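/- Let $\Omega\subset\mathbb{C}$ be a bounded domain, $E\to\Omega$ a holomorphic vector bundle of finite rank, $h$ a smooth Hermitian metric on $E$, and $g\colon\Omega\to[0,\infty)$ a function. Put $\omega=\sqrt{-1}\,dz\wedge d\bar z$, $\Delta(a;r)=\{z\in\mathbb{C} : |z-a|<r\}$ and $\delta(a)=\sup\{r>0 : \Delta(a;r)\subset\Omega\}$. For $a\in\Omega$, $0<r<\delta(a)$ and $\xi\in E_a\setminus\{0\}$ define the $L^2$-extension index $$L_h(a,r,\xi)=\inf\left\{\frac{\int_{\Delta(a;r)}|s|_h^2}{\pi r^2\,|\xi|^2_{h(a)}}\ :\ s \text{ a holomorphic section of } E \text{ on } \Delta(a;r),\ \int_{\Delta(a;r)}|s|^2_h<\infty,\ s(a)=\xi\right\},$$ where the integrals are with respect to Lebesgue measure. Write the Chern curvature of $(E,h)$ as $\sqrt{-1}\Theta_h=\omega\otimes R$ with $R_x\in\mathrm{End}(E_x)$; for $c\in\mathbb{R}$, $\sqrt{-1}\Theta_h(x)\ge c\,\omega\otimes\mathrm{Id}_E$ means $h(R_x\xi,\xi)\ge c\,|\xi|^2_{h(x)}$ for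 all $\xi\in E_x$. Fix $a\in\Omega$ and consider the conditions: 1. for every $\varepsilon>0$ and every $\xi\in E_a\setminus\{0\}$ there exists $r_\varepsilon\in(0,\delta(a))$ such that $L_h(a,r,\xi)\le e^{-\max\{\frac{g(a)-\varepsilon}{2},\,0\}\,r^2}$ for all $r\in(0,r_\varepsilon)$; 2. $\sqrt{-1}\Theta_h(a)\ge g(a)\,\omega\otimes\mathrm{Id}_E$. Then (1) implies (2). Moreover, if $g(a)>0$, or if $\sqrt{-1}\Theta_h\ge 0$ on a neighbourhood of $a$ (for instance, if $\sqrt{-1}\Theta_h(x)\ge g(x)\,\omega\otimes\mathrm{Id}_E$ for all $x\in\Omega$), then (1) and (2) are equivalent. -/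

import Mathlib

open TopologicalSpace Bundle MeasureTheory Topology
open scoped Manifold ContDiff

noncomputable section

namespace L2Extension

variable {Ω : Opens ℂ}

/-- The Wirtinger derivative `∂f/∂z` of a function on an open subset of `ℂ`. -/
def dz (f : Ω → ℂ) (x : Ω) : ℂ :=
  let D : ℂ → ℂ := mfderiv 𝓘(ℝ, ℂ) 𝓘(ℝ, ℂ) f x
  (D 1 - Complex.I * D Complex.I) / 2

/-- The Wirtinger derivative `∂f/∂z̄` of a function on an open subset of `ℂ`. -/
def dzbar (f : Ω → ℂ) (x : Ω) : ℂ :=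
  let D : ℂ → ℂ := mfderiv 𝓘(ℝ, ℂ) 𝓘(ℝ, ℂ) f x
  (D 1 + Complex.I * D Complex.I) / 2

/-- `δ(a) = sup {r > 0 | Δ(a;r) ⊆ Ω}`. -/
def discRadius (a : Ω) : ℝ :=
  sSup {r : ℝ | 0 < r ∧ Metric.ball (a : ℂ) r ⊆ (Ω : Set ℂ)}

/-- Lebesgue measure on `Ω`, i.e. the restriction of the Lebesgue measure of `ℂ`. -/
def lebesgue (Ω : Opens ℂ) : Measure Ω := Measure.comap Subtype.val (volume : Measure ℂ)

section Bundle

variable {n : ℕ} (E : Ω → Type*)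
  [∀ x, AddCommGroup (E x)] [∀ x, Module ℂ (E x)] [∀ x, TopologicalSpace (E x)]
  [TopologicalSpace (TotalSpace (Fin n → ℂ) E)]
  [FiberBundle (Fin n → ℂ) E] [VectorBundle ℂ (Fin n → ℂ) E]

variable (n) in
/-- A smooth Hermitian metric on a rank `n` complex vector bundle `E` over `Ω`: a family of
positive definite Hermitian forms on the fibres (linear in the first argument, conjugate linear in
the second) whose coefficients in the local trivializations are `C^∞` functions of the base point,
in the sense of real differentiability. -/
structure HermitianMetric where
  /-- the Hermitian form `h_x` on `E x` -/
  form : ∀ x, E x →ₗ[ℂ] E x →ₗ⋆[ℂ] ℂ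
  conj_symm : ∀ x (v w : E x), form x w v = starRingEnd ℂ (form x v w)
  pos : ∀ x (v : E x), v ≠ 0 → 0 < (form x v v).re
  smooth : ∀ (e : Trivialization (Fin n → ℂ) (π (Fin n → ℂ) E)) [MemTrivializationAtlas e]
    (v w : Fin n → ℂ),
    ContMDiffOn 𝓘(ℝ, ℂ) 𝓘(ℝ, ℂ) ∞ (fun x : Ω => form x (e.symm x v) (e.symm x w)) e.baseSet

namespace HermitianMetric

variable {E} (h : HermitianMetric n E)

/-- `|v|²_{h(x)}`; note that `h_x(v,v)` is a real number. -/
def normSq (x : Ω) (v : E x) : ℝ := (h.form x v v).re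

/-- The Gram matrix `H_{λμ} = h(e_λ, e_μ)` of the frame `(e_λ)` defined by a trivialization. -/
def gram (e : Trivialization (Fin n → ℂ) (π (Fin n → ℂ) E)) (x : Ω) :
    Matrix (Fin n) (Fin n) ℂ :=
  Matrix.of fun i j => h.form x (e.symm x (Pi.single i 1)) (e.symm x (Pi.single j 1))

/-- The matrix of the Chern connection in a local holomorphic frame `(e_λ)`, i.e. the matrix
`A = (∂H/∂z) H⁻¹` such that `D e_λ = ∑_μ A_{λμ} dz ⊗ e_μ`. -/
def connectionMatrix (e : Trivialization (Fin n → ℂ) (π (Fin n → ℂ) E)) (x : Ω) :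
    Matrix (Fin n) (Fin n) ℂ :=
  Matrix.of (fun i j => dz (fun y => h.gram e y i j) x) * (h.gram e x)⁻¹

/-- The matrix of the Chern curvature `Θ_h = D²` in a local holomorphic frame `(e_λ)`: since
`Θ_h = ∂̄(A dz) = -(∂A/∂z̄) dz ∧ dz̄`, one has `Θ_h e_λ = ∑_μ R_{λμ} dz ∧ dz̄ ⊗ e_μ` with
`R = -∂A/∂z̄`. -/
def curvatureMatrix (e : Trivialization (Fin n → ℂ) (π (Fin n → ℂ) E)) (x : Ω) :
    Matrix (Fin n) (Fin n) ℂ :=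
  Matrix.of fun i j => -dzbar (fun y => h.connectionMatrix e y i j) x

/-- The Chern curvature at `x`, as the endomorphism `R` of the fibre `E x` with
`Θ_h(x) = dz ∧ dz̄ ⊗ R`, that is, `√-1 Θ_h(x) = ω ⊗ R` for `ω = √-1 dz ∧ dz̄`. It does not depend
on the local holomorphic frame in which it is computed. -/
def curvature (x : Ω) : E x →ₗ[ℂ] E x :=
  let e := trivializationAt (Fin n → ℂ) E x
  e.symmₗ ℂ x ∘ₗ (h.curvatureMatrix e x).vecMulLinear ∘ₗ e.linearMapAt ℂ x

/-- `√-1 Θ_h(x) ≥ c ω ⊗ Id_E`, where `ω = √-1 dz ∧ dz̄`, as an inequality of Hermitian forms. -/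
def CurvatureGE (x : Ω) (c : ℝ) : Prop :=
  ∀ ξ : E x, c * h.normSq x ξ ≤ (h.form x (h.curvature x ξ) ξ).re

/-- `s ∈ A²(Δ(a;r), h)`: the section `s` is holomorphic and square integrable on the disc
`Δ(a;r)` (values of `s` outside of the disc are irrelevant). -/
def IsL2Holomorphic (a : Ω) (r : ℝ) (s : ∀ x, E x) : Prop :=
  MDifferentiableOn 𝓘(ℂ, ℂ) (𝓘(ℂ, ℂ).prod 𝓘(ℂ, Fin n → ℂ))
    (fun x => TotalSpace.mk' (Fin n → ℂ) x (s x)) (Metric.ball a r) ∧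
  IntegrableOn (fun x => h.normSq x (s x)) (Metric.ball a r) (lebesgue Ω)

/-- The `L²`-extension index `L_h(a,r,ξ)`, for `0 < r < δ(a)` and `0 ≠ ξ ∈ E_a`. -/
def extensionIndex (a : Ω) (r : ℝ) (ξ : E a) : ℝ :=
  sInf {t : ℝ | ∃ s : ∀ x, E x, h.IsL2Holomorphic a r s ∧ s a = ξ ∧
    t = (∫ x in Metric.ball a r, h.normSq x (s x) ∂(lebesgue Ω)) /
      (Real.pi * r ^ 2 * h.normSq a ξ)}

/-- For every `ε > 0` and every `ξ ∈ E_a ∖ {0}` there is `r_ε ∈ (0, δ(a))` such that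
`L_h(a,r,ξ) ≤ exp(-max((c-ε)/2, 0) r²)` for all `r ∈ (0, r_ε)`. -/
def SharpExtensionBound (a : Ω) (c : ℝ) : Prop :=
  ∀ ε : ℝ, 0 < ε → ∀ ξ : E a, ξ ≠ 0 →
    ∃ rε : ℝ, 0 < rε ∧ rε < discRadius a ∧ ∀ r : ℝ, 0 < r → r < rε →
      h.extensionIndex a r ξ ≤ Real.exp (-(max ((c - ε) / 2) 0 * r ^ 2))

end HermitianMetric

end Bundle

end L2Extension

end

/-! Everything rests on the expansion `L_h(a,r,ξ) = 1 - r² h(Rξ,ξ) / (2|ξ|²) + o(r²)` as `r → 0`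
(`HermitianMetric.tendsto_extensionIndex`). Compare it with `e^{-m r²} = 1 - m r² + o(r²)`, where `m
= max((g(a)-ε)/2, 0)`. Condition (1) forces `h(Rξ,ξ) ≥ 2m|ξ|² ≥ (g(a)-ε)|ξ|²` for every `ε`, which
is (2). Conversely, if `g(a) > 0` then `m < g(a)/2` strictly, and this slack absorbs the `o(r²)`.

For the expansion, take a holomorphic frame with Gram matrix `H` and Chern connection `A`. The
affine section `σ = ξ - z ξA(0)` has vanishing covariant derivative at the centre, and integrating
the Taylor expansion of `|σ|²` over the disc gives the upper bound (`integral_ball_expansion`,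
`wirtBar_wirt_herm_affineSection`). It is optimal up to `o(r⁴)` in the integral
(`integral_affineSection_le`). Indeed, for a competitor `s` the difference `u = s - σ` vanishes at
the centre, and the cross term `⟨u,σ⟩` is a holomorphic function vanishing there, whose integral is
zero, plus `u · o(|z|)`, which `|u|²` absorbs.

If `g(a) = 0`, the expansion does not decide whether `L_h ≤ 1`. When the curvature is semipositive
near `a`, this bound is the extension theorem from a point with sharp constant (`exists_extension`,
`coordIndex_le_one`). By duality (Hahn-Banach and Riesz) it follows from the inequality `π |u(0)|² ≤
R² ∫ |u_z|²/|z|²` in the dual metric, for compactly supported `u` (`sharp_apriori`). That inequality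
comes from a Bochner identity (`integral_bochner`) for the metric `(1-y)H` with a weight `W(y)`, `y
= κ|z|² + d`. The weight is chosen so that, after completing a square, what remains is `κd/y²` times
the squared norm, and `κd/y²` tends to `π` times the Dirac mass as `d → 0`. The functional furnished
by duality is a weak solution of `∂s/∂z̄ = 0`, hence holomorphic by Weyl's lemma
(`exists_holomorphic_of_weak`); radial test functions identify its value at the centre. -/

namespace L2Extension

open Complex ComplexConjugate

/-! ### Wirtinger derivatives of functions on `ℂ` -/

/-- The Wirtinger derivative `∂f/∂z`. -/
noncomputable def wirt (f : ℂ → ℂ) (z : ℂ) : ℂ :=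
  (fderiv ℝ f z 1 - I * fderiv ℝ f z I) / 2

/-- The Wirtinger derivative `∂f/∂z̄`. -/
noncomputable def wirtBar (f : ℂ → ℂ) (z : ℂ) : ℂ :=
  (fderiv ℝ f z 1 + I * fderiv ℝ f z I) / 2

section Scalar

variable {f g : ℂ → ℂ} {z : ℂ}

lemma fderiv_eq_wirt (f : ℂ → ℂ) (z v : ℂ) :
    fderiv ℝ f z v = wirt f z * v + wirtBar f z * conj v := by
  have hv : v = (v.re : ℝ) • (1 : ℂ) + (v.im : ℝ) • I := by
    apply Complex.ext <;> simp
  have h1 : fderiv ℝ f z v = v.re * fderiv ℝ f z 1 + v.im * fderiv ℝ f z I := by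
    conv_lhs => rw [hv]
    rw [map_add, map_smul, map_smul]; simp
  have h2 : v = v.re + v.im * I := (re_add_im v).symm
  have h3 : conj v = v.re - v.im * I := by
    rw [sub_eq_add_neg]; apply Complex.ext <;> simp
  rw [h1, h3, wirt, wirtBar]
  conv_rhs => enter [1, 2]; rw [h2]
  linear_combination (v.im * fderiv ℝ f z I) * Complex.I_sq

lemma wirt_congr (h : f =ᶠ[𝓝 z] g) : wirt f z = wirt g z := by
  simp only [wirt, h.fderiv_eq]

lemma wirtBar_congr (h : f =ᶠ[𝓝 z] g) : wirtBar f z = wirtBar g z := by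
  simp only [wirtBar, h.fderiv_eq]

@[simp] lemma wirt_const (c : ℂ) : wirt (fun _ => c) z = 0 := by simp [wirt]

@[simp] lemma wirtBar_const (c : ℂ) : wirtBar (fun _ => c) z = 0 := by simp [wirtBar]

lemma wirt_add (hf : DifferentiableAt ℝ f z) (hg : DifferentiableAt ℝ g z) :
    wirt (fun w => f w + g w) z = wirt f z + wirt g z := by
  simp only [wirt, fderiv_fun_add hf hg, add_apply]; ring

lemma wirtBar_add (hf : DifferentiableAt ℝ f z) (hg : DifferentiableAt ℝ g z) :
    wirtBar (fun w => f w + g w) z = wirtBar f z + wirtBar g z := by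
  simp only [wirtBar, fderiv_fun_add hf hg, add_apply]; ring

lemma wirt_mul (hf : DifferentiableAt ℝ f z) (hg : DifferentiableAt ℝ g z) :
    wirt (fun w => f w * g w) z = wirt f z * g z + f z * wirt g z := by
  simp only [wirt, fderiv_fun_mul hf hg, add_apply, smul_apply, smul_eq_mul]; ring

lemma wirtBar_mul (hf : DifferentiableAt ℝ f z) (hg : DifferentiableAt ℝ g z) :
    wirtBar (fun w => f w * g w) z = wirtBar f z * g z + f z * wirtBar g z := by
  simp only [wirtBar, fderiv_fun_mul hf hg, add_apply, smul_apply, smul_eq_mul]; ring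

lemma wirt_sum {ι : Type*} (s : Finset ι) {F : ι → ℂ → ℂ}
    (h : ∀ i ∈ s, DifferentiableAt ℝ (F i) z) :
    wirt (fun w => ∑ i ∈ s, F i w) z = ∑ i ∈ s, wirt (F i) z := by
  simp only [wirt, fderiv_fun_sum h, sum_apply, Finset.mul_sum, ← Finset.sum_sub_distrib,
    Finset.sum_div]

lemma wirtBar_sum {ι : Type*} (s : Finset ι) {F : ι → ℂ → ℂ}
    (h : ∀ i ∈ s, DifferentiableAt ℝ (F i) z) :
    wirtBar (fun w => ∑ i ∈ s, F i w) z = ∑ i ∈ s, wirtBar (F i) z := by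
  simp only [wirtBar, fderiv_fun_sum h, sum_apply, Finset.mul_sum, ← Finset.sum_add_distrib,
    Finset.sum_div]

lemma fderiv_conj_comp (hf : DifferentiableAt ℝ f z) (v : ℂ) :
    fderiv ℝ (fun w => conj (f w)) z v = conj (fderiv ℝ f z v) := by
  have := (conjCLE.toContinuousLinearMap.hasFDerivAt.comp z hf.hasFDerivAt).fderiv
  have h2 : (fun w => conj (f w)) = (conjCLE.toContinuousLinearMap : ℂ →L[ℝ] ℂ) ∘ f := by
    ext; simp
  rw [h2, this]; simp

lemma wirt_conj (hf : DifferentiableAt ℝ f z) :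
    wirt (fun w => conj (f w)) z = conj (wirtBar f z) := by
  simp only [wirt, wirtBar, fderiv_conj_comp hf, map_div₀, map_add, map_mul, conj_I, conj_ofNat]
  ring

lemma wirtBar_conj (hf : DifferentiableAt ℝ f z) :
    wirtBar (fun w => conj (f w)) z = conj (wirt f z) := by
  simp only [wirt, wirtBar, fderiv_conj_comp hf, map_div₀, map_sub, map_mul, conj_I, conj_ofNat]
  ring

lemma fderiv_of_differentiableAt_complex (hf : DifferentiableAt ℂ f z) (v : ℂ) :
    fderiv ℝ f z v = deriv f z * v := by
  rw [hf.fderiv_restrictScalars ℝ]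
  simp [mul_comm]

lemma wirtBar_eq_zero (hf : DifferentiableAt ℂ f z) : wirtBar f z = 0 := by
  simp only [wirtBar, fderiv_of_differentiableAt_complex hf]
  linear_combination (deriv f z / 2) * Complex.I_sq

@[simp] lemma wirt_id : wirt (fun w => w) z = 1 := by simp [wirt]

@[simp] lemma wirtBar_id : wirtBar (fun w => w) z = 0 := by simp [wirtBar]

@[simp] lemma wirt_conj_id : wirt (fun w => conj w) z = 0 := by
  rw [wirt_conj (f := fun w => w) differentiableAt_id]; simp

@[simp] lemma wirtBar_conj_id : wirtBar (fun w => conj w) z = 1 := by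
  rw [wirtBar_conj (f := fun w => w) differentiableAt_id]; simp

lemma differentiableAt_complex_of_wirtBar_eq_zero (hf : DifferentiableAt ℝ f z)
    (h : wirtBar f z = 0) : DifferentiableAt ℂ f z := by
  refine (HasDerivAt.hasFDerivAt (f' := wirt f z) ?_).differentiableAt
  refine hasDerivAt_iff_hasFDerivAt.2 ?_
  refine hasFDerivAt_of_restrictScalars ℝ hf.hasFDerivAt ?_
  ext v; simp [fderiv_eq_wirt, h, mul_comm]

/-- Chain rule for a real function of a real-valued function. -/
lemma wirt_ofReal_comp {φ : ℝ → ℝ} {u : ℂ → ℝ} {φ' : ℝ} (hφ : HasDerivAt φ φ' (u z))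
    (hu : DifferentiableAt ℝ u z) :
    wirt (fun w => (φ (u w) : ℂ)) z = φ' * wirt (fun w => (u w : ℂ)) z := by
  have h1 : HasFDerivAt (fun w => (u w : ℂ)) (ofRealCLM.comp (fderiv ℝ u z)) z :=
    ofRealCLM.hasFDerivAt.comp z hu.hasFDerivAt
  have h2 : HasFDerivAt (fun w => (φ (u w) : ℂ)) (ofRealCLM.comp (φ' • fderiv ℝ u z)) z :=
    ofRealCLM.hasFDerivAt.comp z (hφ.comp_hasFDerivAt z hu.hasFDerivAt)
  simp only [wirt, h1.fderiv, h2.fderiv]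
  simp; ring

lemma wirtBar_ofReal_comp {φ : ℝ → ℝ} {u : ℂ → ℝ} {φ' : ℝ} (hφ : HasDerivAt φ φ' (u z))
    (hu : DifferentiableAt ℝ u z) :
    wirtBar (fun w => (φ (u w) : ℂ)) z = φ' * wirtBar (fun w => (u w : ℂ)) z := by
  have h1 : HasFDerivAt (fun w => (u w : ℂ)) (ofRealCLM.comp (fderiv ℝ u z)) z :=
    ofRealCLM.hasFDerivAt.comp z hu.hasFDerivAt
  have h2 : HasFDerivAt (fun w => (φ (u w) : ℂ)) (ofRealCLM.comp (φ' • fderiv ℝ u z)) z :=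
    ofRealCLM.hasFDerivAt.comp z (hφ.comp_hasFDerivAt z hu.hasFDerivAt)
  simp only [wirtBar, h1.fderiv, h2.fderiv]
  simp; ring

lemma contDiff_fderiv_apply (hf : ContDiff ℝ ∞ f) (v : ℂ) :
    ContDiff ℝ ∞ (fun z => fderiv ℝ f z v) :=
  (hf.fderiv_right (m := ∞) (by simp)).clm_apply contDiff_const

lemma contDiff_wirt (hf : ContDiff ℝ ∞ f) : ContDiff ℝ ∞ (wirt f) :=
  ((contDiff_fderiv_apply hf 1).sub (contDiff_const.mul (contDiff_fderiv_apply hf I))).div_const 2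

lemma contDiff_wirtBar (hf : ContDiff ℝ ∞ f) : ContDiff ℝ ∞ (wirtBar f) :=
  ((contDiff_fderiv_apply hf 1).add (contDiff_const.mul (contDiff_fderiv_apply hf I))).div_const 2

lemma fderiv_fderiv_apply (hf : ContDiff ℝ ∞ f) (v w : ℂ) :
    fderiv ℝ (fun z => fderiv ℝ f z v) z w = fderiv ℝ (fderiv ℝ f) z w v := by
  have h1 : DifferentiableAt ℝ (fderiv ℝ f) z :=
    ((hf.fderiv_right (m := ∞) (by simp)).differentiable (by simp)).differentiableAt
  rw [(h1.hasFDerivAt.clm_apply (hasFDerivAt_const v z)).fderiv]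
  simp

/-- Both sides are a quarter of the Laplacian, by symmetry of the second derivative. -/
lemma wirtBar_wirt (hf : ContDiff ℝ ∞ f) (z : ℂ) : wirtBar (wirt f) z = wirt (wirtBar f) z := by
  have hd : ∀ v, DifferentiableAt ℝ (fun z => fderiv ℝ f z v) z := fun v =>
    ((contDiff_fderiv_apply hf v).differentiable (by simp)).differentiableAt
  have hs : IsSymmSndFDerivAt ℝ f z := hf.contDiffAt.isSymmSndFDerivAt (by
    rw [minSmoothness_of_isRCLikeNormedField]; exact WithTop.coe_le_coe.2 (le_top : (2 : ℕ∞) ≤ ⊤))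
  have h1 : ∀ v, fderiv ℝ (wirt f) z v =
      (fderiv ℝ (fderiv ℝ f) z v 1 - I * fderiv ℝ (fderiv ℝ f) z v I) / 2 := by
    intro v
    have : HasFDerivAt (wirt f) _ z :=
      (((hd 1).hasFDerivAt.sub ((hd I).hasFDerivAt.const_mul I)).mul_const (2⁻¹ : ℂ))
    rw [this.fderiv]
    simp [fderiv_fderiv_apply hf]; ring
  have h2 : ∀ v, fderiv ℝ (wirtBar f) z v =
      (fderiv ℝ (fderiv ℝ f) z v 1 + I * fderiv ℝ (fderiv ℝ f) z v I) / 2 := by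
    intro v
    have : HasFDerivAt (wirtBar f) _ z :=
      (((hd 1).hasFDerivAt.add ((hd I).hasFDerivAt.const_mul I)).mul_const (2⁻¹ : ℂ))
    rw [this.fderiv]
    simp [fderiv_fderiv_apply hf]; ring
  rw [wirtBar, wirt, h1, h1, h2, h2, hs I 1]
  ring

lemma hasCompactSupport_wirt (hf : HasCompactSupport f) : HasCompactSupport (wirt f) := by
  have h1 := hf.fderiv (𝕜 := ℝ)
  refine h1.mono fun z hz => ?_
  simp only [Function.mem_support, ne_eq] at hz ⊢
  exact fun h => hz (by simp [L2Extension.wirt, h])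

lemma hasCompactSupport_wirtBar (hf : HasCompactSupport f) : HasCompactSupport (wirtBar f) := by
  have h1 := hf.fderiv (𝕜 := ℝ)
  refine h1.mono fun z hz => ?_
  simp only [Function.mem_support, ne_eq] at hz ⊢
  exact fun h => hz (by simp [L2Extension.wirtBar, h])

lemma integral_fderiv_eq_zero (hf : ContDiff ℝ ∞ f) (hc : HasCompactSupport f) (v : ℂ) :
    ∫ z, fderiv ℝ f z v = 0 := by
  have hi : Integrable (fun z => fderiv ℝ f z v) :=
    (contDiff_fderiv_apply hf v).continuous.integrable_of_hasCompactSupport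
      ((hc.fderiv (𝕜 := ℝ)).mono fun z hz h => hz (by simp [h]))
  -- Integration by parts against the constant function `1`.
  have := integral_smul_fderiv_eq_neg_fderiv_smul_of_integrable (μ := volume)
    (f := fun _ : ℂ => (1 : ℂ)) (g := f) (v := v) (by simp) (by simpa using hi)
    (by simpa using hf.continuous.integrable_of_hasCompactSupport hc)
    (fun _ _ => by fun_prop) (fun x _ => (hf.differentiable (by simp)).differentiableAt)
  simpa using this

lemma integral_wirt_eq_zero (hf : ContDiff ℝ ∞ f) (hc : HasCompactSupport f) :
    ∫ z, wirt f z = 0 := by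
  have hi : ∀ v, Integrable (fun z => fderiv ℝ f z v) := fun v =>
    (contDiff_fderiv_apply hf v).continuous.integrable_of_hasCompactSupport
      ((hc.fderiv (𝕜 := ℝ)).mono fun z hz h => hz (by simp [h]))
  simp only [wirt]
  rw [integral_div, integral_sub (hi 1) ((hi I).const_mul I), integral_const_mul,
    integral_fderiv_eq_zero hf hc, integral_fderiv_eq_zero hf hc]
  simp

lemma integral_wirtBar_eq_zero (hf : ContDiff ℝ ∞ f) (hc : HasCompactSupport f) :
    ∫ z, wirtBar f z = 0 := by
  have hi : ∀ v, Integrable (fun z => fderiv ℝ f z v) := fun v =>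
    (contDiff_fderiv_apply hf v).continuous.integrable_of_hasCompactSupport
      ((hc.fderiv (𝕜 := ℝ)).mono fun z hz h => hz (by simp [h]))
  simp only [wirtBar]
  rw [integral_div, integral_add (hi 1) ((hi I).const_mul I), integral_const_mul,
    integral_fderiv_eq_zero hf hc, integral_fderiv_eq_zero hf hc]
  simp

lemma wirt_sub (hf : DifferentiableAt ℝ f z) (hg : DifferentiableAt ℝ g z) :
    wirt (fun w => f w - g w) z = wirt f z - wirt g z := by
  simp only [wirt, fderiv_fun_sub hf hg, sub_apply]; ring

end Scalar

/-! ### Wirtinger derivatives of matrix valued functions -/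

section Matrix

open Matrix

variable {k m n : Type*}

/-- The entrywise derivative `∂F/∂z` of a matrix valued function. -/
noncomputable def wirtM (F : ℂ → Matrix m n ℂ) (z : ℂ) : Matrix m n ℂ :=
  Matrix.of fun i j => wirt (fun w => F w i j) z

/-- The entrywise derivative `∂F/∂z̄` of a matrix valued function. -/
noncomputable def wirtBarM (F : ℂ → Matrix m n ℂ) (z : ℂ) : Matrix m n ℂ :=
  Matrix.of fun i j => wirtBar (fun w => F w i j) z

/-- Matrix valued functions with smooth entries. -/
def SmoothM (F : ℂ → Matrix m n ℂ) : Prop :=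
  ∀ i j, ContDiff ℝ ∞ fun z => F z i j

variable {F : ℂ → Matrix k m ℂ} {G : ℂ → Matrix m n ℂ} {z : ℂ}

lemma SmoothM.differentiableAt (hF : SmoothM F) (i : k) (j : m) :
    DifferentiableAt ℝ (fun w => F w i j) z :=
  ((hF i j).differentiable (by simp)).differentiableAt

lemma SmoothM.continuous (hF : SmoothM F) : Continuous F :=
  continuous_matrix fun i j => (hF i j).continuous

lemma SmoothM.const (M : Matrix k m ℂ) : SmoothM (fun _ => M) := fun _ _ => contDiff_const

lemma SmoothM.add {F' : ℂ → Matrix k m ℂ} (hF : SmoothM F) (hF' : SmoothM F') :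
    SmoothM (fun z => F z + F' z) := fun i j => (hF i j).add (hF' i j)

lemma SmoothM.smul {φ : ℂ → ℂ} (hφ : ContDiff ℝ ∞ φ) (hF : SmoothM F) :
    SmoothM (fun z => φ z • F z) := fun i j => hφ.mul (hF i j)

lemma SmoothM.mul [Fintype m] (hF : SmoothM F) (hG : SmoothM G) :
    SmoothM (fun z => F z * G z) := fun i j => by
  simp only [Matrix.mul_apply]
  exact ContDiff.sum fun l _ => (hF i l).mul (hG l j)

lemma SmoothM.conjTranspose (hF : SmoothM F) : SmoothM (fun z => (F z)ᴴ) := fun i j => by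
  simp only [Matrix.conjTranspose_apply]
  exact conjCLE.contDiff.comp (hF j i)

lemma SmoothM.wirtM (hF : SmoothM F) : SmoothM (wirtM F) := fun i j => contDiff_wirt (hF i j)

lemma SmoothM.wirtBarM (hF : SmoothM F) : SmoothM (wirtBarM F) :=
  fun i j => contDiff_wirtBar (hF i j)

lemma SmoothM.det [Fintype m] [DecidableEq m] {F : ℂ → Matrix m m ℂ} (hF : SmoothM F) :
    ContDiff ℝ ∞ fun z => (F z).det := by
  simp only [Matrix.det_apply]
  refine ContDiff.sum fun σ _ => ?_
  simp only [Units.smul_def, zsmul_eq_mul]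
  exact contDiff_const.mul (contDiff_prod fun i _ => hF _ _)

/-- Cramer's rule: the entries of the inverse are cofactors divided by the determinant. -/
lemma SmoothM.inv [Fintype m] [DecidableEq m] {F : ℂ → Matrix m m ℂ} (hF : SmoothM F)
    (h : ∀ z, (F z).det ≠ 0) : SmoothM fun z => (F z)⁻¹ := by
  intro i j
  simp only [Matrix.inv_def, Ring.inverse_eq_inv', Matrix.smul_apply, smul_eq_mul]
  refine (hF.det.inv h).mul ?_
  simp only [Matrix.adjugate_apply]
  refine SmoothM.det (F := fun z => (F z).updateRow j (Pi.single i 1)) fun a b => ?_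
  by_cases hab : a = j
  · subst hab; simpa using contDiff_const
  · simpa [Matrix.updateRow_ne hab] using hF a b

lemma wirtM_add {F' : ℂ → Matrix k m ℂ} (hF : SmoothM F) (hF' : SmoothM F') :
    wirtM (fun z => F z + F' z) z = wirtM F z + wirtM F' z := by
  ext i j; exact wirt_add (hF.differentiableAt i j) (hF'.differentiableAt i j)

lemma wirtBarM_add {F' : ℂ → Matrix k m ℂ} (hF : SmoothM F) (hF' : SmoothM F') :
    wirtBarM (fun z => F z + F' z) z = wirtBarM F z + wirtBarM F' z := by
  ext i j; exact wirtBar_add (hF.differentiableAt i j) (hF'.differentiableAt i j)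

lemma wirtM_smul {φ : ℂ → ℂ} (hφ : ContDiff ℝ ∞ φ) (hF : SmoothM F) :
    wirtM (fun z => φ z • F z) z = wirt φ z • F z + φ z • wirtM F z := by
  ext i j
  exact wirt_mul (hφ.differentiable (by simp)).differentiableAt (hF.differentiableAt i j)

lemma wirtBarM_smul {φ : ℂ → ℂ} (hφ : ContDiff ℝ ∞ φ) (hF : SmoothM F) :
    wirtBarM (fun z => φ z • F z) z = wirtBar φ z • F z + φ z • wirtBarM F z := by
  ext i j
  exact wirtBar_mul (hφ.differentiable (by simp)).differentiableAt (hF.differentiableAt i j)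

lemma wirtM_mul [Fintype m] (hF : SmoothM F) (hG : SmoothM G) :
    wirtM (fun z => F z * G z) z = wirtM F z * G z + F z * wirtM G z := by
  ext i j
  simp only [wirtM, Matrix.of_apply, Matrix.mul_apply, Matrix.add_apply]
  rw [wirt_sum (F := fun l w => F w i l * G w l j) _
    fun l _ => (hF.differentiableAt i l).fun_mul (hG.differentiableAt l j), ← Finset.sum_add_distrib]
  exact Finset.sum_congr rfl fun l _ =>
    wirt_mul (hF.differentiableAt i l) (hG.differentiableAt l j)

lemma wirtBarM_mul [Fintype m] (hF : SmoothM F) (hG : SmoothM G) :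
    wirtBarM (fun z => F z * G z) z = wirtBarM F z * G z + F z * wirtBarM G z := by
  ext i j
  simp only [wirtBarM, Matrix.of_apply, Matrix.mul_apply, Matrix.add_apply]
  rw [wirtBar_sum (F := fun l w => F w i l * G w l j) _
    fun l _ => (hF.differentiableAt i l).fun_mul (hG.differentiableAt l j), ← Finset.sum_add_distrib]
  exact Finset.sum_congr rfl fun l _ =>
    wirtBar_mul (hF.differentiableAt i l) (hG.differentiableAt l j)

lemma wirtM_conjTranspose (hF : SmoothM F) :
    wirtM (fun z => (F z)ᴴ) z = (wirtBarM F z)ᴴ := by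
  ext i j; exact wirt_conj (hF.differentiableAt j i)

lemma wirtBarM_conjTranspose (hF : SmoothM F) :
    wirtBarM (fun z => (F z)ᴴ) z = (wirtM F z)ᴴ := by
  ext i j; exact wirtBar_conj (hF.differentiableAt j i)

lemma wirtBarM_wirtM (hF : SmoothM F) : wirtBarM (wirtM F) z = wirtM (wirtBarM F) z := by
  ext i j; exact wirtBar_wirt (hF i j) z

end Matrix

end L2Extension

/-! ### Hermitian pairings of row vectors and the Bochner identity -/

namespace L2Extension

open Complex ComplexConjugate Matrix
open scoped ComplexOrder

section Herm

variable {ι : Type*} [Fintype ι]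

/-- The sesquilinear pairing `a H b*` of row vectors. -/
noncomputable def herm (H : Matrix ι ι ℂ) (a b : Matrix Unit ι ℂ) : ℂ := (a * H * bᴴ) () ()

lemma herm_add_left (H : Matrix ι ι ℂ) (a a' b : Matrix Unit ι ℂ) :
    herm H (a + a') b = herm H a b + herm H a' b := by simp [herm, Matrix.add_mul]

lemma herm_add_right (H : Matrix ι ι ℂ) (a b b' : Matrix Unit ι ℂ) :
    herm H a (b + b') = herm H a b + herm H a b' := by simp [herm, Matrix.mul_add]

lemma herm_smul_left (H : Matrix ι ι ℂ) (c : ℂ) (a b : Matrix Unit ι ℂ) :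
    herm H (c • a) b = c * herm H a b := by simp [herm]

lemma herm_smul_right (H : Matrix ι ι ℂ) (c : ℂ) (a b : Matrix Unit ι ℂ) :
    herm H a (c • b) = conj c * herm H a b := by simp [herm]

lemma herm_smul (c : ℂ) (H : Matrix ι ι ℂ) (a b : Matrix Unit ι ℂ) :
    herm (c • H) a b = c * herm H a b := by simp [herm]

@[simp] lemma herm_zero_left (H : Matrix ι ι ℂ) (b : Matrix Unit ι ℂ) : herm H 0 b = 0 := by
  simp [herm]

@[simp] lemma herm_zero_right (H : Matrix ι ι ℂ) (b : Matrix Unit ι ℂ) : herm H b 0 = 0 := by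
  simp [herm]

lemma conj_herm {H : Matrix ι ι ℂ} (hH : H.IsHermitian) (a b : Matrix Unit ι ℂ) :
    conj (herm H a b) = herm H b a := by
  have : (a * H * bᴴ)ᴴ = b * H * aᴴ := by
    simp [Matrix.conjTranspose_mul, hH.eq, Matrix.mul_assoc]
  rw [herm, herm, ← this]; rfl

lemma herm_self_im {H : Matrix ι ι ℂ} (hH : H.IsHermitian) (a : Matrix Unit ι ℂ) :
    (herm H a a).im = 0 := by
  simpa using (conj_eq_iff_im.1 (conj_herm hH a a))

lemma herm_self_ofReal {H : Matrix ι ι ℂ} (hH : H.IsHermitian) (a : Matrix Unit ι ℂ) :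
    (((herm H a a).re : ℝ) : ℂ) = herm H a a :=
  Complex.ext (by simp) (by simp [herm_self_im hH])

lemma herm_eq_sum (H : Matrix ι ι ℂ) (a b : Matrix Unit ι ℂ) :
    herm H a b = ∑ j, (∑ i, a () i * H i j) * conj (b () j) := by
  simp [herm, Matrix.mul_apply]

lemma herm_self_nonneg {H : Matrix ι ι ℂ} (hH : H.PosSemidef) (a : Matrix Unit ι ℂ) :
    0 ≤ (herm H a a).re := by
  have h := (hH.mul_mul_conjTranspose_same a).diag_nonneg (i := ())
  exact (Complex.le_def.1 h).1

lemma herm_self_pos {H : Matrix ι ι ℂ} (hH : H.PosDef) {a : Matrix Unit ι ℂ} (ha : a ≠ 0) :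
    0 < (herm H a a).re := by
  have hinj : Function.Injective aᴴ.mulVec := by
    obtain ⟨i, hi⟩ : ∃ i, a () i ≠ 0 := by
      by_contra! h
      exact ha (by ext _ i; exact h i)
    intro v w hvw
    have h := congrFun hvw i
    simp only [Matrix.mulVec, dotProduct, Finset.univ_unique, Finset.sum_singleton,
      conjTranspose_apply] at h
    ext u
    exact mul_left_cancel₀ (star_ne_zero.2 hi) h
  have h := (hH.conjTranspose_mul_mul_same (B := aᴴ) hinj).diag_pos (i := ())
  rw [conjTranspose_conjTranspose] at h
  exact (Complex.lt_def.1 h).1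

/-- Cauchy-Schwarz. -/
lemma norm_herm_sq_le {H : Matrix ι ι ℂ} (hH : H.PosSemidef) (a b : Matrix Unit ι ℂ) :
    ‖herm H a b‖ ^ 2 ≤ (herm H a a).re * (herm H b b).re := by
  -- The form evaluated at `a + t⟨a,b⟩b` is a nonnegative quadratic polynomial in the real variable
  -- `t`; the factor `⟨a,b⟩` makes the cross term real.
  have key : ∀ t : ℝ, 0 ≤ (herm H b b).re * ‖herm H a b‖ ^ 2 * (t * t)
      + 2 * ‖herm H a b‖ ^ 2 * t + (herm H a a).re := by
    intro t
    have h0 := herm_self_nonneg hH (a + ((t : ℂ) * herm H a b) • b)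
    have e : herm H (a + ((t : ℂ) * herm H a b) • b) (a + ((t : ℂ) * herm H a b) • b)
        = herm H a a + 2 * t * (herm H a b * conj (herm H a b))
          + t * t * (herm H a b * conj (herm H a b)) * herm H b b := by
      simp only [herm_add_left, herm_add_right, herm_smul_left, herm_smul_right, map_mul,
        conj_ofReal, ← conj_herm hH.isHermitian a b]
      ring
    rw [e, Complex.mul_conj, ← herm_self_ofReal hH.isHermitian b, Complex.normSq_eq_norm_sq] at h0
    norm_cast at h0
    simp only [add_re, ofReal_re] at h0
    linarith
  have := discrim_le_zero key
  rw [discrim] at this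
  -- The discriminant inequality carries a superfluous factor `‖⟨a,b⟩‖²`, which can only be
  -- cancelled if it is nonzero.
  by_cases h0 : ‖herm H a b‖ = 0
  · rw [h0]; simpa using mul_nonneg (herm_self_nonneg hH a) (herm_self_nonneg hH b)
  · have : 0 < ‖herm H a b‖ ^ 2 := by positivity
    nlinarith

variable {H A : ℂ → Matrix ι ι ℂ} {a b γ : ℂ → Matrix Unit ι ℂ} {z : ℂ}

lemma contDiff_herm (hH : SmoothM H) (ha : SmoothM a) (hb : SmoothM b) :
    ContDiff ℝ ∞ fun z => herm (H z) (a z) (b z) :=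
  ((ha.mul hH).mul hb.conjTranspose) () ()

/-- This is the adjoint of the equation `H_z = A H`. -/
lemma wirtBarM_of_hermitian (hH : SmoothM H) (hHh : ∀ z, (H z).IsHermitian)
    (hHA : wirtM H z = A z * H z) : wirtBarM H z = H z * (A z)ᴴ := by
  have h1 : wirtBarM H z = wirtBarM (fun z => (H z)ᴴ) z := by
    congr 1; ext1 w; exact (hHh w).eq.symm
  rw [h1, wirtBarM_conjTranspose hH, hHA, Matrix.conjTranspose_mul, (hHh z).eq]

/-- Compatibility of the Chern connection with the metric: on rows its `(1,0)` part is `Da = a_z +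
aA` and its `(0,1)` part is `∂/∂z̄`. -/
lemma wirt_herm (hH : SmoothM H) (ha : SmoothM a) (hb : SmoothM b)
    (hHA : wirtM H z = A z * H z) :
    wirt (fun z => herm (H z) (a z) (b z)) z =
      herm (H z) (wirtM a z + a z * A z) (b z) + herm (H z) (a z) (wirtBarM b z) := by
  have h := wirtM_mul (z := z) (ha.mul hH) hb.conjTranspose
  rw [wirtM_mul ha hH, wirtM_conjTranspose hb, hHA] at h
  have h2 := congrFun (congrFun h ()) ()
  refine h2.trans ?_
  simp [herm, Matrix.add_mul, Matrix.mul_assoc]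

lemma wirtBar_herm (hH : SmoothM H) (hHh : ∀ z, (H z).IsHermitian) (ha : SmoothM a)
    (hb : SmoothM b) (hHA : wirtM H z = A z * H z) :
    wirtBar (fun z => herm (H z) (a z) (b z)) z =
      herm (H z) (wirtBarM a z) (b z) + herm (H z) (a z) (wirtM b z + b z * A z) := by
  have h := wirtBarM_mul (z := z) (ha.mul hH) hb.conjTranspose
  rw [wirtBarM_mul ha hH, wirtBarM_conjTranspose hb, wirtBarM_of_hermitian hH hHh hHA] at h
  have h2 := congrFun (congrFun h ()) ()
  refine h2.trans ?_
  simp [herm, Matrix.add_mul, Matrix.mul_add, Matrix.mul_assoc, conjTranspose_mul]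
  ring

/-- The integrand of the Bochner identity `integral_bochner`. -/
noncomputable def bochnerIntegrand (W : ℂ → ℂ) (H A : ℂ → Matrix ι ι ℂ)
    (γ : ℂ → Matrix Unit ι ℂ) (z : ℂ) : ℂ :=
  wirt (wirtBar W) z * herm (H z) (γ z) (γ z)
    + wirtBar W z * herm (H z) (wirtM γ z + γ z * A z) (γ z)
    + wirt W z * herm (H z) (γ z) (wirtM γ z + γ z * A z)
    + W z * herm (H z) (wirtM γ z + γ z * A z) (wirtM γ z + γ z * A z)
    - W z * herm (H z) (wirtBarM γ z) (wirtBarM γ z)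
    + W z * herm (H z) (γ z) (γ z * wirtBarM A z)

/-- The Bochner identity for a compactly supported section `γ` of a bundle with metric `H` and
Chern connection `A dz`. -/
theorem integral_bochner (hH : SmoothM H) (hHh : ∀ z, (H z).IsHermitian) (hA : SmoothM A)
    (hHA : ∀ z, wirtM H z = A z * H z) (hγ : SmoothM γ) (hγc : HasCompactSupport γ)
    {W : ℂ → ℂ} (hW : ContDiff ℝ ∞ W) :
    Integrable (bochnerIntegrand W H A γ) ∧ ∫ z, bochnerIntegrand W H A γ z = 0 := by
  have hβ : SmoothM (fun z => wirtM γ z + γ z * A z) := hγ.wirtM.add (hγ.mul hA)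
  -- The integrand is `∂Y1 - ∂̄Y2 + ∂Y3`, a combination of derivatives of compactly supported
  -- functions. The term `W_z̄ ⟨γ, γ_z̄⟩` cancels between `Y1` and `Y2`. The second derivatives of
  -- `γ` in `Y2` and `Y3` cancel up to the commutator of `∂̄` and `D`, which is `γ A_z̄`, the
  -- curvature term.
  set Y1 : ℂ → ℂ := fun z => wirtBar W z * herm (H z) (γ z) (γ z) with hY1
  set Y2 : ℂ → ℂ := fun z => W z * herm (H z) (γ z) (wirtBarM γ z) with hY2
  set Y3 : ℂ → ℂ := fun z => W z * herm (H z) (γ z) (wirtM γ z + γ z * A z) with hY3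
  have hN := contDiff_herm hH hγ hγ
  have hNb := contDiff_herm hH hγ hγ.wirtBarM
  have hNβ := contDiff_herm hH hγ hβ
  have s1 : ContDiff ℝ ∞ Y1 := (contDiff_wirtBar hW).mul hN
  have s2 : ContDiff ℝ ∞ Y2 := hW.mul hNb
  have s3 : ContDiff ℝ ∞ Y3 := hW.mul hNβ
  have c1 : HasCompactSupport Y1 := hγc.mono fun z hz h => hz (by simp [hY1, h])
  have c2 : HasCompactSupport Y2 := hγc.mono fun z hz h => hz (by simp [hY2, h])
  have c3 : HasCompactSupport Y3 := hγc.mono fun z hz h => hz (by simp [hY3, h])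
  have hd : ∀ {f : ℂ → ℂ} {z : ℂ}, ContDiff ℝ ∞ f → DifferentiableAt ℝ f z :=
    fun hf => (hf.differentiable (by simp)).differentiableAt
  have i1 := (contDiff_wirt s1).continuous.integrable_of_hasCompactSupport (μ := volume)
    (hasCompactSupport_wirt c1)
  have i2 := (contDiff_wirtBar s2).continuous.integrable_of_hasCompactSupport (μ := volume)
    (hasCompactSupport_wirtBar c2)
  have i3 := (contDiff_wirt s3).continuous.integrable_of_hasCompactSupport (μ := volume)
    (hasCompactSupport_wirt c3)
  have h12 : Integrable fun z => wirt Y1 z - wirtBar Y2 z := i1.sub i2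
  have hi : Integrable fun z => wirt Y1 z - wirtBar Y2 z + wirt Y3 z := h12.add i3
  have hz : ∫ z, (wirt Y1 z - wirtBar Y2 z + wirt Y3 z) = 0 := by
    rw [integral_add h12 i3, integral_sub i1 i2, integral_wirt_eq_zero s1 c1,
      integral_wirtBar_eq_zero s2 c2, integral_wirt_eq_zero s3 c3]
    simp
  suffices h : (fun z => wirt Y1 z - wirtBar Y2 z + wirt Y3 z) =
      bochnerIntegrand W H A γ from h ▸ ⟨hi, hz⟩
  ext1 z
  rw [bochnerIntegrand, hY1, hY2, hY3, wirt_mul (hd (contDiff_wirtBar hW)) (hd hN), wirtBar_mul (hd hW) (hd hNb),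
    wirt_mul (hd hW) (hd hNβ), wirt_herm hH hγ hγ (hHA z), wirt_herm hH hγ hβ (hHA z),
    wirtBar_herm hH hHh hγ hγ.wirtBarM (hHA z), wirtBarM_add hγ.wirtM (hγ.mul hA),
    wirtBarM_wirtM hγ, wirtBarM_mul hγ hA]
  simp only [herm_add_right]
  ring

end Herm

end L2Extension

/-! ### Radial weights for the sharp constant -/

namespace L2Extension

open Complex ComplexConjugate Matrix
open scoped ComplexOrder

section Weights

/-- The regularised squared modulus `κ|z|² + d`. -/
noncomputable def regSq (κ d : ℝ) (z : ℂ) : ℝ := κ * normSq z + d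

variable {κ d : ℝ} {z : ℂ}

lemma contDiff_regSq : ContDiff ℝ ∞ (regSq κ d) := by
  have : regSq κ d = fun z : ℂ => κ * ‖z‖ ^ 2 + d := by
    ext z; rw [regSq, Complex.normSq_eq_norm_sq]
  rw [this]
  exact (contDiff_const.mul (contDiff_norm_sq ℝ)).add contDiff_const

lemma differentiableAt_regSq : DifferentiableAt ℝ (regSq κ d) z :=
  (contDiff_regSq.differentiable (by simp)).differentiableAt

lemma regSq_pos (hκ : 0 ≤ κ) (hd : 0 < d) : 0 < regSq κ d z := by
  have := mul_nonneg hκ (normSq_nonneg z)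
  rw [regSq]; linarith

lemma regSq_lt_one {R : ℝ} (hκ : 0 < κ) (h : κ * R ^ 2 + d = 1) (hz : z ∈ Metric.ball 0 R) :
    regSq κ d z < 1 := by
  have hz' : ‖z‖ < R := by simpa using hz
  have : ‖z‖ ^ 2 < R ^ 2 := by gcongr
  rw [regSq, Complex.normSq_eq_norm_sq, ← h]
  nlinarith

lemma ofReal_regSq (z : ℂ) : ((regSq κ d z : ℝ) : ℂ) = κ * (z * conj z) + d := by
  rw [Complex.mul_conj, regSq]; push_cast; rfl

lemma wirt_regSq : wirt (fun w => ((regSq κ d w : ℝ) : ℂ)) z = κ * conj z := by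
  have hc : DifferentiableAt ℝ (fun w : ℂ => conj w) z := conjCLE.differentiableAt
  simp only [ofReal_regSq]
  rw [wirt_add (by fun_prop) (by fun_prop), wirt_mul (by fun_prop) (by fun_prop),
    wirt_mul (by fun_prop) hc]
  simp

lemma wirtBar_regSq : wirtBar (fun w => ((regSq κ d w : ℝ) : ℂ)) z = κ * z := by
  have hc : DifferentiableAt ℝ (fun w : ℂ => conj w) z := conjCLE.differentiableAt
  simp only [ofReal_regSq]
  rw [wirtBar_add (by fun_prop) (by fun_prop), wirtBar_mul (by fun_prop) (by fun_prop),
    wirtBar_mul (by fun_prop) hc]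
  simp

/-- The weight `(1 + log t - t) / (1 - t)`. -/
noncomputable def logWeight (t : ℝ) : ℝ := (1 + Real.log t - t) / (1 - t)

/-- The derivative of `logWeight`. -/
noncomputable def logWeight' (t : ℝ) : ℝ := 1 / t + (1 + Real.log t - t) / (1 - t) ^ 2

/-- The second derivative of `logWeight`. -/
noncomputable def logWeight'' (t : ℝ) : ℝ :=
  -1 / t ^ 2 + 1 / (t * (1 - t)) + 2 * (1 + Real.log t - t) / (1 - t) ^ 3

variable {t : ℝ}

/-- This sign makes the `|γ_z̄|²` term and the curvature term of the Bochner identity nonnegative,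
so both may be dropped. -/
lemma logWeight_nonpos (h0 : 0 < t) (h1 : t < 1) : logWeight t ≤ 0 :=
  div_nonpos_of_nonpos_of_nonneg (by linarith [Real.log_le_sub_one_of_pos h0]) (by linarith)

/-- The derivative multiplies the completed square in `logWeight_pointwise`, so its sign is needed
there. It follows from `log x ≤ x - 1` at `x = 1/t`. -/
lemma logWeight'_nonneg (h0 : 0 < t) (h1 : t < 1) : 0 ≤ logWeight' t := by
  have h2 := Real.log_le_sub_one_of_pos (inv_pos.2 h0)
  rw [Real.log_inv] at h2
  have h3 : 0 < 1 - t := by linarith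
  have : logWeight' t = (1 / t - 1 + Real.log t) / (1 - t) ^ 2 := by
    rw [logWeight']; field_simp; ring
  rw [this, one_div]
  exact div_nonneg (by linarith) (by positivity)

lemma hasDerivAt_logNum (h0 : 0 < t) :
    HasDerivAt (fun t => 1 + Real.log t - t) (1 / t - 1) t := by
  have h := ((Real.hasDerivAt_log h0.ne').const_add 1).fun_sub (hasDerivAt_id' t)
  rwa [← one_div] at h

lemma hasDerivAt_logWeight (h0 : 0 < t) (h1 : t < 1) :
    HasDerivAt logWeight (logWeight' t) t := by
  have h3 : 1 - t ≠ 0 := by linarith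
  have := (hasDerivAt_logNum h0).div ((hasDerivAt_id t).const_sub 1) (by simpa using h3)
  refine this.congr_deriv ?_
  simp only [id, logWeight']
  field_simp; ring

lemma hasDerivAt_logWeight' (h0 : 0 < t) (h1 : t < 1) :
    HasDerivAt logWeight' (logWeight'' t) t := by
  have h3 : 1 - t ≠ 0 := by linarith
  have h4 := (hasDerivAt_logNum h0).div (((hasDerivAt_id t).const_sub 1).pow 2)
    (by simpa using h3)
  have h5 : HasDerivAt (fun t : ℝ => 1 / t) (-1 / t ^ 2) t := by
    simpa [one_div, neg_div] using hasDerivAt_inv h0.ne'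
  refine (h5.add h4).congr_deriv ?_
  simp only [id, logWeight'', Pi.pow_apply]
  field_simp; ring

variable {s : Set ℂ}

lemma wirt_logWeight (hs : IsOpen s) (hy : ∀ w ∈ s, 0 < regSq κ d w ∧ regSq κ d w < 1)
    {W : ℂ → ℂ} (hW : ∀ w ∈ s, W w = logWeight (regSq κ d w)) (hz : z ∈ s) :
    wirt W z = logWeight' (regSq κ d z) * (κ * conj z) := by
  rw [wirt_congr (Filter.eventuallyEq_of_mem (hs.mem_nhds hz) hW), wirt_ofReal_comp
    (hasDerivAt_logWeight (hy z hz).1 (hy z hz).2) differentiableAt_regSq, wirt_regSq]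

lemma wirtBar_logWeight (hs : IsOpen s) (hy : ∀ w ∈ s, 0 < regSq κ d w ∧ regSq κ d w < 1)
    {W : ℂ → ℂ} (hW : ∀ w ∈ s, W w = logWeight (regSq κ d w)) (hz : z ∈ s) :
    wirtBar W z = logWeight' (regSq κ d z) * (κ * z) := by
  rw [wirtBar_congr (Filter.eventuallyEq_of_mem (hs.mem_nhds hz) hW), wirtBar_ofReal_comp
    (hasDerivAt_logWeight (hy z hz).1 (hy z hz).2) differentiableAt_regSq, wirtBar_regSq]

lemma wirt_wirtBar_logWeight (hs : IsOpen s)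
    (hy : ∀ w ∈ s, 0 < regSq κ d w ∧ regSq κ d w < 1)
    {W : ℂ → ℂ} (hW : ∀ w ∈ s, W w = logWeight (regSq κ d w)) (hz : z ∈ s) :
    wirt (wirtBar W) z = ((logWeight'' (regSq κ d z) * (κ ^ 2 * normSq z)
      + logWeight' (regSq κ d z) * κ : ℝ) : ℂ) := by
  have hd := hasDerivAt_logWeight' (hy z hz).1 (hy z hz).2
  rw [wirt_congr (Filter.eventuallyEq_of_mem (hs.mem_nhds hz)
    fun w hw => wirtBar_logWeight hs hy hW hw), wirt_mul ?_ (by fun_prop), wirt_ofReal_comp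
      hd differentiableAt_regSq, wirt_regSq, wirt_mul (by fun_prop) (by fun_prop)]
  · simp only [wirt_const, wirt_id]
    push_cast [← Complex.mul_conj]
    ring
  · exact ofRealCLM.differentiableAt.comp z (hd.differentiableAt.comp z differentiableAt_regSq)

lemma wirt_one_sub_regSq (hs : IsOpen s) {ρ : ℂ → ℂ}
    (hρ : ∀ w ∈ s, ρ w = ((1 - regSq κ d w : ℝ) : ℂ)) (hz : z ∈ s) :
    wirt ρ z = - (κ * conj z) := by
  rw [wirt_congr (Filter.eventuallyEq_of_mem (hs.mem_nhds hz) hρ),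
    wirt_ofReal_comp (φ := fun t => 1 - t) ((hasDerivAt_id _).const_sub 1) differentiableAt_regSq,
    wirt_regSq]
  simp

/-- Multiplying a metric by `ρ = 1 - y` adds `ρ_z/ρ` to its connection; the value is minus the
curvature gained by this twist. -/
lemma wirtBar_wirt_div_one_sub_regSq (hs : IsOpen s) (hy : ∀ w ∈ s, regSq κ d w < 1) {ρ : ℂ → ℂ}
    (hρ : ∀ w ∈ s, ρ w = ((1 - regSq κ d w : ℝ) : ℂ)) (hz : z ∈ s) :
    wirtBar (fun w => wirt ρ w / ρ w) z = ((-(κ * (1 - d) / (1 - regSq κ d z) ^ 2) : ℝ) : ℂ) := by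
  have h3 : 1 - regSq κ d z ≠ 0 := by linarith [hy z hz]
  have hφ : HasDerivAt (fun t : ℝ => (1 - t)⁻¹) (1 / (1 - regSq κ d z) ^ 2) (regSq κ d z) := by
    simpa using ((hasDerivAt_id (regSq κ d z)).const_sub 1).fun_inv h3
  have e : (fun w => wirt ρ w / ρ w) =ᶠ[𝓝 z]
      fun w => ((fun t : ℝ => (1 - t)⁻¹) (regSq κ d w) : ℝ) * (-(κ * conj w)) := by
    filter_upwards [hs.mem_nhds hz] with w hw
    rw [wirt_one_sub_regSq hs hρ hw, hρ w hw]
    push_cast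
    rw [div_eq_mul_inv, mul_comm]
  have hc : DifferentiableAt ℝ (fun w : ℂ => conj w) z := conjCLE.differentiableAt
  have hc' : DifferentiableAt ℝ (fun w : ℂ => -(κ * conj w)) z := (hc.const_mul _).neg
  have e2 : wirtBar (fun w : ℂ => -(κ * conj w)) z = -κ := by
    have : (fun w : ℂ => -(κ * conj w)) = fun w => (-κ : ℂ) * conj w := by ext; ring
    rw [this, wirtBar_mul (by fun_prop) hc]; simp
  rw [wirtBar_congr e, wirtBar_mul ?_ hc', wirtBar_ofReal_comp hφ differentiableAt_regSq,
    wirtBar_regSq, e2]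
  · have h4 : (1 : ℂ) - regSq κ d z ≠ 0 := by exact_mod_cast h3
    push_cast
    field_simp
    rw [ofReal_regSq]
    ring
  · exact ofRealCLM.differentiableAt.comp z (hφ.differentiableAt.comp z differentiableAt_regSq)

/-- The pointwise inequality behind the sharp constant. -/
lemma logWeight_pointwise {x N B c : ℝ} (hx : 0 ≤ x) (hκ : 0 < κ) (ht : t = κ * x + d)
    (h0 : 0 < t) (h1 : t < 1) (hN : 0 ≤ N) (hB : 0 ≤ B) (hc : c ^ 2 ≤ κ ^ 2 * x * (N * B)) :
    κ * d / t ^ 2 * N - (1 - t) / t * B ≤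
      (logWeight'' t * (κ ^ 2 * x) + logWeight' t * κ) * N + 2 * (logWeight' t * c)
        + logWeight t * B - logWeight t * (κ * (1 - d) / (1 - t) ^ 2) * N := by
  have h3 : 0 < 1 - t := by linarith
  -- The total coefficient of `N` splits into the approximate Dirac mass `κd/t²` and the part that
  -- enters the square below.
  have e1 : logWeight'' t * (κ ^ 2 * x) + logWeight' t * κ
      - logWeight t * (κ * (1 - d) / (1 - t) ^ 2)
      = κ ^ 2 * x / (1 - t) * logWeight' t + κ * d / t ^ 2 := by
    have hd : d = t - κ * x := by linarith
    rw [hd, logWeight, logWeight', logWeight'']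
    field_simp
    ring
  -- This differential equation determines the weight `W`: it reads `((1-t)W)' = 1/t - 1`, so
  -- `(1-t)W = log t - t + const`, and the constant `1` is the one for which `W` tends to zero as `t
  -- → 1`.
  have e2 : logWeight t + (1 - t) / t = (1 - t) * logWeight' t := by
    rw [logWeight, logWeight']
    field_simp
    ring
  -- By hypothesis the cross term `|c|` is at most the geometric mean of the two outer terms.
  have key : 0 ≤ κ ^ 2 * x / (1 - t) * N + 2 * c + (1 - t) * B := by
    have h4 : 0 ≤ κ ^ 2 * x * N + 2 * (1 - t) * c + (1 - t) ^ 2 * B := by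
      have h5 : ((1 - t) * c) ^ 2 ≤ (κ ^ 2 * x * N) * ((1 - t) ^ 2 * B) := by nlinarith [sq_nonneg (1-t)]
      have h6 : 0 ≤ κ ^ 2 * x * N := by positivity
      have h7 : 0 ≤ (1 - t) ^ 2 * B := by positivity
      have h8 : (2 * ((1 - t) * c)) ^ 2 ≤ (κ ^ 2 * x * N + (1 - t) ^ 2 * B) ^ 2 := by
        nlinarith [sq_nonneg (κ ^ 2 * x * N - (1 - t) ^ 2 * B)]
      have h9 := (abs_le_of_sq_le_sq' h8 (by linarith)).1
      linarith
    have : κ ^ 2 * x / (1 - t) * N + 2 * c + (1 - t) * B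
        = (κ ^ 2 * x * N + 2 * (1 - t) * c + (1 - t) ^ 2 * B) / (1 - t) := by
      field_simp
    rw [this]; exact div_nonneg h4 h3.le
  have := mul_nonneg (logWeight'_nonneg h0 h1) key
  linear_combination this - N * e1 - B * e2

end Weights

end L2Extension

/-! ### The regularised a priori inequality -/

namespace L2Extension

open Complex ComplexConjugate Matrix
open scoped ComplexOrder

section Apriori

lemma wirtM_eq_zero_of_notMem_tsupport {ι : Type*} {F : ℂ → Matrix Unit ι ℂ} {z : ℂ}
    (hz : z ∉ tsupport F) : wirtM F z = 0 ∧ wirtBarM F z = 0 := by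
  have h : ∀ i j, (fun w => F w i j) =ᶠ[𝓝 z] fun _ => 0 := fun i j => by
    filter_upwards [(isClosed_tsupport F).isOpen_compl.mem_nhds hz] with w hw
    rw [image_eq_zero_of_notMem_tsupport hw]; rfl
  constructor
  · ext i j; simp [wirtM, wirt_congr (h i j)]
  · ext i j; simp [wirtBarM, wirtBar_congr (h i j)]

variable {ι : Type*} [Fintype ι] {H A : ℂ → Matrix ι ι ℂ} {α : ℂ → Matrix Unit ι ℂ}

/-- The cutoff of `1 - regSq` to a positive function on the plane. -/
lemma exists_pos_eq_one_sub_regSq {κ d R r : ℝ} (hκ : 0 < κ) (h : κ * R ^ 2 + d = 1) (hr : 0 < r)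
    (hrR : r < R) : ∃ ρ : ℂ → ℝ, ContDiff ℝ ∞ ρ ∧ (∀ z, 0 < ρ z) ∧
      ∀ z ∈ Metric.ball 0 r, ρ z = 1 - regSq κ d z := by
  let χ : ContDiffBump (0 : ℂ) := ⟨r, R, hr, hrR⟩
  refine ⟨fun z => χ z * (1 - regSq κ d z) + (1 - χ z), ?_, fun z => ?_, fun z hz => ?_⟩
  · exact (χ.contDiff.mul (contDiff_const.sub contDiff_regSq)).add (contDiff_const.sub χ.contDiff)
  · by_cases hz : z ∈ Metric.ball (0 : ℂ) R
    · change 0 < χ z * (1 - regSq κ d z) + (1 - χ z)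
      have h1 := regSq_lt_one hκ h hz
      have h2 := χ.nonneg (x := z)
      have h3 := χ.le_one (x := z)
      rcases h3.eq_or_lt with h4 | h4
      · rw [h4]; linarith
      · nlinarith
    · have : χ z = 0 := χ.zero_of_le_dist (by simpa using hz)
      simp [this]
  · have : χ z = 1 := χ.one_of_mem_closedBall (Metric.ball_subset_closedBall hz)
    simp [this]

/-- The Bochner identity is applied to `γ = α/ρ` in the metric `ρH`, with `ρ = 1 - y` and weight
`W(y)`. The twist vanishes on the circle of radius `R`, and its curvature is what balances the
equation of the weight. After discarding the two terms of good sign, `logWeight_pointwise` compares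
the integrands. -/
theorem regularized_apriori (hH : SmoothM H) (hHp : ∀ z, (H z).PosDef) (hA : SmoothM A)
    (hHA : ∀ z, wirtM H z = A z * H z) {R : ℝ} (hR : 0 < R)
    (hcurv : ∀ z ∈ Metric.ball 0 R, ∀ a : Matrix Unit ι ℂ,
      (herm (H z) (a * wirtBarM A z) a).re ≤ 0)
    (hα : SmoothM α) (hαc : HasCompactSupport α) (hαR : tsupport α ⊆ Metric.ball 0 R)
    {κ d : ℝ} (hκ : 0 < κ) (hd : 0 < d) (hκd : κ * R ^ 2 + d = 1) :
    ∫ z, κ * d / regSq κ d z ^ 2 * (herm (H z) (α z) (α z)).re ≤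
      ∫ z, 1 / regSq κ d z * (herm (H z) (wirtM α z + α z * A z) (wirtM α z + α z * A z)).re := by
  classical
  -- On a slightly smaller disc containing the support, `1 - y` is bounded away from zero, so it can
  -- be replaced outside by a positive smooth function.
  obtain ⟨r, hr0, hrR, hαr⟩ : ∃ r, 0 < r ∧ r < R ∧ tsupport α ⊆ Metric.ball 0 r := by
    obtain ⟨r, hr, h⟩ := exists_lt_subset_ball (isClosed_tsupport α) hαR
    exact ⟨max r (R / 2), by positivity, max_lt hr (by linarith),
      h.trans (Metric.ball_subset_ball (le_max_left _ _))⟩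
  obtain ⟨ρ, hρs, hρ0, hρr⟩ := exists_pos_eq_one_sub_regSq hκ hκd hr0 hrR
  have hHh : ∀ z, (H z).IsHermitian := fun z => (hHp z).isHermitian
  have hy0 : ∀ z, 0 < regSq κ d z := fun z => regSq_pos hκ.le hd
  have hy1 : ∀ z ∈ Metric.ball 0 r, regSq κ d z < 1 := fun z hz =>
    regSq_lt_one hκ hκd (Metric.ball_subset_ball hrR.le hz)
  set ρc : ℂ → ℂ := fun z => (ρ z : ℂ) with hρc
  have hρne : ∀ z, ρc z ≠ 0 := fun z => by simpa [hρc] using (hρ0 z).ne'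
  have hρcs : ContDiff ℝ ∞ ρc := ofRealCLM.contDiff.comp hρs
  set W : ℂ → ℂ := fun z => (((1 + Real.log (regSq κ d z) - regSq κ d z) / ρ z : ℝ) : ℂ) with hW
  have hWs : ContDiff ℝ ∞ W := ofRealCLM.contDiff.comp
    (((contDiff_const.add (contDiff_regSq.log fun z => (hy0 z).ne')).sub contDiff_regSq).div hρs
      fun z => (hρ0 z).ne')
  have hWr : ∀ w ∈ Metric.ball 0 r, W w = logWeight (regSq κ d w) := fun w hw => by
    simp only [hW, logWeight, hρr w hw]
  have hρcr : ∀ w ∈ Metric.ball 0 r, ρc w = ((1 - regSq κ d w : ℝ) : ℂ) := fun w hw => by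
    simp only [hρc, hρr w hw]
  have hiρ : ContDiff ℝ ∞ fun z => (ρc z)⁻¹ := hρcs.inv hρne
  have hdρ : ContDiff ℝ ∞ fun z => wirt ρc z / ρc z := by
    simpa only [div_eq_mul_inv] using (contDiff_wirt hρcs).mul hiρ
  -- Division by `ρ` undoes the change of connection: `D'γ = ρ⁻¹ Dα`, as `hβ` records.
  set γ : ℂ → Matrix Unit ι ℂ := fun z => (ρc z)⁻¹ • α z with hγ
  have hγs : SmoothM γ := hα.smul hiρ
  have hγc : HasCompactSupport γ := hαc.mono fun z hz h => hz (by simp [hγ, h])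
  set H' : ℂ → Matrix ι ι ℂ := fun z => ρc z • H z with hH'
  set A' : ℂ → Matrix ι ι ℂ := fun z => A z + (wirt ρc z / ρc z) • (1 : Matrix ι ι ℂ) with hA'
  have h1s : SmoothM (fun _ : ℂ => (1 : Matrix ι ι ℂ)) := SmoothM.const 1
  have hH's : SmoothM H' := hH.smul hρcs
  have hA's : SmoothM A' := hA.add (h1s.smul hdρ)
  have hH'h : ∀ z, (H' z).IsHermitian := fun z => by
    simp only [hH', hρc, Matrix.IsHermitian, conjTranspose_smul, (hHh z).eq]
    simp
  have hH'A' : ∀ z, wirtM H' z = A' z * H' z := fun z => by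
    simp only [hH', hA']
    rw [wirtM_smul hρcs hH, hHA, Matrix.add_mul, Matrix.smul_mul, Matrix.one_mul, smul_smul,
      div_mul_cancel₀ _ (hρne z), Matrix.mul_smul, add_comm]
  have hβ : ∀ z, wirtM γ z + γ z * A' z = (ρc z)⁻¹ • (wirtM α z + α z * A z) := fun z => by
    have e : wirt (fun z => (ρc z)⁻¹) z = - (ρc z)⁻¹ * (wirt ρc z / ρc z) := by
      have h := wirt_mul (z := z) (hiρ.differentiable (by simp)).differentiableAt
        (hρcs.differentiable (by simp)).differentiableAt
      have h1 : (fun z => (ρc z)⁻¹ * ρc z) = fun _ => 1 := by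
        ext z; exact inv_mul_cancel₀ (hρne z)
      rw [h1, wirt_const] at h
      have := hρne z
      field_simp at h ⊢
      linear_combination -h
    simp only [hγ, hA']
    rw [wirtM_smul hiρ hα, e]
    simp only [Matrix.mul_add, Matrix.smul_mul, Matrix.mul_smul, Matrix.mul_one, smul_add,
      smul_smul, neg_mul, neg_smul]
    rw [mul_comm (wirt ρc z / ρc z)]
    abel
  obtain ⟨hXs, hB⟩ := integral_bochner hH's hH'h hA's hH'A' hγs hγc hWs
  set X : ℂ → ℂ := bochnerIntegrand W H' A' γ with hX
  have hβs : SmoothM fun z => wirtM α z + α z * A z := hα.wirtM.add (hα.mul hA)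
  have hβc : HasCompactSupport fun z => wirtM α z + α z * A z := by
    refine HasCompactSupport.intro hαc fun z hz => ?_
    rw [(wirtM_eq_zero_of_notMem_tsupport hz).1, image_eq_zero_of_notMem_tsupport hz]; simp
  have i1 : Integrable fun z => κ * d / regSq κ d z ^ 2 * (herm (H z) (α z) (α z)).re := by
    refine Continuous.integrable_of_hasCompactSupport ?_ (hαc.mono fun z hz h => hz (by simp [h]))
    refine (continuous_const.div (contDiff_regSq.continuous.pow 2) fun z => ?_).mul
      (continuous_re.comp (contDiff_herm hH hα hα).continuous)
    exact pow_ne_zero 2 (hy0 z).ne'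
  have i2 : Integrable fun z => 1 / regSq κ d z *
      (herm (H z) (wirtM α z + α z * A z) (wirtM α z + α z * A z)).re := by
    refine Continuous.integrable_of_hasCompactSupport ?_ (hβc.mono fun z hz h => hz (by simp [h]))
    exact (continuous_const.div contDiff_regSq.continuous fun z => (hy0 z).ne').mul
      (continuous_re.comp (contDiff_herm hH hβs hβs).continuous)
  have hXre : ∫ z, (X z).re = 0 := by
    have := integral_re hXs
    simp only [RCLike.re_to_complex] at this
    rw [this, hB]; simp
  have hle : ∀ z, κ * d / regSq κ d z ^ 2 * (herm (H z) (α z) (α z)).re - 1 / regSq κ d z *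
      (herm (H z) (wirtM α z + α z * A z) (wirtM α z + α z * A z)).re ≤ (X z).re := by
    intro z
    by_cases hz : z ∈ Metric.ball (0 : ℂ) r
    swap
    · have hsub : tsupport γ ⊆ tsupport α :=
        closure_mono fun w (hw : γ w ≠ 0) (h : α w = 0) => hw (by simp [hγ, h])
      have hz' : z ∉ tsupport α := fun h => hz (hαr h)
      have hz'' : z ∉ tsupport γ := fun h => hz' (hsub h)
      simp [hX, bochnerIntegrand, (wirtM_eq_zero_of_notMem_tsupport hz').1,
        image_eq_zero_of_notMem_tsupport hz', (wirtM_eq_zero_of_notMem_tsupport hz'').1,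
        (wirtM_eq_zero_of_notMem_tsupport hz'').2, image_eq_zero_of_notMem_tsupport hz'']
    set a := α z with ha
    set b := wirtM α z + α z * A z with hb
    set y := regSq κ d z with hy
    have hρz : ρc z = ((1 - y : ℝ) : ℂ) := hρcr z hz
    have hρz' : ρ z = 1 - y := hρr z hz
    have hyz : 0 < 1 - y := by linarith [hy1 z hz]
    have e1 : ∀ a b : Matrix Unit ι ℂ, herm (H' z) ((ρc z)⁻¹ • a) ((ρc z)⁻¹ • b)
        = (((1 - y)⁻¹ : ℝ) : ℂ) * herm (H z) a b := fun a b => by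
      have h0 := hρne z
      simp only [hH']
      rw [herm_smul, herm_smul_left, herm_smul_right, mul_inv_cancel_left₀ h0, hρz, ← ofReal_inv,
        conj_ofReal]
    have e2 : wirtBarM A' z = wirtBarM A z
        + ((-(κ * (1 - d) / (1 - y) ^ 2) : ℝ) : ℂ) • (1 : Matrix ι ι ℂ) := by
      simp only [hA']
      rw [wirtBarM_add hA (h1s.smul hdρ), wirtBarM_smul hdρ h1s,
        wirtBar_wirt_div_one_sub_regSq Metric.isOpen_ball hy1 hρcr hz]
      congr 1
      have : wirtBarM (fun _ : ℂ => (1 : Matrix ι ι ℂ)) z = 0 := by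
        ext i j; simp [wirtBarM]
      rw [this, smul_zero, add_zero]
    have e3 : γ z * wirtBarM A' z = (ρc z)⁻¹ • (a * wirtBarM A z
        + ((-(κ * (1 - d) / (1 - y) ^ 2) : ℝ) : ℂ) • a) := by
      rw [e2, hγ]
      simp [Matrix.mul_add, ha]
      exact smul_comm _ _ _
    have hpsd := (hHp z).posSemidef
    have hq : 0 ≤ (herm (H' z) (wirtBarM γ z) (wirtBarM γ z)).re := by
      simp only [hH', herm_smul, hρc, re_ofReal_mul]
      exact mul_nonneg (hρ0 z).le (herm_self_nonneg hpsd _)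
    have hW0 : logWeight y ≤ 0 := logWeight_nonpos (hy0 z) (hy1 z hz)
    have hcu : (herm (H z) a (a * wirtBarM A z)).re ≤ 0 := by
      rw [← conj_herm (hHh z), conj_re]
      exact hcurv z (Metric.ball_subset_ball hrR.le hz) a
    have hyb : ∀ w ∈ Metric.ball 0 r, 0 < regSq κ d w ∧ regSq κ d w < 1 :=
      fun w hw => ⟨hy0 w, hy1 w hw⟩
    -- Pairing sections divided by `ρ` in the metric `ρH` produces the common factor `1/(1-y)`.
    have eX : (X z).re = (1 - y)⁻¹ * ((logWeight'' y * (κ ^ 2 * normSq z) + logWeight' y * κ)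
          * (herm (H z) a a).re + 2 * (logWeight' y * (κ * (z * herm (H z) b a).re))
          + logWeight y * (herm (H z) b b).re
          - logWeight y * (κ * (1 - d) / (1 - y) ^ 2) * (herm (H z) a a).re)
        - logWeight y * (herm (H' z) (wirtBarM γ z) (wirtBarM γ z)).re
        + (1 - y)⁻¹ * (logWeight y * (herm (H z) a (a * wirtBarM A z)).re) := by
      have eγ : γ z = (ρc z)⁻¹ • a := rfl
      rw [hX, bochnerIntegrand, hβ, ← hb, e3, eγ, e1, e1, e1, e1, e1,
        wirt_wirtBar_logWeight Metric.isOpen_ball hyb hWr hz,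
        wirtBar_logWeight Metric.isOpen_ball hyb hWr hz,
        wirt_logWeight Metric.isOpen_ball hyb hWr hz, hWr z hz, ← hy, herm_add_right (H z) a (a * wirtBarM A z), herm_smul_right,
        conj_ofReal, ← conj_herm (hHh z) b a]
      simp only [add_re, sub_re, mul_re, ofReal_re, ofReal_im, conj_re, conj_im, mul_im, add_im]
      ring
    have hCS : (κ * (z * herm (H z) b a).re) ^ 2 ≤ κ ^ 2 * normSq z *
        ((herm (H z) a a).re * (herm (H z) b b).re) := by
      have h1 := norm_herm_sq_le hpsd b a
      have h2 : (z * herm (H z) b a).re ^ 2 ≤ normSq z * ‖herm (H z) b a‖ ^ 2 := by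
        rw [Complex.normSq_eq_norm_sq, ← mul_pow, ← norm_mul]
        exact sq_le_sq' (by linarith [abs_le.1 (abs_re_le_norm (z * herm (H z) b a))])
          (le_trans (le_abs_self _) (abs_re_le_norm _))
      have h3 := mul_le_mul_of_nonneg_left h1 (normSq_nonneg z)
      calc _ = κ ^ 2 * (z * herm (H z) b a).re ^ 2 := by ring
        _ ≤ κ ^ 2 * (normSq z * ((herm (H z) b b).re * (herm (H z) a a).re)) := by
          gcongr; exact h2.trans h3
        _ = _ := by ring
    have key := logWeight_pointwise (normSq_nonneg z) hκ hy (hy0 z) (hy1 z hz)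
      (herm_self_nonneg hpsd a) (herm_self_nonneg hpsd b) hCS
    have key2 := mul_le_mul_of_nonneg_left key (inv_pos.2 hyz).le
    have t1 : 0 ≤ - (logWeight y * (herm (H' z) (wirtBarM γ z) (wirtBarM γ z)).re) := by
      nlinarith
    have t2 : 0 ≤ (1 - y)⁻¹ * (logWeight y * (herm (H z) a (a * wirtBarM A z)).re) :=
      mul_nonneg (inv_pos.2 hyz).le (mul_nonneg_of_nonpos_of_nonpos hW0 hcu)
    -- Dropping the factor `1/(1-y) ≥ 1` costs nothing in the limit `d → 0`, since the mass
    -- concentrates at the origin, where `y = d`.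
    have t3 : κ * d / y ^ 2 * (herm (H z) a a).re ≤
        (1 - y)⁻¹ * (κ * d / y ^ 2 * (herm (H z) a a).re) := by
      refine le_mul_of_one_le_left (mul_nonneg (by positivity) (herm_self_nonneg hpsd a)) ?_
      exact (one_le_inv₀ hyz).2 (by linarith [hy0 z])
    have t4 : (1 - y)⁻¹ * ((1 - y) / y * (herm (H z) b b).re) = 1 / y * (herm (H z) b b).re := by
      field_simp
    rw [eX]
    rw [mul_sub, t4] at key2
    linarith
  have := integral_mono (i1.sub i2) hXs.re hle
  simp only [Pi.sub_apply, RCLike.re_to_complex] at this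
  rw [integral_sub i1 i2, hXre] at this
  linarith

end Apriori

end L2Extension

namespace L2Extension

open Complex ComplexConjugate Metric

/-! ### Integration in polar coordinates -/

lemma integrableOn_polar {f : ℂ → ℂ} (hf : Integrable f) :
    IntegrableOn (fun p : ℝ × ℝ => p.1 • f (Complex.polarCoord.symm p)) polarCoord.target := by
  have h1 : Integrable (f ∘ measurableEquivRealProd.symm) :=
    (Complex.volume_preserving_equiv_real_prod.symm.integrable_comp_emb
      measurableEquivRealProd.symm.measurableEmbedding).2 hf
  have h2 := (integrableOn_image_iff_integrableOn_abs_det_fderiv_smul volume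
    polarCoord.open_target.measurableSet
    (fun p _ => (hasFDerivAt_polarCoord_symm p).hasFDerivWithinAt) polarCoord.symm.injOn
    (f ∘ measurableEquivRealProd.symm)).1 h1.integrableOn
  refine h2.congr_fun (fun p hp => ?_) polarCoord.open_target.measurableSet
  have hp1 : 0 < p.1 := hp.1
  simp only [det_fderivPolarCoordSymm, abs_of_pos hp1, Function.comp_apply]
  rw [measurableEquivRealProd_symm_polarCoord_symm_apply]

theorem integral_eq_integral_circleAverage {f : ℂ → ℂ} (hf : Integrable f) :
    ∫ z, f z = ∫ r in Set.Ioi (0 : ℝ), (2 * Real.pi * r) • Real.circleAverage f 0 r := by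
  rw [← Complex.integral_comp_polarCoord_symm]
  have h := integrableOn_polar hf
  rw [show polarCoord.target = Set.Ioi (0 : ℝ) ×ˢ Set.Ioo (-Real.pi) Real.pi from rfl] at h ⊢
  rw [Measure.volume_eq_prod] at h ⊢
  rw [setIntegral_prod _ h]
  refine setIntegral_congr_fun measurableSet_Ioi fun r _ => ?_
  simp only
  rw [integral_smul, Real.circleAverage_eq_integral_add (-Real.pi), smul_smul,
    ← integral_Ioc_eq_integral_Ioo, ← intervalIntegral.integral_of_le (by linarith [Real.pi_pos]),
    intervalIntegral.integral_comp_add_right (fun θ => f (circleMap 0 r θ))]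
  have e1 : 2 * Real.pi * r * (2 * Real.pi)⁻¹ = r := by field_simp
  rw [e1]
  congr 1
  rw [show (0 : ℝ) + -Real.pi = -Real.pi by ring, show 2 * Real.pi + -Real.pi = Real.pi by ring]
  refine intervalIntegral.integral_congr fun θ _ => ?_
  simp [circleMap, Complex.exp_mul_I]

lemma setIntegral_ball_eq_integral_circleAverage {f : ℂ → ℂ} {R : ℝ}
    (hf : IntegrableOn f (ball 0 R)) :
    ∫ z in ball 0 R, f z = ∫ r in Set.Ioo (0 : ℝ) R, (2 * Real.pi * r) • Real.circleAverage f 0 r := by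
  rw [← integral_indicator measurableSet_ball, integral_eq_integral_circleAverage
    (hf.integrable_indicator measurableSet_ball)]
  have : ∀ r ∈ Set.Ioi (0 : ℝ), (2 * Real.pi * r) • Real.circleAverage ((ball 0 R).indicator f) 0 r
      = (Set.Iio R).indicator (fun r => (2 * Real.pi * r) • Real.circleAverage f 0 r) r := by
    intro r (hr : 0 < r)
    by_cases h : r < R
    · rw [Set.indicator_of_mem (by exact h)]
      congr 1
      refine Real.circleAverage_congr_sphere fun z hz => ?_
      rw [Set.indicator_of_mem]
      rw [mem_sphere_zero_iff_norm, abs_of_pos hr] at hz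
      rw [mem_ball_zero_iff, hz]; exact h
    · rw [Set.indicator_of_notMem (by exact h)]
      have : Real.circleAverage ((ball 0 R).indicator f) 0 r = Real.circleAverage (fun _ => 0) 0 r := by
        refine Real.circleAverage_congr_sphere fun z hz => ?_
        rw [Set.indicator_of_notMem]
        rw [mem_sphere_zero_iff_norm, abs_of_pos hr] at hz
        rw [mem_ball_zero_iff, hz]; exact h
      rw [this, Real.circleAverage_const, smul_zero]
  rw [setIntegral_congr_fun measurableSet_Ioi this, setIntegral_indicator measurableSet_Iio]
  rfl

/-- The mean value property of holomorphic functions against radial weights. -/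
lemma integral_radial_mul_eq_zero {g : ℂ → ℂ} {k : ℝ → ℂ} {R : ℝ}
    (hg : DifferentiableOn ℂ g (ball 0 R)) (hg0 : g 0 = 0)
    (hi : IntegrableOn (fun z => k ‖z‖ * g z) (ball 0 R)) :
    ∫ z in ball 0 R, k ‖z‖ * g z = 0 := by
  rw [setIntegral_ball_eq_integral_circleAverage hi]
  refine (setIntegral_congr_fun measurableSet_Ioo fun r hr => ?_).trans (integral_zero _ _)
  have h1 : Real.circleAverage (fun z => k ‖z‖ * g z) 0 r =
      Real.circleAverage (fun z => k r * g z) 0 r := by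
    refine Real.circleAverage_congr_sphere fun z hz => ?_
    rw [mem_sphere_zero_iff_norm, abs_of_pos hr.1] at hz
    simp [hz]
  have h2 : DiffContOnCl ℂ (fun z => k r * g z) (ball 0 |r|) := by
    rw [abs_of_pos hr.1]
    refine DifferentiableOn.diffContOnCl fun z hz => ?_
    rw [closure_ball _ hr.1.ne'] at hz
    have hz' : z ∈ ball (0 : ℂ) R := closedBall_subset_ball hr.2 hz
    exact (((hg z hz').differentiableAt (isOpen_ball.mem_nhds hz')).const_mul _).differentiableWithinAt
  simp only [h1, h2.circleAverage, hg0, mul_zero, smul_zero]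

lemma integral_radial {φ : ℝ → ℝ} {R : ℝ} (hR : 0 ≤ R) (hφ : Continuous φ) :
    ∫ z in ball (0 : ℂ) R, φ ‖z‖ = ∫ r in (0 : ℝ)..R, 2 * Real.pi * r * φ r := by
  have hi : IntegrableOn (fun z : ℂ => (φ ‖z‖ : ℂ)) (ball 0 R) := by
    refine IntegrableOn.mono_set ?_ ball_subset_closedBall
    exact (by fun_prop : Continuous fun z : ℂ => (φ ‖z‖ : ℂ)).continuousOn.integrableOn_compact
      (isCompact_closedBall 0 R)
  have h := setIntegral_ball_eq_integral_circleAverage hi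
  rw [integral_complex_ofReal] at h
  have h2 : ∫ r in Set.Ioo (0 : ℝ) R, (2 * Real.pi * r) •
      Real.circleAverage (fun z : ℂ => (φ ‖z‖ : ℂ)) 0 r
      = ∫ r in Set.Ioo (0 : ℝ) R, ((2 * Real.pi * r * φ r : ℝ) : ℂ) := by
    refine setIntegral_congr_fun measurableSet_Ioo fun r hr => ?_
    rw [Real.circleAverage_const_on_circle (a := (φ r : ℂ))]
    · simp
    · intro z hz
      rw [mem_sphere_zero_iff_norm, abs_of_pos hr.1] at hz
      simp [hz]
  rw [h2, integral_complex_ofReal] at h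
  have h3 := Complex.ofReal_injective h
  rw [h3, intervalIntegral.integral_of_le hR, integral_Ioc_eq_integral_Ioo]

lemma integral_norm_sq_ball {R : ℝ} (hR : 0 ≤ R) :
    ∫ z in ball (0 : ℂ) R, ‖z‖ ^ 2 = Real.pi * R ^ 4 / 2 := by
  rw [integral_radial (φ := fun r => r ^ 2) hR (by fun_prop)]
  have : ∀ r : ℝ, 2 * Real.pi * r * r ^ 2 = 2 * Real.pi * r ^ 3 := fun r => by ring
  simp only [this]
  rw [intervalIntegral.integral_const_mul, integral_pow]
  norm_num; ring

/-- In polar coordinates the integrand has the primitive `-πd/(κr² + d)`. For fixed `R > 0`, and `κ`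
bounded away from zero, the mass tends to `π` as `d → 0`. -/
lemma integral_regularized_dirac {κ d R : ℝ} (hκ : 0 < κ) (hd : 0 < d) (hR : 0 ≤ R) :
    ∫ z in ball (0 : ℂ) R, κ * d / regSq κ d z ^ 2 = Real.pi * (1 - d / (κ * R ^ 2 + d)) := by
  have h0 : ∀ r : ℝ, 0 < κ * r ^ 2 + d := fun r => by positivity
  have e : ∀ z : ℂ, κ * d / regSq κ d z ^ 2 = (fun r : ℝ => κ * d / (κ * r ^ 2 + d) ^ 2) ‖z‖ :=
    fun z => by simp only [regSq, Complex.normSq_eq_norm_sq]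
  have hc : Continuous fun r : ℝ => κ * d / (κ * r ^ 2 + d) ^ 2 :=
    continuous_const.div (by fun_prop) fun r => pow_ne_zero 2 (h0 r).ne'
  simp only [e]
  rw [integral_radial hR hc]
  have hder : ∀ r : ℝ, HasDerivAt (fun r : ℝ => -(Real.pi * d) * (κ * r ^ 2 + d)⁻¹)
      (2 * Real.pi * r * (κ * d / (κ * r ^ 2 + d) ^ 2)) r := by
    intro r
    have h1 : HasDerivAt (fun r : ℝ => κ * r ^ 2 + d) (κ * (2 * r)) r := by
      simpa using ((hasDerivAt_pow 2 r).const_mul κ).add_const d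
    refine ((h1.fun_inv (h0 r).ne').const_mul (-(Real.pi * d))).congr_deriv ?_
    have := (h0 r).ne'
    field_simp
  rw [intervalIntegral.integral_eq_sub_of_hasDerivAt (fun r _ => hder r)
    ((by fun_prop : Continuous fun r => _ * r * _).intervalIntegrable _ _)]
  have := (h0 R).ne'
  field_simp
  ring

end L2Extension

/-! ### The sharp inequality in the dual metric -/

namespace L2Extension

open Complex ComplexConjugate Matrix Metric
open scoped ComplexOrder

section Dual

variable {ι : Type*} [Fintype ι] [DecidableEq ι]

lemma herm_mul_inv {H : Matrix ι ι ℂ} (hH : H.PosDef) (u v : Matrix Unit ι ℂ) :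
    herm H (u * H⁻¹) (v * H⁻¹) = herm H⁻¹ u v := by
  have h1 : H⁻¹ * H = 1 := Matrix.nonsing_inv_mul H ((isUnit_iff_isUnit_det H).1 hH.isUnit)
  rw [herm, herm, conjTranspose_mul, hH.inv.isHermitian.eq, Matrix.mul_assoc u, h1, Matrix.mul_one,
    Matrix.mul_assoc]

variable {H A : ℂ → Matrix ι ι ℂ} {u : ℂ → Matrix Unit ι ℂ}

lemma SmoothM.inv_of_posDef (hH : SmoothM H) (hHp : ∀ z, (H z).PosDef) :
    SmoothM fun z => (H z)⁻¹ :=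
  hH.inv fun z => ((isUnit_iff_isUnit_det _).1 (hHp z).isUnit).ne_zero

/-- For `α = uH⁻¹` one has `Dα = u_z H⁻¹`, so `regularized_apriori` becomes an inequality between
`u` and `u_z` in the metric `H⁻¹`. As `d → 0` the left side concentrates at the origin, while on the
right `1/y` is bounded by `R²/((1-d)|z|²)`. -/
theorem sharp_apriori (hH : SmoothM H) (hHp : ∀ z, (H z).PosDef) (hA : SmoothM A)
    (hHA : ∀ z, wirtM H z = A z * H z) {R : ℝ} (hR : 0 < R)
    (hcurv : ∀ z ∈ ball 0 R, ∀ a : Matrix Unit ι ℂ, (herm (H z) (a * wirtBarM A z) a).re ≤ 0)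
    (hu : SmoothM u) (huc : HasCompactSupport u) (huR : tsupport u ⊆ ball 0 R)
    (hi : Integrable fun z => (herm (H z)⁻¹ (wirtM u z) (wirtM u z)).re / normSq z) :
    Real.pi * (herm (H 0)⁻¹ (u 0) (u 0)).re ≤
      R ^ 2 * ∫ z, (herm (H z)⁻¹ (wirtM u z) (wirtM u z)).re / normSq z := by
  have hG := hH.inv_of_posDef hHp
  have hGp : ∀ z, ((H z)⁻¹).PosSemidef := fun z => (hHp z).inv.posSemidef
  set α : ℂ → Matrix Unit ι ℂ := fun z => u z * (H z)⁻¹ with hα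
  have hαs : SmoothM α := hu.mul hG
  have hsub : tsupport α ⊆ tsupport u :=
    closure_mono fun w (hw : α w ≠ 0) (h : u w = 0) => hw (by simp [hα, h])
  have hαc : HasCompactSupport α := huc.mono fun w (hw : α w ≠ 0) (h : u w = 0) =>
    hw (by simp [hα, h])
  have hinv : ∀ z, (H z)⁻¹ * H z = 1 := fun z =>
    Matrix.nonsing_inv_mul _ ((isUnit_iff_isUnit_det _).1 (hHp z).isUnit)
  have hinv' : ∀ z, H z * (H z)⁻¹ = 1 := fun z =>
    Matrix.mul_nonsing_inv _ ((isUnit_iff_isUnit_det _).1 (hHp z).isUnit)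
  have hβ : ∀ z, wirtM α z + α z * A z = wirtM u z * (H z)⁻¹ := fun z => by
    have h1 : (fun z => α z * H z) = u := by
      ext1 z; simp only [hα]; rw [Matrix.mul_assoc, hinv, Matrix.mul_one]
    have h2 := wirtM_mul (z := z) hαs hH
    rw [h1, hHA, ← Matrix.mul_assoc, ← Matrix.add_mul] at h2
    rw [h2, Matrix.mul_assoc _ (H z), hinv', Matrix.mul_one]
  set N : ℂ → ℝ := fun z => (herm (H z)⁻¹ (u z) (u z)).re with hN
  set Q : ℂ → ℝ := fun z => (herm (H z)⁻¹ (wirtM u z) (wirtM u z)).re with hQ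
  have hNc : Continuous N := continuous_re.comp (contDiff_herm hG hu hu).continuous
  have hN0 : ∀ z, 0 ≤ N z := fun z => herm_self_nonneg (hGp z) _
  have hQ0 : ∀ z, 0 ≤ Q z := fun z => herm_self_nonneg (hGp z) _
  have hQc : Continuous Q := continuous_re.comp (contDiff_herm hG hu.wirtM hu.wirtM).continuous
  have hNs : HasCompactSupport N := huc.mono fun z (hz : N z ≠ 0) (h : u z = 0) =>
    hz (by simp [hN, h])
  have hQs : HasCompactSupport Q := by
    refine HasCompactSupport.intro huc fun z hz => ?_
    simp [hQ, (wirtM_eq_zero_of_notMem_tsupport hz).1]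
  have hβ' : ∀ z, herm (H z) (wirtM α z + α z * A z) (wirtM α z + α z * A z) =
      herm (H z)⁻¹ (wirtM u z) (wirtM u z) := fun z => by rw [hβ, herm_mul_inv (hHp z)]
  have hα' : ∀ z, herm (H z) (α z) (α z) = herm (H z)⁻¹ (u z) (u z) := fun z =>
    herm_mul_inv (hHp z) _ _
  -- The value `κ = (1-d)/R²` is forced by `κR² + d = 1`.
  have hD : ∀ d ∈ Set.Ioo (0 : ℝ) 1,
      ∫ z, (1 - d) / R ^ 2 * d / regSq ((1 - d) / R ^ 2) d z ^ 2 * N z ≤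
        R ^ 2 / (1 - d) * ∫ z, Q z / normSq z := by
    intro d hd
    have hd1 : 0 < 1 - d := by linarith [hd.2]
    have hκ : 0 < (1 - d) / R ^ 2 := by positivity
    have h := regularized_apriori hH hHp hA hHA hR hcurv hαs hαc (hsub.trans huR) hκ hd.1
      (by field_simp; ring)
    simp only [hβ', hα'] at h
    refine h.trans ?_
    rw [← integral_const_mul]
    refine integral_mono_ae ?_ (hi.const_mul _) ?_
    · refine Continuous.integrable_of_hasCompactSupport
        ((continuous_const.div contDiff_regSq.continuous
          fun z => (regSq_pos hκ.le hd.1).ne').mul hQc) hQs.mul_left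
    · filter_upwards [compl_mem_ae_iff.2 (measure_singleton (0 : ℂ))] with z (hz : z ≠ 0)
      have hx : 0 < normSq z := normSq_pos.2 hz
      have h1 : 1 / regSq ((1 - d) / R ^ 2) d z ≤ R ^ 2 / (1 - d) * (1 / normSq z) := by
        rw [div_mul_div_comm, mul_one, regSq]
        rw [div_le_div_iff₀ (by have := hd.1; positivity) (by positivity)]
        have : R ^ 2 * ((1 - d) / R ^ 2 * normSq z + d) = (1 - d) * normSq z + R ^ 2 * d := by
          field_simp
        rw [this]
        have := mul_nonneg (sq_nonneg R) hd.1.le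
        linarith
      calc 1 / regSq ((1 - d) / R ^ 2) d z * Q z ≤ R ^ 2 / (1 - d) * (1 / normSq z) * Q z :=
            mul_le_mul_of_nonneg_right h1 (hQ0 z)
        _ = R ^ 2 / (1 - d) * (Q z / normSq z) := by ring
  have hε : ∀ ε > 0, Real.pi * (N 0 - ε) ≤ R ^ 2 * ∫ z, Q z / normSq z := by
    intro ε hε
    -- Only the disc where `N ≥ N(0) - ε` is kept; it carries the mass of
    -- `integral_regularized_dirac`, which tends to `π`.
    obtain ⟨η, hη, hNη⟩ := Metric.continuous_iff.1 hNc 0 ε hε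
    have hle : ∀ d ∈ Set.Ioo (0 : ℝ) 1,
        Real.pi * (1 - d / ((1 - d) / R ^ 2 * η ^ 2 + d)) * (N 0 - ε) ≤
          R ^ 2 / (1 - d) * ∫ z, Q z / normSq z := by
      intro d hd
      refine le_trans ?_ (hD d hd)
      have hd1 : 0 < 1 - d := by linarith [hd.2]
      have hκ : 0 < (1 - d) / R ^ 2 := by positivity
      have hk : Continuous fun z => (1 - d) / R ^ 2 * d / regSq ((1 - d) / R ^ 2) d z ^ 2 :=
        continuous_const.div (contDiff_regSq.continuous.pow 2)
          fun z => pow_ne_zero 2 (regSq_pos hκ.le hd.1).ne'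
      have hk0 : ∀ z, 0 ≤ (1 - d) / R ^ 2 * d / regSq ((1 - d) / R ^ 2) d z ^ 2 := fun z => by
        have := hd.1.le
        positivity
      have hi2 : Integrable fun z =>
          (1 - d) / R ^ 2 * d / regSq ((1 - d) / R ^ 2) d z ^ 2 * N z :=
        (hk.mul hNc).integrable_of_hasCompactSupport hNs.mul_left
      rw [← integral_regularized_dirac hκ hd.1 hη.le, ← integral_mul_const]
      refine le_trans (setIntegral_mono_on ?_ hi2.integrableOn measurableSet_ball
        fun z hz => ?_) (setIntegral_le_integral hi2 (Filter.Eventually.of_forall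
          fun z => mul_nonneg (hk0 z) (hN0 z)))
      · exact (((hk.mul continuous_const).continuousOn.integrableOn_compact
          (isCompact_closedBall 0 η)).mono_set ball_subset_closedBall)
      · have := hNη z hz
        rw [Real.dist_eq] at this
        exact mul_le_mul_of_nonneg_left (by linarith [(abs_lt.1 this).1]) (hk0 z)
    have t1 : Filter.Tendsto (fun d : ℝ =>
        Real.pi * (1 - d / ((1 - d) / R ^ 2 * η ^ 2 + d)) * (N 0 - ε)) (𝓝[>] 0)
        (𝓝 (Real.pi * (1 - 0 / ((1 - 0) / R ^ 2 * η ^ 2 + 0)) * (N 0 - ε))) := by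
      refine Filter.Tendsto.mono_left (ContinuousAt.tendsto ?_) nhdsWithin_le_nhds
      have : (1 - (0 : ℝ)) / R ^ 2 * η ^ 2 + 0 ≠ 0 := by
        have : 0 < η ^ 2 / R ^ 2 := by positivity
        simp; exact ⟨hR.ne', hη.ne'⟩
      fun_prop (disch := assumption)
    have t2 : Filter.Tendsto (fun d : ℝ => R ^ 2 / (1 - d) * ∫ z, Q z / normSq z) (𝓝[>] 0)
        (𝓝 (R ^ 2 / (1 - 0) * ∫ z, Q z / normSq z)) := by
      refine Filter.Tendsto.mono_left (ContinuousAt.tendsto ?_) nhdsWithin_le_nhds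
      have : (1 : ℝ) - 0 ≠ 0 := by norm_num
      fun_prop (disch := assumption)
    have := le_of_tendsto_of_tendsto t1 t2
      (Filter.eventually_of_mem (Ioo_mem_nhdsGT one_pos) hle)
    simpa using this
  by_contra! hcon
  have hpi := Real.pi_pos
  have := hε ((Real.pi * N 0 - R ^ 2 * ∫ z, Q z / normSq z) / (2 * Real.pi))
    (div_pos (by linarith) (by positivity))
  rw [mul_sub, mul_div_assoc'] at this
  field_simp at this
  linarith

end Dual

end L2Extension

namespace L2Extension

open Complex ComplexConjugate Metric

/-! ### Mollification and Weyl's lemma for `∂/∂z̄` -/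

/-- The convolution `k * s`. -/
noncomputable def mollify (k s : ℂ → ℂ) (z : ℂ) : ℂ := ∫ w, k (z - w) * s w

section

variable {k k' s : ℂ → ℂ}

lemma hasFDerivAt_mollify (hk : ContDiff ℝ ∞ k) (hkc : HasCompactSupport k) (hs : Integrable s)
    (z : ℂ) : HasFDerivAt (mollify k s) (∫ w, s w • fderiv ℝ k (z - w)) z ∧
      Integrable (fun w => s w • fderiv ℝ k (z - w)) := by
  have hk' : Continuous (fderiv ℝ k) := (hk.fderiv_right (m := ∞) (by simp)).continuous
  obtain ⟨C, hC⟩ := hk'.bounded_above_of_compact_support (hkc.fderiv (𝕜 := ℝ))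
  obtain ⟨C0, hC0⟩ := hk.continuous.bounded_above_of_compact_support hkc
  have hi : ∀ z, Integrable fun w => k (z - w) * s w := fun z =>
    hs.bdd_mul (c := C0) (hk.continuous.comp (by fun_prop)).aestronglyMeasurable
      (Filter.Eventually.of_forall fun w => hC0 _)
  have hm : AEStronglyMeasurable (fun w => s w • fderiv ℝ k (z - w)) volume :=
    hs.aestronglyMeasurable.smul (hk'.comp (by fun_prop)).aestronglyMeasurable
  have hb : ∀ z w, ‖s w • fderiv ℝ k (z - w)‖ ≤ C * ‖s w‖ := fun z w => by
    rw [norm_smul, mul_comm]; gcongr; exact hC _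
  refine ⟨?_, (hs.norm.const_mul C).mono' hm (Filter.Eventually.of_forall fun w => hb z w)⟩
  refine hasFDerivAt_integral_of_dominated_of_fderiv_le (bound := fun w => C * ‖s w‖)
    (s := Set.univ) Filter.univ_mem
    (Filter.Eventually.of_forall fun z => (hi z).aestronglyMeasurable) (hi z) hm
    (Filter.Eventually.of_forall fun w z _ => hb z w) (hs.norm.const_mul C)
    (Filter.Eventually.of_forall fun w z _ => ?_)
  have h1 : HasFDerivAt (fun z => k (z - w)) (fderiv ℝ k (z - w)) z := by
    have := (hk.differentiable (by simp) (z - w)).hasFDerivAt.comp z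
      ((hasFDerivAt_id z).sub_const w)
    simpa [Function.comp_def] using this
  exact h1.mul_const (s w)

lemma wirtBar_mollify (hk : ContDiff ℝ ∞ k) (hkc : HasCompactSupport k) (hs : Integrable s)
    (z : ℂ) : wirtBar (mollify k s) z = ∫ w, s w * wirtBar k (z - w) := by
  obtain ⟨h1, h2⟩ := hasFDerivAt_mollify hk hkc hs z
  have h3 : ∀ v : ℂ, fderiv ℝ (mollify k s) z v = ∫ w, s w * fderiv ℝ k (z - w) v := fun v => by
    rw [h1.fderiv, ContinuousLinearMap.integral_apply h2]; simp
  have h4 : ∀ v : ℂ, Integrable fun w => s w * fderiv ℝ k (z - w) v := fun v => by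
    simpa using h2.apply_continuousLinearMap v
  rw [wirtBar, h3, h3, ← integral_const_mul, ← integral_add (h4 1) ((h4 I).const_mul I),
    ← integral_div]
  congr 1; ext w; rw [wirtBar]; ring

lemma mollify_comm (hk : Continuous k) (hkc : HasCompactSupport k) (hk' : Continuous k')
    (hkc' : HasCompactSupport k') (hs : Integrable s) :
    mollify k (mollify k' s) = mollify k' (mollify k s) := by
  have key : ∀ (k k' : ℂ → ℂ), Continuous k → HasCompactSupport k → Continuous k' →
      HasCompactSupport k' → ∀ x, mollify k (mollify k' s) x
        = ∫ w, s w * ∫ z, k (x - z) * k' (z - w) := by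
    intro k k' hk hkc hk' hkc' x
    obtain ⟨C, hC⟩ := hk'.bounded_above_of_compact_support hkc'
    have h1 : Integrable fun z => k (x - z) :=
      (hk.integrable_of_hasCompactSupport hkc).comp_sub_left x
    have h2 : Integrable (fun p : ℂ × ℂ => k' (p.1 - p.2) * (k (x - p.1) * s p.2))
        (volume.prod volume) :=
      (h1.mul_prod hs).bdd_mul (c := C) (hk'.comp (by fun_prop)).aestronglyMeasurable
        (Filter.Eventually.of_forall fun w => hC _)
    calc mollify k (mollify k' s) x = ∫ z, ∫ w, k' (z - w) * (k (x - z) * s w) := by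
          rw [mollify]; congr 1; ext z
          rw [mollify, ← integral_const_mul]; congr 1; ext w; ring
      _ = ∫ w, ∫ z, k' (z - w) * (k (x - z) * s w) := integral_integral_swap h2
      _ = _ := by
          congr 1; ext w; rw [← integral_const_mul]; congr 1; ext z; ring
  ext x
  rw [key k k' hk hkc hk' hkc', key k' k hk' hkc' hk hkc]
  congr 1; ext w; congr 1
  -- The reflection `z ↦ x + w - z` exchanges the two kernels.
  rw [← integral_sub_left_eq_self _ volume (x + w)]
  congr 1; ext z
  rw [mul_comm]; congr 2 <;> ring

/-- A radial mollifier. -/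
lemma exists_radial_mollifier {δ : ℝ} (hδ : 0 < δ) : ∃ κ : ℝ → ℝ,
    ContDiff ℝ ∞ (fun z : ℂ => (κ ‖z‖ : ℂ)) ∧ (∀ z : ℂ, z ∉ ball 0 δ → κ ‖z‖ = 0) ∧
      ∫ z : ℂ, (κ ‖z‖ : ℂ) = 1 := by
  let θ : ℂ → ℝ := fun z => Real.smoothTransition (1 - ‖z‖ ^ 2 / δ ^ 2)
  have hθ : ContDiff ℝ ∞ θ := Real.smoothTransition.contDiff.comp
    (contDiff_const.sub ((contDiff_norm_sq ℝ).div_const _))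
  have hθ0 : ∀ z, z ∉ ball (0 : ℂ) δ → θ z = 0 := fun z hz => by
    refine Real.smoothTransition.zero_of_nonpos ?_
    have : δ ≤ ‖z‖ := by simpa using hz
    rw [sub_nonpos, one_le_div (by positivity)]
    gcongr
  have hc : HasCompactSupport θ := HasCompactSupport.intro (isCompact_closedBall 0 δ)
    fun z hz => hθ0 z fun h => hz (ball_subset_closedBall h)
  have hpos : 0 < ∫ z, θ z := by
    refine hθ.continuous.integral_pos_of_hasCompactSupport_nonneg_nonzero hc
      (fun z => Real.smoothTransition.nonneg _) (x := 0) ?_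
    simp [θ, Real.smoothTransition.one_of_one_le]
  refine ⟨fun r => Real.smoothTransition (1 - r ^ 2 / δ ^ 2) / ∫ z, θ z,
    ofRealCLM.contDiff.comp (hθ.div_const _), fun z hz => ?_, ?_⟩
  · change θ z / _ = 0
    rw [hθ0 z hz, zero_div]
  · rw [integral_complex_ofReal]
    change ((∫ z, θ z / ∫ z, θ z : ℝ) : ℂ) = 1
    rw [integral_div, div_self hpos.ne', ofReal_one]

/-- A radial kernel of mass one averages over circles, so it reproduces holomorphic functions by the
mean value property. -/
lemma mollify_eq_of_differentiableOn {κ : ℝ → ℝ} {δ : ℝ}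
    (hκ : ContDiff ℝ ∞ (fun z : ℂ => (κ ‖z‖ : ℂ))) (hκ0 : ∀ z : ℂ, z ∉ ball 0 δ → κ ‖z‖ = 0)
    (hκ1 : ∫ z : ℂ, (κ ‖z‖ : ℂ) = 1) {g : ℂ → ℂ} (hgc : Continuous g) {x : ℂ}
    (hg : DifferentiableOn ℂ g (ball x δ)) : mollify (fun z => (κ ‖z‖ : ℂ)) g x = g x := by
  have h1 : mollify (fun z => (κ ‖z‖ : ℂ)) g x = ∫ t, (κ ‖t‖ : ℂ) * g (x - t) := by
    rw [mollify, ← integral_sub_left_eq_self _ volume x]; simp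
  have hc : HasCompactSupport fun z : ℂ => (κ ‖z‖ : ℂ) :=
    HasCompactSupport.intro (isCompact_closedBall 0 δ)
      fun z hz => by simp [hκ0 z fun h => hz (ball_subset_closedBall h)]
  have i1 : Integrable fun t : ℂ => (κ ‖t‖ : ℂ) * g (x - t) :=
    (hκ.continuous.mul (by fun_prop)).integrable_of_hasCompactSupport hc.mul_right
  have i2 : Integrable fun t : ℂ => (κ ‖t‖ : ℂ) * g x :=
    (hκ.continuous.mul (by fun_prop)).integrable_of_hasCompactSupport hc.mul_right
  have h2 : ∫ t in ball 0 δ, (κ ‖t‖ : ℂ) * (g (x - t) - g x) = 0 := by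
    refine integral_radial_mul_eq_zero (k := fun r => (κ r : ℂ)) (g := fun t => g (x - t) - g x)
      ?_ (by simp) ?_
    · refine DifferentiableOn.sub_const ?_ _
      refine hg.comp (by fun_prop) fun t ht => ?_
      simpa using ht
    · simpa only [mul_sub, Pi.sub_def] using (i1.sub i2).integrableOn
  rw [setIntegral_eq_integral_of_forall_compl_eq_zero fun t ht => by simp [hκ0 t ht]] at h2
  simp only [mul_sub] at h2
  rw [integral_sub i1 i2, integral_mul_const, hκ1, one_mul, sub_eq_zero] at h2
  rw [h1, h2]

/-- Weyl's lemma: integrable weak solutions of `∂s/∂z̄ = 0` are holomorphic. -/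
theorem exists_holomorphic_of_weak {r R : ℝ} (hrR : r < R) (hs : IntegrableOn s (ball 0 R))
    (h : ∀ φ : ℂ → ℂ, ContDiff ℝ ∞ φ → HasCompactSupport φ → tsupport φ ⊆ ball 0 R →
      ∫ z in ball 0 R, s z * wirtBar φ z = 0) :
    ∃ f : ℂ → ℂ, Continuous f ∧ DifferentiableOn ℂ f (ball 0 r) ∧
      ∀ᵐ z, z ∈ ball 0 r → s z = f z := by
  set S : ℂ → ℂ := (ball 0 R).indicator s with hS
  have hSi : Integrable S := hs.integrable_indicator measurableSet_ball
  -- Mollifications are holomorphic: `∂/∂z̄` of `k * S` at `z` is, up to sign, the weak equation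
  -- tested on `w ↦ k(z - w)`. This function is supported in the closed `δ`-disc about `z`, which
  -- lies in the disc of radius `R` when `|z| < R - δ`.
  have hol : ∀ (k : ℂ → ℂ) (δ : ℝ), ContDiff ℝ ∞ k → (∀ z, z ∉ ball 0 δ → k z = 0) →
      Continuous (mollify k S) ∧ DifferentiableOn ℂ (mollify k S) (ball 0 (R - δ)) := by
    intro k δ hk hk0
    have hsub : tsupport k ⊆ closedBall 0 δ := closure_minimal
      (fun z (hz : k z ≠ 0) => ball_subset_closedBall (by by_contra hc; exact hz (hk0 z hc)))
      isClosed_closedBall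
    have hkc : HasCompactSupport k := (isCompact_closedBall 0 δ).of_isClosed_subset
      (isClosed_tsupport k) hsub
    have hd := fun z => (hasFDerivAt_mollify hk hkc hSi z).1.differentiableAt
    refine ⟨continuous_iff_continuousAt.2 fun z => (hd z).continuousAt, fun z hz =>
      (differentiableAt_complex_of_wirtBar_eq_zero (hd z) ?_).differentiableWithinAt⟩
    rw [wirtBar_mollify hk hkc hSi]
    have e : ∀ w, wirtBar (fun w => k (z - w)) w = - wirtBar k (z - w) := fun w => by
      have : HasFDerivAt (fun w => k (z - w)) (-(fderiv ℝ k (z - w))) w := by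
        have := (hk.differentiable (by simp) (z - w)).hasFDerivAt.comp w
          ((hasFDerivAt_id w).const_sub z)
        simpa [Function.comp_def] using this
      rw [wirtBar, wirtBar, this.fderiv]; simp; ring
    have hts : tsupport (fun w => k (z - w)) ⊆ closedBall z δ := closure_minimal
      (fun w (hw : k (z - w) ≠ 0) => by
        have : z - w ∈ closedBall (0 : ℂ) δ := hsub (subset_tsupport k hw)
        rw [mem_closedBall, dist_comm, dist_eq_norm]; simpa using this) isClosed_closedBall
    have := h (fun w => k (z - w)) (hk.comp (contDiff_const.sub contDiff_id))
      ((isCompact_closedBall z δ).of_isClosed_subset (isClosed_tsupport _) hts)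
      (hts.trans fun w hw => by
        rw [mem_ball_zero_iff] at hz ⊢
        rw [mem_closedBall, dist_eq_norm] at hw
        have := norm_add_le (w - z) z
        rw [sub_add_cancel] at this
        linarith)
    rw [← integral_indicator measurableSet_ball] at this
    rw [← neg_eq_zero, ← integral_neg, ← this]
    congr 1; ext w
    by_cases hw : w ∈ ball (0 : ℂ) R
    · simp only [hS, Set.indicator_of_mem hw, e]; ring
    · simp [hS, Set.indicator_of_notMem hw]
  -- A third of the gap ensures that the `δ`-disc about a point of the `r`-disc stays in the disc of
  -- radius `R - δ`.
  have hδ : 0 < (R - r) / 3 := by linarith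
  set δ := (R - r) / 3 with hδdef
  obtain ⟨κ, hκ, hκ0, hκ1⟩ := exists_radial_mollifier hδ
  set k : ℂ → ℂ := fun z => (κ ‖z‖ : ℂ) with hk
  have hkc : HasCompactSupport k := HasCompactSupport.intro (isCompact_closedBall 0 δ)
    fun z hz => by simp [hk, hκ0 z fun h => hz (ball_subset_closedBall h)]
  have hkh := hol k δ hκ fun z hz => by simp [hk, hκ0 z hz]
  refine ⟨mollify k S, hkh.1, hkh.2.mono (ball_subset_ball (by linarith)), ?_⟩
  let φ : ℕ → ContDiffBump (0 : ℂ) := fun i =>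
    ⟨δ / (i + 1) / 2, δ / (i + 1), by positivity, by
      have : 0 < δ / (i + 1) := by positivity
      linarith⟩
  have hφ : Filter.Tendsto (fun i => (φ i).rOut) Filter.atTop (𝓝 0) := by
    have := (tendsto_one_div_add_atTop_nhds_zero_nat (𝕜 := ℝ)).const_mul δ
    simpa [φ, div_eq_mul_inv] using this
  have hae := ContDiffBump.ae_convolution_tendsto_right_of_locallyIntegrable (K := 2) hφ
    (Filter.Eventually.of_forall fun i => by simp only [φ]; linarith) hSi.locallyIntegrable
  filter_upwards [hae] with x hx hxr
  have hx2 := ContDiffBump.convolution_tendsto_right_of_continuous (μ := volume) hφ hkh.1 x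
  have hconv : ∀ (i : ℕ) (g : ℂ → ℂ), (MeasureTheory.convolution ((φ i).normed volume) g
      (ContinuousLinearMap.lsmul ℝ ℝ) volume) x
        = mollify (fun z => ((φ i).normed volume z : ℂ)) g x := fun i g => by
    rw [convolution_eq_swap, mollify]; simp
  simp only [hconv] at hx hx2
  -- Near `x` the function `φ_i * S` is holomorphic, so `φ_i * (k * S) = k * (φ_i * S) = φ_i * S` at
  -- `x`. As `i → ∞` the two ends tend to `k * S` and, almost everywhere, to `S`; hence the two
  -- agree almost everywhere.
  have heq : ∀ i, mollify (fun z => ((φ i).normed volume z : ℂ)) (mollify k S) x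
      = mollify (fun z => ((φ i).normed volume z : ℂ)) S x := fun i => by
    have hφs : ContDiff ℝ ∞ fun z => ((φ i).normed volume z : ℂ) :=
      ofRealCLM.contDiff.comp (φ i).contDiff_normed
    have hφ0 : ∀ z, z ∉ ball (0 : ℂ) δ → ((φ i).normed volume z : ℂ) = 0 := fun z hz => by
      have : z ∉ Function.support ((φ i).normed volume) := by
        rw [(φ i).support_normed_eq]
        refine fun h => hz (ball_subset_ball ?_ h)
        exact div_le_self hδ.le (by simp)
      rw [Function.notMem_support.1 this, ofReal_zero]
    have hφc : HasCompactSupport fun z => ((φ i).normed volume z : ℂ) :=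
      HasCompactSupport.intro (isCompact_closedBall 0 δ)
        fun z hz => hφ0 z fun h => hz (ball_subset_closedBall h)
    rw [mollify_comm hφs.continuous hφc hκ.continuous hkc hSi]
    have hh := hol _ δ hφs hφ0
    refine mollify_eq_of_differentiableOn hκ hκ0 hκ1 hh.1 (hh.2.mono fun w hw => ?_)
    rw [mem_ball_zero_iff] at hxr ⊢
    rw [mem_ball, dist_eq_norm] at hw
    have := norm_add_le (w - x) x
    rw [sub_add_cancel] at this
    linarith
  simp only [heq] at hx2
  have := tendsto_nhds_unique hx hx2
  rw [← this, hS, Set.indicator_of_mem (ball_subset_ball hrR.le hxr)]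

end

end L2Extension

/-! ### Duality: test sections and weak solutions of the extension problem -/

namespace L2Extension

open Complex ComplexConjugate Metric Matrix
open scoped ComplexOrder

/-- A bounded functional on the range of a linear map into a Hilbert space is represented by a
vector of the Hilbert space. -/
lemma exists_inner_eq_of_bound {V E : Type*} [AddCommGroup V] [Module ℂ V] [NormedAddCommGroup E]
    [InnerProductSpace ℂ E] [CompleteSpace E] (F : V →ₗ[ℂ] E) (ℓ : V →ₗ[ℂ] ℂ) {C : ℝ}
    (hC : 0 ≤ C) (h : ∀ v, ‖ℓ v‖ ≤ C * ‖F v‖) :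
    ∃ g : E, ‖g‖ ≤ C ∧ ∀ v, inner ℂ g (F v) = ℓ v := by
  have hker : LinearMap.ker F ≤ LinearMap.ker ℓ := fun v hv => by
    have := h v
    rw [LinearMap.mem_ker.1 hv, norm_zero, mul_zero] at this
    exact LinearMap.mem_ker.2 (norm_le_zero_iff.1 this)
  -- By the bound, `ℓ` descends to a bounded functional on the range of `F`; it is extended by
  -- Hahn-Banach and represented by Riesz.
  let ℓ' : LinearMap.range F →ₗ[ℂ] ℂ :=
    ((LinearMap.ker F).liftQ ℓ hker) ∘ₗ F.quotKerEquivRange.symm.toLinearMap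
  have hℓ' : ∀ v, ℓ' ⟨F v, LinearMap.mem_range_self F v⟩ = ℓ v := fun v => by
    have : F.quotKerEquivRange.symm ⟨F v, LinearMap.mem_range_self F v⟩ =
        (LinearMap.ker F).mkQ v := F.quotKerEquivRange_symm_apply_image v _
    simp only [ℓ', LinearMap.comp_apply, LinearEquiv.coe_coe, this, Submodule.mkQ_apply,
      Submodule.liftQ_apply]
  have hb : ∀ w, ‖ℓ' w‖ ≤ C * ‖w‖ := by
    rintro ⟨_, v, rfl⟩
    rw [hℓ']; exact h v
  obtain ⟨f, hf, hfn⟩ := exists_extension_norm_eq _ (ℓ'.mkContinuous C hb)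
  refine ⟨(InnerProductSpace.toDual ℂ E).symm f, ?_, fun v => ?_⟩
  · rw [LinearIsometryEquiv.norm_map, hfn]
    exact LinearMap.mkContinuous_norm_le _ hC _
  · rw [InnerProductSpace.toDual_symm_apply]
    have := hf ⟨F v, LinearMap.mem_range_self F v⟩
    rw [this, LinearMap.mkContinuous_apply, hℓ']

section Sqrt

open scoped Matrix.Norms.L2Operator MatrixOrder

/-- Applied to `G = H⁻¹`, the root turns the varying fibre norms into the Euclidean norm, so that an
ordinary `L²` space of vector functions suffices. -/
lemma exists_continuous_sqrt {ι : Type*} [Fintype ι] [DecidableEq ι] {G : ℂ → Matrix ι ι ℂ}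
    (hG : Continuous G) (hGp : ∀ z, (G z).PosSemidef) :
    ∃ B : ℂ → Matrix ι ι ℂ, Continuous B ∧ ∀ z, (B z).IsHermitian ∧ B z * B z = G z := by
  have h0 : ∀ z, 0 ≤ G z := fun z => Matrix.nonneg_iff_posSemidef.2 (hGp z)
  refine ⟨fun z => CFC.sqrt (G z), ?_, fun z => ⟨?_, CFC.sqrt_mul_sqrt_self _ (h0 z)⟩⟩
  · exact CFC.continuousOn_sqrt.comp_continuous hG h0
  · exact (CFC.sqrt_nonneg (G z)).isSelfAdjoint

end Sqrt

/-- Radial cutoffs of the form `θ(|z|²)`. -/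
lemma exists_radial_cutoff {r : ℝ} (hr : 0 < r) : ∃ θ : ℝ → ℝ, ContDiff ℝ ∞ θ ∧ θ 0 = 1 ∧
    ∀ x, r ^ 2 / 2 ≤ x → θ x = 0 := by
  refine ⟨fun x => Real.smoothTransition (1 - 2 * x / r ^ 2), ?_, ?_, fun x hx => ?_⟩
  · exact Real.smoothTransition.contDiff.comp
      (contDiff_const.sub ((contDiff_const.mul contDiff_id).div_const _))
  · simp [Real.smoothTransition.one_of_one_le]
  · refine Real.smoothTransition.zero_of_nonpos ?_
    rw [sub_nonpos, one_le_div (by positivity)]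
    linarith

section Extension

variable {ι : Type*} [Fintype ι]

/-- The space of test sections used to solve the extension problem. -/
def testSpace (ι : Type*) (R : ℝ) : Submodule ℂ (ℂ → Matrix Unit ι ℂ) where
  carrier := {u | SmoothM u ∧ (∃ r < R, ∀ z, z ∉ closedBall 0 r → u z = 0) ∧
    ∃ C, ∀ z j, ‖wirtM u z () j‖ ≤ C * ‖z‖}
  zero_mem' := ⟨SmoothM.const 0, ⟨R - 1, by linarith, fun _ _ => rfl⟩, 0, fun z j => by
    have : wirtM (0 : ℂ → Matrix Unit ι ℂ) z = 0 := by
      ext i j; exact wirt_const 0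
    simp [this]⟩
  add_mem' := by
    rintro u v ⟨hu, ⟨r, hr, hur⟩, C, hC⟩ ⟨hv, ⟨r', hr', hvr⟩, C', hC'⟩
    refine ⟨hu.add hv, ⟨max r r', max_lt hr hr', fun z hz => ?_⟩, C + C', fun z j => ?_⟩
    · simp only [mem_closedBall, le_max_iff, not_or] at hz
      simp [hur z (by simpa using hz.1), hvr z (by simpa using hz.2)]
    · have : wirtM (u + v) z = wirtM u z + wirtM v z := wirtM_add hu hv
      rw [this, Matrix.add_apply, add_mul]
      exact (norm_add_le _ _).trans (add_le_add (hC z j) (hC' z j))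
  smul_mem' := by
    rintro c u ⟨hu, ⟨r, hr, hur⟩, C, hC⟩
    refine ⟨hu.smul contDiff_const, ⟨r, hr, fun z hz => by simp [hur z hz]⟩, ‖c‖ * C,
      fun z j => ?_⟩
    have : wirtM (c • u) z = c • wirtM u z := by
      have h := wirtM_smul (z := z) (φ := fun _ => c) contDiff_const hu
      rw [wirt_const, zero_smul, zero_add] at h
      exact h
    rw [this, Matrix.smul_apply, norm_smul, mul_assoc]
    gcongr
    exact hC z j

end Extension

end L2Extension

namespace L2Extension

open Complex ComplexConjugate Metric Matrix
open scoped ComplexOrder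

section Extension

lemma tsupport_testSpace {ι : Type*} {R : ℝ} (v : testSpace ι R) :
    HasCompactSupport v.1 ∧ tsupport v.1 ⊆ ball 0 R := by
  obtain ⟨-, ⟨r, hr, h⟩, -⟩ := v.2
  have hsub : tsupport v.1 ⊆ closedBall 0 r := closure_minimal
    (fun z (hz : v.1 z ≠ 0) => by by_contra hc; exact hz (h z hc)) isClosed_closedBall
  exact ⟨(isCompact_closedBall 0 r).of_isClosed_subset (isClosed_tsupport _) hsub,
    hsub.trans (closedBall_subset_ball hr)⟩

variable {ι : Type*} [Fintype ι] {R : ℝ}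

/-- The square integrable row vector `u_z B / z̄` attached to a test section `u`. -/
noncomputable def testVec (B : ℂ → Matrix ι ι ℂ) (u : ℂ → Matrix Unit ι ℂ) (z : ℂ) :
    EuclideanSpace ℂ ι :=
  WithLp.toLp 2 fun i => (wirtM u z * B z) () i / conj z

/-- The condition `|u_z| ≤ C|z|` imposed on test sections keeps the quotient by `z̄` bounded; at the
origin the quotient is `0` by convention. -/
lemma memLp_testVec {B : ℂ → Matrix ι ι ℂ} (hB : Continuous B) (v : testSpace ι R) :
    MemLp (testVec B v.1) 2 (volume.restrict (ball 0 R)) := by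
  obtain ⟨hu, -, C, hC⟩ := v.2
  have hcont : Continuous fun z => wirtM v.1 z * B z := hu.wirtM.continuous.matrix_mul hB
  have hmeas : Measurable (testVec B v.1) := by
    have h : Measurable fun z => fun i => (wirtM v.1 z * B z) () i / conj z :=
      measurable_pi_lambda _ fun i => (hcont.matrix_elem () i).measurable.div
        (Complex.continuous_conj.measurable)
    exact (PiLp.continuous_toLp 2 (fun _ : ι => ℂ)).measurable.comp h
  have hbd : ∃ K : ℝ, ∀ z ∈ ball (0 : ℂ) R, ∀ i, ‖(testVec B v.1 z) i‖ ≤ K := by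
    obtain ⟨M, hM⟩ : ∃ M : ℝ, ∀ z ∈ closedBall (0 : ℂ) R, ∀ j i, ‖B z j i‖ ≤ M := by
      have : ∀ j i, ∃ M : ℝ, ∀ z ∈ closedBall (0 : ℂ) R, ‖B z j i‖ ≤ M := fun j i =>
        (isCompact_closedBall (0 : ℂ) R).exists_bound_of_continuousOn
          (hB.matrix_elem j i).continuousOn
      choose M hM using this
      refine ⟨∑ j, ∑ i, |M j i|, fun z hz j i => (hM j i z hz).trans ((le_abs_self _).trans ?_)⟩
      exact (Finset.single_le_sum (f := fun i => |M j i|) (fun _ _ => abs_nonneg _)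
        (Finset.mem_univ i)).trans (Finset.single_le_sum (f := fun j => ∑ i, |M j i|)
          (fun _ _ => Finset.sum_nonneg fun _ _ => abs_nonneg _) (Finset.mem_univ j))
    refine ⟨∑ _j : ι, |C| * |M|, fun z hz i => ?_⟩
    simp only [testVec, norm_div, RCLike.norm_conj]
    by_cases hz0 : z = 0
    · simp only [hz0, norm_zero, div_zero]
      exact Finset.sum_nonneg fun _ _ => by positivity
    · rw [div_le_iff₀ (norm_pos_iff.2 hz0), Matrix.mul_apply, Finset.sum_mul]
      refine (norm_sum_le _ _).trans (Finset.sum_le_sum fun j _ => ?_)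
      rw [norm_mul]
      calc ‖wirtM v.1 z () j‖ * ‖B z j i‖ ≤ (|C| * ‖z‖) * |M| := by
            gcongr
            · exact (hC z j).trans (by gcongr; exact le_abs_self C)
            · exact (hM z (ball_subset_closedBall hz) j i).trans (le_abs_self M)
        _ = |C| * |M| * ‖z‖ := by ring
  obtain ⟨K, hK⟩ := hbd
  have : IsFiniteMeasure (volume.restrict (ball (0 : ℂ) R)) :=
    ⟨by rw [Measure.restrict_apply_univ]; exact measure_ball_lt_top⟩
  refine MemLp.of_bound hmeas.aestronglyMeasurable (Real.sqrt (∑ _i : ι, K ^ 2)) ?_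
  filter_upwards [ae_restrict_mem measurableSet_ball] with z hz
  rw [EuclideanSpace.norm_eq]
  refine Real.sqrt_le_sqrt (Finset.sum_le_sum fun i _ => ?_)
  have := hK z hz i
  gcongr

/-- The linear map `u ↦ u_z B / z̄` from test sections to square integrable functions. -/
noncomputable def testMap {B : ℂ → Matrix ι ι ℂ} (hB : Continuous B) :
    testSpace ι R →ₗ[ℂ] Lp (EuclideanSpace ℂ ι) 2 (volume.restrict (ball (0 : ℂ) R)) where
  toFun v := (memLp_testVec hB v).toLp _
  map_add' u v := by
    rw [← MemLp.toLp_add]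
    refine MemLp.toLp_congr _ _ (Filter.Eventually.of_forall fun z => ?_)
    have : wirtM (u.1 + v.1) z = wirtM u.1 z + wirtM v.1 z := wirtM_add u.2.1 v.2.1
    ext i
    simp [testVec, this, Matrix.add_mul, add_div]
  map_smul' c v := by
    rw [RingHom.id_apply, ← MemLp.toLp_const_smul]
    refine MemLp.toLp_congr _ _ (Filter.Eventually.of_forall fun z => ?_)
    have : wirtM (c • v.1) z = c • wirtM v.1 z := by
      have h := wirtM_smul (z := z) (φ := fun _ => c) contDiff_const v.2.1
      rw [wirt_const, zero_smul, zero_add] at h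
      exact h
    ext i
    simp [testVec, this, mul_div_assoc]

lemma norm_sq_row_mul {B G : Matrix ι ι ℂ} (hB : B.IsHermitian) (hBG : B * B = G)
    (a : Matrix Unit ι ℂ) : ∑ i, ‖(a * B) () i‖ ^ 2 = (herm G a a).re := by
  classical
  have h1 : herm G a a = herm 1 (a * B) (a * B) := by
    rw [herm, herm, conjTranspose_mul, hB.eq, Matrix.mul_one, ← hBG]
    simp only [Matrix.mul_assoc]
  rw [h1, herm_eq_sum]
  simp [Matrix.one_apply, Complex.mul_conj, Complex.normSq_eq_norm_sq, re_sum]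
  norm_cast

lemma norm_sq_testMap {B G : ℂ → Matrix ι ι ℂ} (hB : Continuous B)
    (hBG : ∀ z, (B z).IsHermitian ∧ B z * B z = G z) (v : testSpace ι R) :
    Integrable (fun z => (herm (G z) (wirtM v.1 z) (wirtM v.1 z)).re / normSq z) ∧
    ‖testMap hB v‖ ^ 2 = ∫ z, (herm (G z) (wirtM v.1 z) (wirtM v.1 z)).re / normSq z := by
  have hpt : ∀ z, ‖testVec B v.1 z‖ ^ 2 =
      (herm (G z) (wirtM v.1 z) (wirtM v.1 z)).re / normSq z := fun z => by
    rw [EuclideanSpace.norm_sq_eq, ← norm_sq_row_mul (hBG z).1 (hBG z).2, Finset.sum_div]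
    refine Finset.sum_congr rfl fun i _ => ?_
    simp [testVec, div_pow, Complex.normSq_eq_norm_sq]
  have hzero : ∀ z, z ∉ ball (0 : ℂ) R → ‖testVec B v.1 z‖ ^ 2 = 0 := fun z hz => by
    have : z ∉ tsupport v.1 := fun h => hz ((tsupport_testSpace v).2 h)
    rw [hpt, (wirtM_eq_zero_of_notMem_tsupport this).1]; simp
  have hm := memLp_testVec hB v
  have hi : IntegrableOn (fun z => ‖testVec B v.1 z‖ ^ 2) (ball 0 R) := 
    (memLp_two_iff_integrable_sq_norm hm.1).1 hm
  have hi2 : Integrable (fun z => ‖testVec B v.1 z‖ ^ 2) :=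
    (integrableOn_iff_integrable_of_support_subset fun z hz => by
      by_contra hc; exact hz (hzero z hc)).1 hi
  simp only [hpt] at hi2
  refine ⟨hi2, ?_⟩
  have h1 : ‖testMap hB v‖ ^ 2 = ∫ z in ball 0 R, ‖testVec B v.1 z‖ ^ 2 := by
    rw [@norm_sq_eq_re_inner ℂ, L2.inner_def, ← integral_re (L2.integrable_inner _ _)]
    refine integral_congr_ae ?_
    filter_upwards [hm.coeFn_toLp] with z hz
    have : (testMap hB v : ℂ → EuclideanSpace ℂ ι) z = testVec B v.1 z := hz
    rw [this, ← norm_sq_eq_re_inner]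
  rw [h1, setIntegral_eq_integral_of_forall_compl_eq_zero hzero]
  simp only [hpt]

end Extension

end L2Extension

namespace L2Extension

open Complex ComplexConjugate Metric Matrix
open scoped ComplexOrder

section Extension

lemma single_mem_testSpace {ι : Type*} [DecidableEq ι] {R : ℝ} {φ : ℂ → ℂ}
    (hφ : ContDiff ℝ ∞ φ) (hs : ∃ r < R, ∀ z, z ∉ closedBall 0 r → φ z = 0)
    (hb : ∃ C, ∀ z, ‖wirt φ z‖ ≤ C * ‖z‖) (j : ι) :
    (fun z => φ z • Matrix.single () j (1 : ℂ)) ∈ testSpace ι R := by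
  have hc : SmoothM fun _ : ℂ => Matrix.single () j (1 : ℂ) := SmoothM.const _
  refine ⟨hc.smul hφ, ?_, ?_⟩
  · obtain ⟨r, hr, h⟩ := hs
    exact ⟨r, hr, fun z hz => by simp [h z hz]⟩
  · obtain ⟨C, hC⟩ := hb
    refine ⟨C, fun z i => ?_⟩
    have : wirtM (fun _ : ℂ => Matrix.single () j (1 : ℂ)) z = 0 := by
      ext a b; exact wirt_const _
    rw [wirtM_smul hφ hc, this, smul_zero, add_zero, Matrix.smul_apply, norm_smul]
    refine le_trans ?_ (hC z)
    refine mul_le_of_le_one_right (norm_nonneg _) ?_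
    rw [Matrix.single_apply]; split_ifs <;> simp

lemma wirtM_smul_single {ι : Type*} [DecidableEq ι] {φ : ℂ → ℂ} (hφ : ContDiff ℝ ∞ φ) (j : ι)
    (z : ℂ) : wirtM (fun z => φ z • Matrix.single () j (1 : ℂ)) z =
      wirt φ z • Matrix.single () j (1 : ℂ) := by
  have : wirtM (fun _ : ℂ => Matrix.single () j (1 : ℂ)) z = 0 := by
    ext a b; exact wirt_const _
  rw [wirtM_smul hφ (SmoothM.const _), this, smul_zero, add_zero]

variable {ι : Type*} [Fintype ι] [DecidableEq ι] {R : ℝ} {H A : ℂ → Matrix ι ι ℂ}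

/-- The functional `u ↦ -π u(0) ξ*`. -/
noncomputable def deltaFunctional (R : ℝ) (ξ : Matrix Unit ι ℂ) : testSpace ι R →ₗ[ℂ] ℂ where
  toFun v := -Real.pi * herm 1 (v.1 0) ξ
  map_add' u v := by
    have : (u + v).1 0 = u.1 0 + v.1 0 := rfl
    rw [this, herm_add_left]; ring
  map_smul' c v := by
    have : (c • v).1 0 = c • v.1 0 := rfl
    rw [this, herm_smul_left, RingHom.id_apply, smul_eq_mul]; ring

/-- Weak form of the extension theorem. -/
lemma exists_weak_extension (hH : SmoothM H) (hHp : ∀ z, (H z).PosDef) (hA : SmoothM A)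
    (hHA : ∀ z, wirtM H z = A z * H z) (hR : 0 < R)
    (hcurv : ∀ z ∈ ball 0 R, ∀ a : Matrix Unit ι ℂ, (herm (H z) (a * wirtBarM A z) a).re ≤ 0)
    (ξ : Matrix Unit ι ℂ) :
    ∃ s : ℂ → Matrix Unit ι ℂ, (∀ j, IntegrableOn (fun z => s z () j) (ball 0 R)) ∧
      IntegrableOn (fun z => (herm (H z) (s z) (s z)).re) (ball 0 R) ∧
      ∫ z in ball 0 R, (herm (H z) (s z) (s z)).re ≤ Real.pi * R ^ 2 * (herm (H 0) ξ ξ).re ∧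
      ∀ (φ : ℂ → ℂ), ContDiff ℝ ∞ φ → (∃ r < R, ∀ z, z ∉ closedBall 0 r → φ z = 0) →
        (∃ C, ∀ z, ‖wirt φ z‖ ≤ C * ‖z‖) → ∀ j,
        ∫ z in ball 0 R, wirt φ z / conj z * conj (s z () j) =
          -Real.pi * φ 0 * conj (ξ () j) := by
  have hinv : ∀ z, (H z)⁻¹ * H z = 1 := fun z =>
    Matrix.nonsing_inv_mul _ ((isUnit_iff_isUnit_det _).1 (hHp z).isUnit)
  have hG := hH.inv_of_posDef hHp
  have hGp : ∀ z, ((H z)⁻¹).PosSemidef := fun z => (hHp z).inv.posSemidef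
  obtain ⟨B, hBc, hB⟩ := exists_continuous_sqrt hG.continuous hGp
  have hBHB : ∀ z, B z * H z * B z = 1 := fun z => by
    rw [mul_eq_one_comm, ← Matrix.mul_assoc, (hB z).2, hinv]
  set h := (herm (H 0) ξ ξ).re with hh
  have hh0 : 0 ≤ h := herm_self_nonneg (hHp 0).posSemidef ξ
  -- Cauchy-Schwarz in the dual metric and `sharp_apriori` give `|π u(0)ξ*|² ≤ π² |u(0)|² |ξ|² ≤ πR²
  -- |ξ|² ‖F u‖²`, where `F` is `testMap`.
  set C := Real.sqrt (Real.pi * R ^ 2 * h) with hC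
  have hC2 : C ^ 2 = Real.pi * R ^ 2 * h := Real.sq_sqrt (by positivity)
  obtain ⟨g, hgC, hg⟩ := exists_inner_eq_of_bound (testMap (R := R) hBc) (deltaFunctional R ξ)
    (C := C) (Real.sqrt_nonneg _) (by
      intro v
      rw [← sq_le_sq₀ (norm_nonneg _) (by positivity), mul_pow, hC2]
      obtain ⟨hi, hn⟩ := norm_sq_testMap hBc hB v
      obtain ⟨hvc, hvR⟩ := tsupport_testSpace v
      have h1 := sharp_apriori hH hHp hA hHA hR hcurv v.2.1 hvc hvR hi
      rw [← hn] at h1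
      -- The row `ξH` represents `ξ` in the dual metric and has there the same norm as `ξ` in `H`.
      have e1 : herm 1 (v.1 0) ξ = herm (H 0)⁻¹ (v.1 0) (ξ * H 0) := by
        rw [herm, herm, conjTranspose_mul, (hHp 0).isHermitian.eq, Matrix.mul_one,
          Matrix.mul_assoc, ← Matrix.mul_assoc _ (H 0), hinv, Matrix.one_mul]
      have e2 : herm (H 0)⁻¹ (ξ * H 0) (ξ * H 0) = herm (H 0) ξ ξ := by
        rw [herm, herm, conjTranspose_mul, (hHp 0).isHermitian.eq,
          Matrix.mul_assoc (ξ * H 0), ← Matrix.mul_assoc _ (H 0), hinv, Matrix.one_mul]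
      have h2 := norm_herm_sq_le (hGp 0) (v.1 0) (ξ * H 0)
      rw [← e1, e2, ← hh] at h2
      have h3 : ‖deltaFunctional R ξ v‖ = Real.pi * ‖herm 1 (v.1 0) ξ‖ := by
        simp [deltaFunctional, abs_of_pos Real.pi_pos]
      rw [h3, mul_pow]
      have hpi := Real.pi_pos
      calc Real.pi ^ 2 * ‖herm 1 (v.1 0) ξ‖ ^ 2
          ≤ Real.pi ^ 2 * ((herm (H 0)⁻¹ (v.1 0) (v.1 0)).re * h) := by gcongr
        _ = Real.pi * h * (Real.pi * (herm (H 0)⁻¹ (v.1 0) (v.1 0)).re) := by ring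
        _ ≤ Real.pi * h * (R ^ 2 * ‖testMap hBc v‖ ^ 2) := by gcongr
        _ = _ := by ring)
  set gM : ℂ → Matrix Unit ι ℂ := fun z => Matrix.of fun _ i => g z i with hgM
  have hgL : MemLp g 2 (volume.restrict (ball (0 : ℂ) R)) := Lp.memLp g
  have hfin : IsFiniteMeasure (volume.restrict (ball (0 : ℂ) R)) :=
    ⟨by rw [Measure.restrict_apply_univ]; exact measure_ball_lt_top⟩
  have hnorm : ∀ z, (herm (H z) (gM z * B z) (gM z * B z)).re = ‖g z‖ ^ 2 := fun z => by
    have e : herm (H z) (gM z * B z) (gM z * B z) = herm 1 (gM z) (gM z) := by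
      rw [herm, herm, conjTranspose_mul, (hB z).1.eq, Matrix.mul_one]
      have : gM z * B z * H z * (B z * (gM z)ᴴ) = gM z * (B z * H z * B z) * (gM z)ᴴ := by
        simp only [Matrix.mul_assoc]
      rw [this, hBHB, Matrix.mul_one]
    have h1 := norm_sq_row_mul (B := (1 : Matrix ι ι ℂ)) (G := 1) isHermitian_one (by simp) (gM z)
    rw [e, ← h1, EuclideanSpace.norm_sq_eq]
    simp [hgM]
  -- The solution is `s = gB`. Since `B H B = 1`, its norm in `H` is the Euclidean norm of `g`;
  -- since `B` is Hermitian, pairing `g` with `u_z B / z̄` is pairing `s` with `u_z / z̄`.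
  refine ⟨fun z => gM z * B z, fun j => ?_, ?_, ?_, fun φ hφ hφs hφb j => ?_⟩
  · simp only [Matrix.mul_apply]
    refine integrable_finsetSum _ fun i _ => ?_
    obtain ⟨M, hM⟩ := (isCompact_closedBall (0 : ℂ) R).exists_bound_of_continuousOn
      (hBc.matrix_elem i j).continuousOn
    have h1 : Integrable (fun z => gM z () i) (volume.restrict (ball (0 : ℂ) R)) := by
      have := (hgL.integrable (by norm_num))
      exact (EuclideanSpace.proj (𝕜 := ℂ) i).integrable_comp this
    refine h1.mul_bdd (c := M) (hBc.matrix_elem i j).aestronglyMeasurable ?_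
    filter_upwards [ae_restrict_mem measurableSet_ball] with z hz
    exact hM z (ball_subset_closedBall hz)
  · simp only [hnorm]
    exact (memLp_two_iff_integrable_sq_norm hgL.1).1 hgL
  · simp only [hnorm]
    have : ∫ z in ball 0 R, ‖g z‖ ^ 2 = ‖g‖ ^ 2 := by
      rw [@norm_sq_eq_re_inner ℂ, L2.inner_def, ← integral_re (L2.integrable_inner _ _)]
      refine integral_congr_ae (Filter.Eventually.of_forall fun z => ?_)
      simp only
      rw [← norm_sq_eq_re_inner]
    rw [this, ← hC2]
    gcongr
  · have h1 := hg ⟨_, single_mem_testSpace hφ hφs hφb j⟩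
    rw [L2.inner_def] at h1
    have h2 : deltaFunctional R ξ ⟨_, single_mem_testSpace hφ hφs hφb j⟩ =
        -Real.pi * φ 0 * conj (ξ () j) := by
      simp [deltaFunctional, herm, Matrix.mul_apply, Matrix.single_apply]
      ring
    rw [← h2, ← h1]
    refine integral_congr_ae ?_
    have hm := memLp_testVec hBc ⟨_, single_mem_testSpace hφ hφs hφb j⟩
    filter_upwards [hm.coeFn_toLp] with z hz
    have : (testMap hBc ⟨_, single_mem_testSpace hφ hφs hφb j⟩ : ℂ → EuclideanSpace ℂ ι) z =
      testVec B (fun z => φ z • Matrix.single () j (1 : ℂ)) z := hz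
    rw [this, PiLp.inner_apply]
    simp only [testVec, wirtM_smul_single hφ]
    simp only [Matrix.mul_apply, map_sum, Finset.mul_sum, map_mul]
    refine Finset.sum_congr rfl fun i _ => ?_
    have hBij : conj (B z i j) = B z j i := by
      have := congrFun (congrFun (hB z).1.eq j) i
      simpa [conjTranspose_apply] using this
    rw [hBij]
    simp [Matrix.smul_apply, Matrix.single_apply, hgM]
    ring

end Extension

end L2Extension

/-! ### Holomorphic extension with the sharp constant -/

namespace L2Extension

open Complex ComplexConjugate Metric Matrix
open scoped ComplexOrder

section Extension

variable {ι : Type*} [Fintype ι] [DecidableEq ι] {R : ℝ} {H A : ℂ → Matrix ι ι ℂ}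

lemma wirt_radial {θ : ℝ → ℝ} (hθ : ContDiff ℝ ∞ θ) (z : ℂ) :
    wirt (fun z => ((θ (normSq z) : ℝ) : ℂ)) z = deriv θ (normSq z) * conj z := by
  have h1 : (fun z : ℂ => normSq z) = regSq 1 0 := by ext z; simp [regSq]
  have h2 : normSq z = regSq 1 0 z := congrFun h1 z
  have hd := (hθ.differentiable (by simp)).differentiableAt (x := regSq 1 0 z) |>.hasDerivAt
  have := wirt_ofReal_comp (u := regSq 1 0) hd differentiableAt_regSq
  rw [wirt_regSq] at this
  simpa [regSq] using this

/-- The sharp extension theorem from a point for metrics of semipositive curvature on a disc. -/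
theorem exists_extension (hH : SmoothM H) (hHp : ∀ z, (H z).PosDef) (hA : SmoothM A)
    (hHA : ∀ z, wirtM H z = A z * H z) {r : ℝ} (hr : 0 < r) (hrR : r < R)
    (hcurv : ∀ z ∈ ball 0 R, ∀ a : Matrix Unit ι ℂ, (herm (H z) (a * wirtBarM A z) a).re ≤ 0)
    (ξ : Matrix Unit ι ℂ) :
    ∃ s : ℂ → Matrix Unit ι ℂ, (∀ j, Continuous fun z => s z () j) ∧
      (∀ j, DifferentiableOn ℂ (fun z => s z () j) (ball 0 r)) ∧ s 0 = ξ ∧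
      ∫ z in ball 0 r, (herm (H z) (s z) (s z)).re ≤ Real.pi * R ^ 2 * (herm (H 0) ξ ξ).re := by
  obtain ⟨s, hsi, hsh, hsb, hw⟩ :=
    exists_weak_extension hH hHp hA hHA (hr.trans hrR) hcurv ξ
  have hne : ∀ᵐ z : ℂ, z ≠ 0 := by simp [ae_iff]
  have hweyl : ∀ j, ∃ f : ℂ → ℂ, Continuous f ∧ DifferentiableOn ℂ f (ball 0 r) ∧
      ∀ᵐ z, z ∈ ball (0 : ℂ) r → s z () j = f z := fun j => by
    -- The test function is the conjugate of `zψ`: it vanishes at `0`, and its `z`-derivative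
    -- divided by `z̄` is the conjugate of `ψ_z̄`. The weak identity thus becomes `∫ s ψ_z̄ = 0`.
    refine exists_holomorphic_of_weak hrR (hsi j) fun ψ hψ hψc hψR => ?_
    have hz : ∀ z, wirt (fun z => conj z * conj (ψ z)) z = conj z * conj (wirtBar ψ z) := fun z => by
      have hd : DifferentiableAt ℝ ψ z := hψ.differentiable (by simp) z
      have h1 : DifferentiableAt ℝ (fun z : ℂ => conj z) z := conjCLE.differentiableAt
      have h2 : DifferentiableAt ℝ (fun z => conj (ψ z)) z := conjCLE.differentiableAt.comp z hd
      rw [wirt_mul h1 h2, wirt_conj hd, wirt_conj_id]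
      simp
    obtain ⟨ρ, hρ, hρs⟩ := exists_lt_subset_ball (isClosed_tsupport ψ) hψR
    have h := hw (fun z => conj z * conj (ψ z))
      ((conjCLE.contDiff (n := ∞)).mul (conjCLE.contDiff.comp hψ)) ⟨ρ, hρ, fun z hz => by
        have : z ∉ tsupport ψ := fun h => hz (ball_subset_closedBall (hρs h))
        simp [image_eq_zero_of_notMem_tsupport this]⟩ (by
        obtain ⟨C, hC⟩ := (hasCompactSupport_wirtBar hψc).exists_bound_of_continuous
          (contDiff_wirtBar hψ).continuous
        refine ⟨C, fun z => ?_⟩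
        rw [hz, norm_mul, RCLike.norm_conj, RCLike.norm_conj, mul_comm]
        gcongr; exact hC z) j
    simp only [map_zero, zero_mul, mul_zero] at h
    rw [← map_eq_zero (starRingEnd ℂ), ← integral_conj]
    refine Eq.trans (integral_congr_ae ?_) h
    filter_upwards [ae_restrict_of_ae hne] with z hz0
    have : conj z ≠ 0 := by simpa using hz0
    rw [hz, map_mul]
    field_simp
  choose f hfc hfd hfs using hweyl
  have hae : ∀ᵐ z, z ∈ ball (0 : ℂ) r → s z = Matrix.of fun _ j => f j z := by
    filter_upwards [ae_all_iff.2 hfs] with z hz hzr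
    ext i j
    exact hz j hzr
  refine ⟨fun z => Matrix.of fun _ j => f j z, hfc, hfd, ?_, ?_⟩
  -- The test function `θ(|z|²)` has `z`-derivative `θ'(|z|²) z̄`, so the weak identity evaluates
  -- the integral of `θ'(|z|²)` against the conjugate of `s` as `-π` times the conjugate of `ξ`. By
  -- the mean value property `∫ θ'(|z|²) f = -π f(0)` for the holomorphic representative `f`. Hence
  -- `f(0) = ξ`.
  · obtain ⟨θ, hθ, hθ0, hθr⟩ := exists_radial_cutoff hr
    have hθd : ∀ x, r ^ 2 / 2 < x → deriv θ x = 0 := fun x hx => by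
      have : θ =ᶠ[𝓝 x] fun _ => 0 := by
        filter_upwards [lt_mem_nhds hx] with y hy using hθr y hy.le
      rw [this.deriv_eq, deriv_const]
    have hnsq : ∀ z : ℂ, z ∉ ball (0 : ℂ) r → r ^ 2 / 2 < normSq z := fun z hz => by
      rw [mem_ball_zero_iff, not_lt] at hz
      rw [normSq_eq_norm_sq]
      nlinarith
    have hdc : Continuous (deriv θ) := hθ.continuous_deriv (by simp)
    ext i j
    have hφ : ContDiff ℝ ∞ fun z : ℂ => ((θ (normSq z) : ℝ) : ℂ) := by
      have : ContDiff ℝ ∞ fun z : ℂ => normSq z := by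
        rw [show (fun z : ℂ => normSq z) = regSq 1 0 by ext z; simp [regSq]]
        exact contDiff_regSq
      exact ofRealCLM.contDiff.comp (hθ.comp this)
    have h := hw _ hφ ⟨r, hrR, fun z hz => by
        simp [hθr _ (hnsq z fun h => hz (ball_subset_closedBall h)).le]⟩ (by
        obtain ⟨C, hC⟩ := (isCompact_Icc (a := (0 : ℝ)) (b := r ^ 2)).exists_bound_of_continuousOn
          hdc.continuousOn
        refine ⟨C, fun z => ?_⟩
        rw [wirt_radial hθ, norm_mul, RCLike.norm_conj]
        gcongr
        rw [norm_real]
        by_cases hz : z ∈ ball (0 : ℂ) r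
        · refine hC _ ⟨normSq_nonneg z, ?_⟩
          rw [mem_ball_zero_iff] at hz
          rw [normSq_eq_norm_sq]
          gcongr
        · rw [hθd _ (hnsq z hz), norm_zero]
          exact (norm_nonneg _).trans (hC 0 ⟨le_rfl, by positivity⟩)) j
    simp only [map_zero, hθ0, ofReal_one, mul_one] at h
    have hfi : ∀ g : ℂ → ℂ, Continuous g →
        IntegrableOn (fun z : ℂ => ((deriv θ (‖z‖ ^ 2) : ℝ) : ℂ) * g z) (ball 0 r) := fun g hg =>
      ((by fun_prop : Continuous fun z : ℂ => ((deriv θ (‖z‖ ^ 2) : ℝ) : ℂ) * g z).continuousOn.integrableOn_compact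
        (isCompact_closedBall 0 r)).mono_set ball_subset_closedBall
    have h1 : ∫ z in ball 0 R, wirt (fun z => ((θ (normSq z) : ℝ) : ℂ)) z / conj z * conj (s z () j) =
        conj (∫ z in ball 0 r, ((deriv θ (‖z‖ ^ 2) : ℝ) : ℂ) * f j z) := by
      rw [← integral_conj, ← integral_indicator measurableSet_ball,
        ← integral_indicator measurableSet_ball]
      refine integral_congr_ae ?_
      filter_upwards [hne, hfs j] with z hz0 hz
      have hz0' : conj z ≠ 0 := by simpa using hz0
      by_cases hzr : z ∈ ball (0 : ℂ) r
      · rw [Set.indicator_of_mem (ball_subset_ball hrR.le hzr), Set.indicator_of_mem hzr,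
          wirt_radial hθ, hz hzr, map_mul, conj_ofReal, normSq_eq_norm_sq]
        field_simp
      · rw [Set.indicator_of_notMem hzr]
        by_cases hzR : z ∈ ball (0 : ℂ) R
        · rw [Set.indicator_of_mem hzR, wirt_radial hθ, hθd _ (hnsq z hzr)]; simp
        · rw [Set.indicator_of_notMem hzR]
    have h2 : ∫ z in ball 0 r, ((deriv θ (‖z‖ ^ 2) : ℝ) : ℂ) * (f j z - f j 0) = 0 :=
      integral_radial_mul_eq_zero (k := fun t => ((deriv θ (t ^ 2) : ℝ) : ℂ))
        ((hfd j).sub_const _) (sub_self _) (hfi _ ((hfc j).sub continuous_const))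
    have h3 : ∫ z in ball (0 : ℂ) r, deriv θ (‖z‖ ^ 2) = -Real.pi := by
      rw [integral_radial (φ := fun t => deriv θ (t ^ 2)) hr.le (by fun_prop)]
      have hd : ∀ t ∈ Set.uIcc 0 r, HasDerivAt (fun t => Real.pi * θ (t ^ 2))
          (2 * Real.pi * t * deriv θ (t ^ 2)) t := fun t _ => by
        have h := ((hθ.differentiable (by simp)).differentiableAt (x := t ^ 2)).hasDerivAt
        have := (h.comp (h := fun t => t ^ 2) t (hasDerivAt_pow 2 t)).const_mul Real.pi
        refine this.congr_deriv ?_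
        push_cast; ring
      rw [intervalIntegral.integral_eq_sub_of_hasDerivAt hd
        ((by fun_prop : Continuous _).intervalIntegrable _ _)]
      rw [hθr (r ^ 2) (by nlinarith)]
      simp [hθ0]
    have h4 : ∫ z in ball 0 r, ((deriv θ (‖z‖ ^ 2) : ℝ) : ℂ) * f j z = -Real.pi * f j 0 := by
      have e : ∀ z, ((deriv θ (‖z‖ ^ 2) : ℝ) : ℂ) * f j z =
          ((deriv θ (‖z‖ ^ 2) : ℝ) : ℂ) * (f j z - f j 0) + ((deriv θ (‖z‖ ^ 2) : ℝ) : ℂ) * f j 0 :=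
        fun z => by ring
      simp_rw [e]
      rw [integral_add (hfi (fun z => f j z - f j 0) ((hfc j).sub continuous_const)) (hfi _ continuous_const), h2,
        integral_mul_const, integral_complex_ofReal, h3]
      simp
    rw [h1, h4, map_mul, map_neg, conj_ofReal] at h
    have := mul_left_cancel₀ (by simp [Real.pi_ne_zero] : (-Real.pi : ℂ) ≠ 0) h
    exact (starRingEnd ℂ).injective this
  · refine le_trans (le_of_eq ?_) ((setIntegral_mono_set hsh
      (Filter.Eventually.of_forall fun z => herm_self_nonneg (hHp z).posSemidef _)
      (ball_subset_ball hrR.le).eventuallyLE).trans hsb)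
    refine setIntegral_congr_ae measurableSet_ball ?_
    filter_upwards [hae] with z hz hzr
    rw [hz hzr]

end Extension

end L2Extension

/-! ### Second order Taylor expansion over small discs -/

namespace L2Extension

open Complex ComplexConjugate Metric Matrix Asymptotics
open scoped ComplexOrder

section Expansion

variable {f : ℂ → ℂ}

lemma wirtBar_sub {g : ℂ → ℂ} {z : ℂ} (hf : DifferentiableAt ℝ f z) (hg : DifferentiableAt ℝ g z) :
    wirtBar (fun w => f w - g w) z = wirtBar f z - wirtBar g z := by
  simp [wirtBar, fderiv_fun_sub hf hg]; ring

lemma wirt_expansion (hf : ContDiff ℝ ∞ f) :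
    (fun z => f z - f 0 - wirt f 0 * z - wirtBar f 0 * conj z) =o[𝓝 0] fun z => z := by
  have h := (hf.differentiable (by simp) 0).hasFDerivAt.isLittleO
  simp only [sub_zero, fderiv_eq_wirt] at h
  refine h.congr_left fun z => by ring

/-- Mean value inequality on the disc of radius `|z|`, where the differential has norm at most
`ε|z|`. -/
lemma norm_le_of_wirt_isLittleO (hf : ContDiff ℝ ∞ f) (h0 : f 0 = 0)
    (h : (wirt f) =o[𝓝 0] fun z => z) (h' : (wirtBar f) =o[𝓝 0] fun z => z) {ε : ℝ} (hε : 0 < ε) :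
    ∀ᶠ r in 𝓝[>] (0 : ℝ), ∀ z ∈ ball (0 : ℂ) r, ‖f z‖ ≤ ε * ‖z‖ ^ 2 := by
  have h1 := (h.def (half_pos hε)).and (h'.def (half_pos hε))
  obtain ⟨r₀, hr₀, hr⟩ := Metric.eventually_nhds_iff_ball.1 h1
  filter_upwards [Ioo_mem_nhdsGT hr₀] with r hr' z hz
  have hd : ∀ w ∈ closedBall (0 : ℂ) ‖z‖, ‖fderiv ℝ f w‖ ≤ ε * ‖z‖ := fun w hw => by
    rw [mem_closedBall_zero_iff] at hw
    rw [mem_ball_zero_iff] at hz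
    obtain ⟨ha, hb⟩ := hr w (mem_ball_zero_iff.2 (by linarith [hr'.2]))
    refine ContinuousLinearMap.opNorm_le_bound _ (by positivity) fun v => ?_
    rw [fderiv_eq_wirt]
    refine (norm_add_le _ _).trans ?_
    rw [norm_mul, norm_mul, RCLike.norm_conj, ← add_mul]
    gcongr
    nlinarith
  have := (convex_closedBall (0 : ℂ) ‖z‖).norm_image_sub_le_of_norm_fderiv_le
    (fun w _ => hf.differentiable (by simp) w) hd
    (mem_closedBall_self (norm_nonneg z)) (by simp : z ∈ closedBall (0 : ℂ) ‖z‖)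
  rw [h0, sub_zero, sub_zero] at this
  linarith [this]

lemma integrableOn_ball_of_continuous {E : Type*} [NormedAddCommGroup E] {g : ℂ → E}
    (hg : Continuous g) (r : ℝ) : IntegrableOn g (ball 0 r) :=
  (hg.continuousOn.integrableOn_compact (isCompact_closedBall 0 r)).mono_set
    ball_subset_closedBall

lemma integral_ball_eq_zero {g : ℂ → ℂ} {r : ℝ} (hg : DifferentiableOn ℂ g (ball 0 r))
    (hg0 : g 0 = 0) (hi : IntegrableOn g (ball 0 r)) : ∫ z in ball 0 r, g z = 0 := by
  simpa using integral_radial_mul_eq_zero (k := fun _ => 1) hg hg0 (by simpa using hi)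

lemma integral_ball_const (c : ℂ) {r : ℝ} (hr : 0 ≤ r) :
    ∫ _ in ball (0 : ℂ) r, c = Real.pi * r ^ 2 * c := by
  rw [setIntegral_const, measureReal_def, Complex.volume_ball]
  simp [ENNReal.toReal_ofReal hr, mul_comm]

/-- The expansion of the mean value of a smooth function over small discs. -/
lemma integral_ball_expansion (hf : ContDiff ℝ ∞ f) {ε : ℝ} (hε : 0 < ε) :
    ∀ᶠ r in 𝓝[>] (0 : ℝ), ‖(∫ z in ball 0 r, f z) -
      (Real.pi * r ^ 2 * f 0 + Real.pi / 2 * r ^ 4 * wirtBar (wirt f) 0)‖ ≤ ε * r ^ 4 := by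
  set a := wirt f 0
  set b := wirtBar f 0
  set c := wirtBar (wirt f) 0 with hc
  set d := wirt (wirt f) 0 with hd
  set e := wirtBar (wirtBar f) 0 with he
  have hc' : c = wirt (wirtBar f) 0 := wirtBar_wirt hf 0
  -- The second order Taylor polynomial, grouped so that the holomorphic and antiholomorphic parts
  -- integrate to zero; only the constant and the `z z̄` term survive.
  set q : ℂ → ℂ := fun z => f 0 + (a * z + d / 2 * (z * z)) +
    (b * conj z + e / 2 * (conj z * conj z)) + c * (z * conj z) with hq
  have hcd : ContDiff ℝ ∞ fun z : ℂ => conj z := conjCLE.contDiff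
  have hqs : ContDiff ℝ ∞ q := by
    have : ContDiff ℝ ∞ fun z : ℂ => z := contDiff_id
    fun_prop
  have hid (z : ℂ) : DifferentiableAt ℝ (fun z : ℂ => z) z := differentiableAt_id
  have hcj (z : ℂ) : DifferentiableAt ℝ (fun z : ℂ => conj z) z := conjCLE.differentiableAt
  have hk (z k : ℂ) : DifferentiableAt ℝ (fun _ : ℂ => k) z := differentiableAt_const k
  have hw : ∀ z, wirt (fun z => f z - q z) z = wirt f z - a - d * z - c * conj z := fun z => by
    rw [wirt_sub (hf.differentiable (by simp) z) (hqs.differentiable (by simp) z)]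
    have : wirt q z = a + d * z + c * conj z := by
      simp only [hq]
      rw [wirt_add (by fun_prop) (by fun_prop), wirt_add (by fun_prop) (by fun_prop),
        wirt_add (by fun_prop) (by fun_prop), wirt_add (by fun_prop) (by fun_prop),
        wirt_add (by fun_prop) (by fun_prop)]
      rw [wirt_mul (by fun_prop) (by fun_prop), wirt_mul (by fun_prop) (by fun_prop),
        wirt_mul (by fun_prop) (by fun_prop), wirt_mul (by fun_prop) (by fun_prop),
        wirt_mul (by fun_prop) (by fun_prop), wirt_mul (by fun_prop) (by fun_prop),
        wirt_mul (by fun_prop) (by fun_prop), wirt_mul (by fun_prop) (by fun_prop)]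
      simp only [wirt_const, wirt_id, wirt_conj_id]
      ring
    rw [this]; ring
  have hwb : ∀ z, wirtBar (fun z => f z - q z) z = wirtBar f z - b - c * z - e * conj z :=
    fun z => by
    rw [wirtBar_sub (hf.differentiable (by simp) z) (hqs.differentiable (by simp) z)]
    have : wirtBar q z = b + c * z + e * conj z := by
      simp only [hq]
      rw [wirtBar_add (by fun_prop) (by fun_prop), wirtBar_add (by fun_prop) (by fun_prop),
        wirtBar_add (by fun_prop) (by fun_prop), wirtBar_add (by fun_prop) (by fun_prop),
        wirtBar_add (by fun_prop) (by fun_prop)]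
      rw [wirtBar_mul (by fun_prop) (by fun_prop), wirtBar_mul (by fun_prop) (by fun_prop),
        wirtBar_mul (by fun_prop) (by fun_prop), wirtBar_mul (by fun_prop) (by fun_prop),
        wirtBar_mul (by fun_prop) (by fun_prop), wirtBar_mul (by fun_prop) (by fun_prop),
        wirtBar_mul (by fun_prop) (by fun_prop), wirtBar_mul (by fun_prop) (by fun_prop)]
      simp only [wirtBar_const, wirtBar_id, wirtBar_conj_id]
      ring
    rw [this]; ring
  have h1 : wirt (fun z => f z - q z) =o[𝓝 0] fun z => z :=
    (wirt_expansion (contDiff_wirt hf)).congr_left fun z => (hw z).symm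
  have h2 : wirtBar (fun z => f z - q z) =o[𝓝 0] fun z => z :=
    (wirt_expansion (contDiff_wirtBar hf)).congr_left fun z => by rw [hwb, ← hc']
  -- The factor `1/π` compensates the area `πr²` of the disc.
  have h3 := norm_le_of_wirt_isLittleO (hf.sub hqs) (by simp [hq]) h1 h2
    (ε := ε / Real.pi) (by have := Real.pi_pos; positivity)
  filter_upwards [h3, self_mem_nhdsWithin] with r hr (hr0 : 0 < r)
  have hqi : ∫ z in ball 0 r, q z = Real.pi * r ^ 2 * f 0 + Real.pi / 2 * r ^ 4 * c := by
    have i1 := integrableOn_ball_of_continuous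
      (by fun_prop : Continuous fun z : ℂ => a * z + d / 2 * (z * z)) r
    have i2 := integrableOn_ball_of_continuous
      (by fun_prop : Continuous fun z : ℂ => b * conj z + e / 2 * (conj z * conj z)) r
    have i3 := integrableOn_ball_of_continuous (by fun_prop : Continuous fun z : ℂ => c * (z * conj z)) r
    have i5 := integrableOn_ball_of_continuous (by fun_prop : Continuous fun z : ℂ =>
      f 0 + (a * z + d / 2 * (z * z))) r
    have i6 := integrableOn_ball_of_continuous (by fun_prop : Continuous fun z : ℂ =>
      f 0 + (a * z + d / 2 * (z * z)) + (b * conj z + e / 2 * (conj z * conj z))) r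
    have i4 := integrableOn_ball_of_continuous (continuous_const : Continuous fun _ : ℂ => f 0) r
    have j1 : ∫ z in ball (0 : ℂ) r, (a * z + d / 2 * (z * z)) = 0 :=
      integral_ball_eq_zero (by fun_prop) (by simp) i1
    have j2 : ∫ z in ball (0 : ℂ) r, (b * conj z + e / 2 * (conj z * conj z)) = 0 := by
      rw [← map_eq_zero (starRingEnd ℂ), ← integral_conj]
      simp only [map_add, map_mul, conj_conj]
      exact integral_ball_eq_zero (by fun_prop) (by simp)
        (integrableOn_ball_of_continuous (by fun_prop) r)
    have j3 : ∫ z in ball (0 : ℂ) r, c * (z * conj z) = Real.pi / 2 * r ^ 4 * c := by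
      rw [integral_const_mul]
      have : ∀ z : ℂ, z * conj z = ((‖z‖ ^ 2 : ℝ) : ℂ) := fun z => by
        rw [mul_conj, normSq_eq_norm_sq]
      simp_rw [this]
      rw [integral_complex_ofReal, integral_norm_sq_ball hr0.le]
      push_cast; ring
    simp only [hq]
    rw [integral_add i6 i3, integral_add i5 i2, integral_add i4 i1,
      j1, j2, j3, integral_ball_const _ hr0.le]
    ring
  rw [← hqi, ← integral_sub (integrableOn_ball_of_continuous hf.continuous r)
    (integrableOn_ball_of_continuous hqs.continuous r)]
  have h4 : ∀ z ∈ ball (0 : ℂ) r, ‖f z - q z‖ ≤ ε / Real.pi * r ^ 2 := fun z hz => by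
    refine (hr z hz).trans ?_
    have := Real.pi_pos
    rw [mem_ball_zero_iff] at hz
    gcongr
  refine (norm_setIntegral_le_of_norm_le_const measure_ball_lt_top h4).trans (le_of_eq ?_)
  rw [measureReal_def, Complex.volume_ball]
  simp [ENNReal.toReal_ofReal hr0.le]
  field_simp

end Expansion

end L2Extension

/-! ### The extension index in coordinates and its expansion -/

namespace L2Extension

open Complex ComplexConjugate Metric Matrix Asymptotics
open scoped ComplexOrder

section Index

variable {ι : Type*} [Fintype ι]

/-- Square integrable holomorphic vectors on the disc of radius `r` with value `ξ` at the centre. -/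
structure IsExtension (H : ℂ → Matrix ι ι ℂ) (r : ℝ) (ξ : Matrix Unit ι ℂ)
    (s : ℂ → Matrix Unit ι ℂ) : Prop where
  holo : ∀ j, DifferentiableOn ℂ (fun z => s z () j) (ball 0 r)
  integrable : IntegrableOn (fun z => (herm (H z) (s z) (s z)).re) (ball 0 r)
  eq : s 0 = ξ

/-- The `L²`-extension index at `0` of the metric with matrix `H`. -/
noncomputable def coordIndex (H : ℂ → Matrix ι ι ℂ) (r : ℝ) (ξ : Matrix Unit ι ℂ) : ℝ :=
  sInf {t : ℝ | ∃ s, IsExtension H r ξ s ∧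
    t = (∫ z in ball 0 r, (herm (H z) (s z) (s z)).re) / (Real.pi * r ^ 2 * (herm (H 0) ξ ξ).re)}

variable {H A : ℂ → Matrix ι ι ℂ} {ξ : Matrix Unit ι ℂ} {r : ℝ}

lemma IsExtension.of_smooth (hH : SmoothM H) {s : ℂ → Matrix Unit ι ℂ}
    (hs : ∀ j, Continuous fun z => s z () j)
    (hd : ∀ j, DifferentiableOn ℂ (fun z => s z () j) (ball 0 r)) (h0 : s 0 = ξ) :
    IsExtension H r ξ s := by
  refine ⟨hd, integrableOn_ball_of_continuous ?_ r, h0⟩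
  have : Continuous s := by
    refine continuous_matrix fun i j => hs j
  have h2 := hH.continuous
  exact continuous_re.comp (((this.matrix_mul h2).matrix_mul this.matrix_conjTranspose).matrix_elem () ())

lemma coordIndex_le (hHp : ∀ z, (H z).PosDef) {s : ℂ → Matrix Unit ι ℂ}
    (hs : IsExtension H r ξ s) : coordIndex H r ξ ≤
      (∫ z in ball 0 r, (herm (H z) (s z) (s z)).re) / (Real.pi * r ^ 2 * (herm (H 0) ξ ξ).re) := by
  refine csInf_le ⟨0, ?_⟩ ⟨s, hs, rfl⟩
  rintro t ⟨s, -, rfl⟩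
  have := Real.pi_pos
  exact div_nonneg (integral_nonneg fun z => herm_self_nonneg (hHp z).posSemidef _)
    (mul_nonneg (by positivity) (herm_self_nonneg (hHp 0).posSemidef ξ))

/-- The affine section with value `ξ` at `0` and vanishing covariant derivative there. -/
noncomputable def affineSection (A : ℂ → Matrix ι ι ℂ) (ξ : Matrix Unit ι ℂ) (z : ℂ) :
    Matrix Unit ι ℂ := ξ + z • (-(ξ * A 0))

lemma smoothM_affineSection : SmoothM (affineSection A ξ) :=
  (SmoothM.const ξ).add (SmoothM.smul contDiff_id (SmoothM.const _))

lemma differentiable_affineSection (j : ι) :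
    Differentiable ℂ fun z => affineSection A ξ z () j := by
  simp only [affineSection, Matrix.add_apply, Matrix.smul_apply, smul_eq_mul]
  fun_prop

lemma affineSection_zero : affineSection A ξ 0 = ξ := by simp [affineSection]

lemma herm_eq_sum_mul (M : Matrix ι ι ℂ) (a b : Matrix Unit ι ℂ) :
    herm M a b = ∑ i, a () i * (M * bᴴ) i () := by
  rw [herm, Matrix.mul_assoc, Matrix.mul_apply]

lemma wirtM_affineSection (z : ℂ) : wirtM (affineSection A ξ) z = -(ξ * A 0) := by
  have h1 : wirtM (fun _ : ℂ => ξ) z = 0 := by ext i j; exact wirt_const _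
  have h2 : wirtM (fun _ : ℂ => -(ξ * A 0)) z = 0 := by ext i j; exact wirt_const _
  have := wirtM_add (z := z) (SmoothM.const ξ)
    (SmoothM.smul contDiff_id (SmoothM.const (-(ξ * A 0))))
  rw [wirtM_smul contDiff_id (SmoothM.const _), h1, h2, smul_zero, add_zero,
    zero_add, show wirt id z = 1 from wirt_id, one_smul] at this
  exact this

lemma wirtBarM_affineSection (z : ℂ) : wirtBarM (affineSection A ξ) z = 0 := by
  ext i j
  exact wirtBar_eq_zero (differentiable_affineSection j z)

/-- The expansion of the squared norm of the affine section. -/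
lemma wirtBar_wirt_herm_affineSection (hH : SmoothM H) (hHh : ∀ z, (H z).IsHermitian)
    (hA : SmoothM A) (hHA : ∀ z, wirtM H z = A z * H z) :
    wirtBar (wirt fun z => herm (H z) (affineSection A ξ z) (affineSection A ξ z)) 0 =
      herm (H 0) (ξ * wirtBarM A 0) ξ := by
  have hσ := smoothM_affineSection (A := A) (ξ := ξ)
  have h1 : (wirt fun z => herm (H z) (affineSection A ξ z) (affineSection A ξ z)) =
      fun z => herm (H z) (-(ξ * A 0) + affineSection A ξ z * A z) (affineSection A ξ z) := by
    ext z
    rw [wirt_herm hH hσ hσ (hHA z), wirtM_affineSection, wirtBarM_affineSection, herm_zero_right,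
      add_zero]
  have hτ : SmoothM fun z => -(ξ * A 0) + affineSection A ξ z * A z :=
    (SmoothM.const _).add (hσ.mul hA)
  rw [h1, wirtBar_herm hH hHh hτ hσ (hHA 0), affineSection_zero]
  have h2 : wirtBarM (fun _ : ℂ => -(ξ * A 0)) 0 = 0 := by ext i j; exact wirtBar_const _
  rw [wirtBarM_add (SmoothM.const _) (hσ.mul hA), wirtBarM_mul hσ hA, wirtBarM_affineSection,
    affineSection_zero, h2]
  simp

variable [DecidableEq ι]

/-- `exists_extension` loses a little radius and yields the bound `ρ²/r²` for every `ρ` in `(r, R)`;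
then `ρ → r`. -/
theorem coordIndex_le_one (hH : SmoothM H) (hHp : ∀ z, (H z).PosDef) (hA : SmoothM A)
    (hHA : ∀ z, wirtM H z = A z * H z) {R : ℝ} (hr : 0 < r) (hrR : r < R)
    (hcurv : ∀ z ∈ ball 0 R, ∀ a : Matrix Unit ι ℂ, (herm (H z) (a * wirtBarM A z) a).re ≤ 0)
    (hξ : ξ ≠ 0) : coordIndex H r ξ ≤ 1 := by
  have hN := herm_self_pos (hHp 0) hξ
  have hpi := Real.pi_pos
  have key : ∀ᶠ ρ in 𝓝[>] r, coordIndex H r ξ * r ^ 2 ≤ ρ ^ 2 := by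
    filter_upwards [Ioo_mem_nhdsGT hrR] with ρ hρ
    obtain ⟨s, hsc, hsd, hs0, hsb⟩ := exists_extension hH hHp hA hHA hr hρ.1
      (fun z hz => hcurv z (ball_subset_ball hρ.2.le hz)) ξ
    have := coordIndex_le hHp (IsExtension.of_smooth hH hsc hsd hs0)
    rw [le_div_iff₀ (by positivity)] at this
    have h2 := this.trans hsb
    have h3 : 0 < Real.pi * (herm (H 0) ξ ξ).re := by positivity
    nlinarith
  have hlim : Filter.Tendsto (fun ρ : ℝ => ρ ^ 2) (𝓝[>] r) (𝓝 (r ^ 2)) :=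
    ((continuous_pow 2).tendsto r).mono_left nhdsWithin_le_nhds
  have h := ge_of_tendsto hlim key
  nlinarith [sq_pos_of_pos hr]

/-- The entry `u_j` is the pairing of `u` with `e_j M⁻¹`, whose squared norm is the diagonal entry
of `M⁻¹`; Cauchy-Schwarz concludes. -/
lemma norm_entry_sq_le {M : Matrix ι ι ℂ} (hM : M.PosDef) (u : Matrix Unit ι ℂ) (j : ι) :
    ‖u () j‖ ^ 2 ≤ (M⁻¹ j j).re * (herm M u u).re := by
  have h := norm_herm_sq_le hM.posSemidef u (Matrix.single () j (1 : ℂ) * M⁻¹)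
  have h1 : M * M⁻¹ = 1 := Matrix.mul_nonsing_inv M ((isUnit_iff_isUnit_det M).1 hM.isUnit)
  have h2 : herm M u (Matrix.single () j (1 : ℂ) * M⁻¹) = u () j := by
    rw [herm, conjTranspose_mul, hM.inv.isHermitian.eq, Matrix.mul_assoc, ← Matrix.mul_assoc M,
      h1, Matrix.one_mul]
    simp [Matrix.mul_apply, Matrix.single_apply]
  have h3 : herm M (Matrix.single () j (1 : ℂ) * M⁻¹) (Matrix.single () j (1 : ℂ) * M⁻¹) = M⁻¹ j j := by
    rw [herm_mul_inv hM]
    simp [herm, Matrix.mul_apply, Matrix.single_apply]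
  rw [h2, h3] at h
  linarith

/-- The affine section is almost optimal. -/
lemma integral_affineSection_le (hH : SmoothM H) (hHp : ∀ z, (H z).PosDef)
    (hHA : ∀ z, wirtM H z = A z * H z) {ε : ℝ} (hε : 0 < ε) :
    ∀ᶠ r in 𝓝[>] (0 : ℝ), ∀ s, IsExtension H r ξ s →
      (∫ z in ball 0 r, (herm (H z) (affineSection A ξ z) (affineSection A ξ z)).re) - ε * r ^ 4 ≤
        ∫ z in ball 0 r, (herm (H z) (s z) (s z)).re := by
  set σ := affineSection A ξ with hσd
  have hσ : SmoothM σ := smoothM_affineSection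
  set w : ι → ℂ → ℂ := fun i z => (H z * (σ z)ᴴ) i () with hw
  have hws : ∀ i, ContDiff ℝ ∞ (w i) := fun i => hH.mul hσ.conjTranspose i ()
  -- For `w = Hσ*` one has `∂w/∂z̄ = H (Dσ)*`, and `Dσ` vanishes at the origin by the choice of `σ`.
  have hwb : ∀ i, wirtBar (w i) 0 = 0 := fun i => by
    have h := wirtBarM_mul (z := 0) hH hσ.conjTranspose
    rw [wirtBarM_conjTranspose hσ, wirtBarM_of_hermitian hH (fun z => (hHp z).isHermitian) (hHA 0),
      wirtM_affineSection, hσd, affineSection_zero] at h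
    have h2 := congrFun (congrFun h i) ()
    refine h2.trans ?_
    simp [Matrix.mul_assoc, conjTranspose_mul]
  obtain ⟨K, hK1, hK⟩ : ∃ K : ℝ, 1 ≤ K ∧ ∀ z ∈ closedBall (0 : ℂ) 1, ∀ j, ((H z)⁻¹ j j).re ≤ K := by
    have hc := (hH.inv_of_posDef hHp).continuous
    have : ∀ j, ∃ K : ℝ, ∀ z ∈ closedBall (0 : ℂ) 1, ‖(H z)⁻¹ j j‖ ≤ K := fun j =>
      (isCompact_closedBall (0 : ℂ) 1).exists_bound_of_continuousOn
        (hc.matrix_elem j j).continuousOn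
    choose K hK using this
    refine ⟨1 + ∑ j, |K j|, by linarith [Finset.sum_nonneg fun j (_ : j ∈ Finset.univ) => abs_nonneg (K j)],
      fun z hz j => ?_⟩
    have := Finset.single_le_sum (fun j _ => abs_nonneg (K j)) (Finset.mem_univ j)
    linarith [hK j z hz, le_abs_self (K j), re_le_norm ((H z)⁻¹ j j)]
  -- The error is shared among the entries, and adding one keeps `m` positive in rank zero. The
  -- constant `δ` solves `δ² m² K = ε/π`, which is what the arithmetic-geometric inequality requires
  -- for each entry.
  set m : ℝ := (Fintype.card ι : ℝ) + 1 with hm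
  have hm0 : 0 < m := by positivity
  set δ : ℝ := Real.sqrt (ε / (Real.pi * (m ^ 2 * K))) with hδ
  have hpi := Real.pi_pos
  have hδ0 : 0 < δ := Real.sqrt_pos.2 (by positivity)
  have hδ2 : δ ^ 2 = ε / (Real.pi * (m ^ 2 * K)) := Real.sq_sqrt (by positivity)
  have hexp := Filter.eventually_all.2 fun i => (wirt_expansion (hws i)).def hδ0
  obtain ⟨r₀, hr₀, hr⟩ := Metric.eventually_nhds_iff_ball.1 hexp
  filter_upwards [Ioo_mem_nhdsGT (lt_min hr₀ one_pos)] with r hr' s hs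
  obtain ⟨hr0, hrlt⟩ := hr'
  have hr1 : r < r₀ := hrlt.trans_le (min_le_left _ _)
  have hr2 : r < 1 := hrlt.trans_le (min_le_right _ _)
  have hK' : ∀ z ∈ ball (0 : ℂ) r, ∀ (u : Matrix Unit ι ℂ) j,
      ‖u () j‖ ^ 2 ≤ K * (herm (H z) u u).re := fun z hz u j =>
    (norm_entry_sq_le (hHp z) u j).trans (mul_le_mul_of_nonneg_right
      (hK z (ball_subset_closedBall (ball_subset_ball hr2.le hz)) j)
      (herm_self_nonneg (hHp z).posSemidef u))
  set u : ℂ → Matrix Unit ι ℂ := fun z => s z - σ z with hu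
  have hsint : ∀ j, IntegrableOn (fun z => s z () j) (ball 0 r) := fun j => by
    refine Integrable.mono' ((integrableOn_ball_of_continuous continuous_const r
      (g := fun _ => (1 : ℝ))).add (hs.integrable.const_mul K))
      ((hs.holo j).continuousOn.aestronglyMeasurable measurableSet_ball) ?_
    filter_upwards [ae_restrict_mem measurableSet_ball] with z hz
    have := hK' z hz (s z) j
    simp only [Pi.add_apply]
    nlinarith [sq_nonneg (‖s z () j‖ - 1), norm_nonneg (s z () j)]
  have hσd' : ∀ j, Differentiable ℂ fun z => σ z () j := differentiable_affineSection
  have huint : ∀ j, IntegrableOn (fun z => u z () j) (ball 0 r) := fun j =>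
    (hsint j).sub (integrableOn_ball_of_continuous (hσd' j).continuous r)
  have hud : ∀ j, DifferentiableOn ℂ (fun z => u z () j) (ball 0 r) := fun j =>
    (hs.holo j).sub (hσd' j).differentiableOn
  have hu0 : u 0 = 0 := by simp [hu, hs.eq, hσd, affineSection_zero]
  -- Since `w` has no `z̄` term to first order, its linearisation is holomorphic. So `g` is
  -- holomorphic and vanishes at the centre with `u`; its integral is zero.
  set g : ℂ → ℂ := fun z => ∑ i, u z () i * (w i 0 + wirt (w i) 0 * z) with hg
  have hgi : IntegrableOn g (ball 0 r) := by
    refine integrable_finsetSum _ fun i _ => ?_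
    refine (huint i).mul_bdd (c := ‖w i 0‖ + ‖wirt (w i) 0‖)
      (by fun_prop : Continuous _).aestronglyMeasurable ?_
    filter_upwards [ae_restrict_mem measurableSet_ball] with z hz
    refine (norm_add_le _ _).trans ?_
    rw [mem_ball_zero_iff] at hz
    rw [norm_mul]
    nlinarith [norm_nonneg (wirt (w i) 0)]
  have hg0 : ∫ z in ball 0 r, g z = 0 := by
    refine integral_ball_eq_zero ?_ (by simp [hg, hu0]) hgi
    simp only [hg]
    refine DifferentiableOn.fun_sum fun i _ => (hud i).mul (by fun_prop)
  have hfi : IntegrableOn (fun z => (herm (H z) (σ z) (σ z)).re) (ball 0 r) :=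
    integrableOn_ball_of_continuous (continuous_re.comp (contDiff_herm hH hσ hσ).continuous) r
  have hqi : IntegrableOn (fun z : ℂ => ε / Real.pi * r ^ 2) (ball 0 r) :=
    integrableOn_ball_of_continuous continuous_const r
  have hpt : ∀ z ∈ ball (0 : ℂ) r, (herm (H z) (σ z) (σ z)).re + 2 * (g z).re - ε / Real.pi * r ^ 2 ≤
      (herm (H z) (s z) (s z)).re := fun z hz => by
    have e1 : s z = u z + σ z := by simp [hu]
    have e2 : (herm (H z) (s z) (s z)).re = (herm (H z) (u z) (u z)).re +
        2 * (herm (H z) (u z) (σ z)).re + (herm (H z) (σ z) (σ z)).re := by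
      rw [e1, herm_add_left, herm_add_right, herm_add_right,
        ← conj_herm (hHp z).isHermitian (u z) (σ z)]
      simp; ring
    have e3 : herm (H z) (u z) (σ z) = g z +
        ∑ i, u z () i * (w i z - w i 0 - wirt (w i) 0 * z - wirtBar (w i) 0 * conj z) := by
      rw [herm_eq_sum_mul, hg, ← Finset.sum_add_distrib]
      refine Finset.sum_congr rfl fun i _ => ?_
      rw [hwb]; simp only [hw]; ring
    have hz' : ‖z‖ < r := mem_ball_zero_iff.1 hz
    -- The cross term occurs twice in `|u + σ|²`, so half of `|u|²` here is exactly what the term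
    -- `|u|²` pays for.
    have e4 : ‖∑ i, u z () i * (w i z - w i 0 - wirt (w i) 0 * z - wirtBar (w i) 0 * conj z)‖ ≤
        (herm (H z) (u z) (u z)).re / 2 + ε / Real.pi * r ^ 2 / 2 := by
      have b : ∀ i, ‖u z () i * (w i z - w i 0 - wirt (w i) 0 * z - wirtBar (w i) 0 * conj z)‖ ≤
          ((herm (H z) (u z) (u z)).re / 2 + ε / Real.pi * r ^ 2 / 2) / m := fun i => by
        have h1 := hr z (mem_ball_zero_iff.2 (hz'.trans hr1)) i
        have h2 := hK' z hz (u z) i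
        rw [norm_mul]
        set x := ‖u z () i‖
        have hx : 0 ≤ x := norm_nonneg _
        have h3 : x * ‖w i z - w i 0 - wirt (w i) 0 * z - wirtBar (w i) 0 * conj z‖ ≤
          x * (δ * r) := by gcongr; exact h1.trans (by gcongr)
        refine h3.trans ?_
        rw [le_div_iff₀ hm0]
        have h4 : ε / Real.pi = δ ^ 2 * (m ^ 2 * K) := by rw [hδ2]; field_simp
        rw [h4]
        have hKp : 0 < K := by linarith
        have h5 : x ^ 2 / K ≤ (herm (H z) (u z) (u z)).re := by rw [div_le_iff₀ hKp]; linarith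
        have h6 : x * (δ * r) * m ≤ x ^ 2 / K / 2 + δ ^ 2 * (m ^ 2 * K) * r ^ 2 / 2 := by
          have : 0 ≤ (x - K * m * δ * r) ^ 2 / K / 2 := by positivity
          have e : (x - K * m * δ * r) ^ 2 / K / 2 = x ^ 2 / K / 2 + δ ^ 2 * (m ^ 2 * K) * r ^ 2 / 2 -
            x * (δ * r) * m := by field_simp; ring
          linarith
        linarith
      refine (norm_sum_le_of_le _ fun i _ => b i).trans ?_
      rw [Finset.sum_const, Finset.card_univ, nsmul_eq_mul, ← mul_div_assoc, div_le_iff₀ hm0]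
      have : 0 ≤ (herm (H z) (u z) (u z)).re / 2 + ε / Real.pi * r ^ 2 / 2 := by
        have := herm_self_nonneg (hHp z).posSemidef (u z)
        positivity
      rw [hm]; nlinarith
    rw [e2, e3, add_re]
    have e5 := (abs_le.1 (abs_re_le_norm (∑ i, u z () i *
      (w i z - w i 0 - wirt (w i) 0 * z - wirtBar (w i) 0 * conj z)))).1
    linarith
  have hg0' : ∫ z in ball 0 r, (g z).re = 0 := by
    have := integral_re hgi
    rw [hg0] at this
    simpa using this
  have hgr : IntegrableOn (fun z => 2 * (g z).re) (ball 0 r) := hgi.re.const_mul 2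
  have hfg : IntegrableOn (fun z => (herm (H z) (σ z) (σ z)).re + 2 * (g z).re) (ball 0 r) :=
    hfi.add hgr
  have hfin := setIntegral_mono_on (hfg.sub hqi) hs.integrable measurableSet_ball hpt
  have hcalc : ∫ z in ball 0 r, ((herm (H z) (σ z) (σ z)).re + 2 * (g z).re - ε / Real.pi * r ^ 2) =
      (∫ z in ball 0 r, (herm (H z) (σ z) (σ z)).re) - ε * r ^ 4 := by
    rw [integral_sub hfg hqi, integral_add hfi hgr, integral_const_mul, hg0',
      setIntegral_const, measureReal_def, Complex.volume_ball]
    simp [ENNReal.toReal_ofReal hr0.le]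
    field_simp
  exact hcalc.symm.le.trans hfin

/-- The second order expansion of the extension index. -/
theorem tendsto_coordIndex (hH : SmoothM H) (hHp : ∀ z, (H z).PosDef) (hA : SmoothM A)
    (hHA : ∀ z, wirtM H z = A z * H z) (hξ : ξ ≠ 0) :
    Filter.Tendsto (fun r => (coordIndex H r ξ - 1) / r ^ 2) (𝓝[>] 0)
      (𝓝 ((herm (H 0) (ξ * wirtBarM A 0) ξ).re / (2 * (herm (H 0) ξ ξ).re))) := by
  set N := (herm (H 0) ξ ξ).re with hN
  have hN0 : 0 < N := herm_self_pos (hHp 0) hξ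
  have hpi := Real.pi_pos
  set σ := affineSection A ξ with hσd
  have hσ : SmoothM σ := smoothM_affineSection
  rw [Metric.tendsto_nhds]
  intro ε hε
  -- Two errors `ε' r⁴`, from near-optimality and from the Taylor expansion, are divided by `π r⁴ N`
  -- and total `ε/2`.
  set ε' := ε * Real.pi * N / 4 with hε'
  have hε'0 : 0 < ε' := by positivity
  filter_upwards [integral_affineSection_le (ξ := ξ) hH hHp hHA hε'0,
    integral_ball_expansion (contDiff_herm hH hσ hσ) hε'0, self_mem_nhdsWithin] with r h1 h2 hr
  have hr0 : 0 < r := hr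
  rw [wirtBar_wirt_herm_affineSection hH (fun z => (hHp z).isHermitian) hA hHA] at h2
  have hint : IntegrableOn (fun z => herm (H z) (σ z) (σ z)) (ball 0 r) :=
    integrableOn_ball_of_continuous (contDiff_herm hH hσ hσ).continuous r
  have hext : IsExtension H r ξ σ := IsExtension.of_smooth hH
    (fun j => (differentiable_affineSection j).continuous)
    (fun j => (differentiable_affineSection j).differentiableOn) affineSection_zero
  have hup := coordIndex_le hHp hext
  set J := ∫ z in ball 0 r, (herm (H z) (σ z) (σ z)).re with hJ
  have hlo : (J - ε' * r ^ 4) / (Real.pi * r ^ 2 * N) ≤ coordIndex H r ξ := by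
    refine le_csInf ⟨_, σ, hext, rfl⟩ ?_
    rintro t ⟨s, hs, rfl⟩
    have := h1 s hs
    gcongr
  have hre : (∫ z in ball 0 r, herm (H z) (σ z) (σ z)).re = J := by
    have := integral_re hint
    simpa using this.symm
  have h3 := (abs_re_le_norm _).trans h2
  have hz : herm (H 0) (σ 0) (σ 0) = herm (H 0) ξ ξ := by rw [hσd, affineSection_zero]
  rw [hz, sub_re, hre] at h3
  set c := (herm (H 0) (ξ * wirtBarM A 0) ξ).re with hc
  have h4 : ((Real.pi : ℂ) * (r : ℂ) ^ 2 * herm (H 0) ξ ξ +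
      (Real.pi : ℂ) / 2 * (r : ℂ) ^ 4 * herm (H 0) (ξ * wirtBarM A 0) ξ).re =
      Real.pi * r ^ 2 * N + Real.pi / 2 * r ^ 4 * c := by
    have a1 : (Real.pi : ℂ) * (r : ℂ) ^ 2 = ((Real.pi * r ^ 2 : ℝ) : ℂ) := by push_cast; ring
    have a2 : (Real.pi : ℂ) / 2 * (r : ℂ) ^ 4 = ((Real.pi / 2 * r ^ 4 : ℝ) : ℂ) := by
      push_cast; ring
    rw [add_re, a1, a2, re_ofReal_mul, re_ofReal_mul]
  rw [h4, abs_le] at h3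
  rw [le_div_iff₀ (by positivity)] at hup
  rw [div_le_iff₀ (by positivity)] at hlo
  set x := coordIndex H r ξ
  have hr4 : 0 < r ^ 4 := by positivity
  have e : (x - 1) / r ^ 2 - c / (2 * N) =
      (x * (Real.pi * r ^ 2 * N) - (Real.pi * r ^ 2 * N + Real.pi / 2 * r ^ 4 * c)) /
        (Real.pi * r ^ 4 * N) := by
    field_simp
    ring
  rw [Real.dist_eq, e, abs_div, abs_of_pos (by positivity : 0 < Real.pi * r ^ 4 * N),
    div_lt_iff₀ (by positivity)]
  have h5 : 2 * ε' * r ^ 4 < ε * (Real.pi * r ^ 4 * N) := by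
    rw [hε']; nlinarith [show 0 < ε * (Real.pi * r ^ 4 * N) by positivity]
  rw [abs_lt]
  constructor <;> nlinarith

end Index

end L2Extension

/-! ### Passage from the open set to the plane -/

namespace L2Extension

open Complex ComplexConjugate Metric Matrix
open scoped ComplexOrder

section Opens

variable {Ω : Opens ℂ} {V : Type*} [NormedAddCommGroup V]

/-- The chart of an open subset is the inclusion, so manifold derivatives on `Ω` reduce to ordinary
derivatives on the plane. -/
lemma writtenInExtChartAt_opens {𝕜 : Type*} [NontriviallyNormedField 𝕜] [NormedSpace 𝕜 ℂ]
    [NormedSpace 𝕜 V] {f : Ω → V} {F : ℂ → V} {y : Ω} (h : f =ᶠ[𝓝 y] fun y => F y.1) :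
    writtenInExtChartAt 𝓘(𝕜, ℂ) 𝓘(𝕜, V) y f =ᶠ[𝓝 (y : ℂ)] F := by
  have h1 := Opens.chartAt_subtype_val_symm_eventuallyEq (H := ℂ) Ω (x := y)
  have h2 : Filter.Tendsto (chartAt ℂ y).symm (𝓝 (y : ℂ)) (𝓝 y) := by
    have := (chartAt ℂ y).continuousAt_symm (mem_chart_target ℂ y)
    rw [ContinuousAt, (chartAt ℂ y).left_inv (mem_chart_source ℂ y)] at this
    exact this
  filter_upwards [h1, h2.eventually h] with z hz hz2
  have hz' : z = ((chartAt ℂ y).symm z : ℂ) := hz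
  have : writtenInExtChartAt 𝓘(𝕜, ℂ) 𝓘(𝕜, V) y f z = f ((chartAt ℂ y).symm z) := rfl
  rw [this, hz2, ← hz']

lemma mdifferentiableAt_opens_iff {𝕜 : Type*} [NontriviallyNormedField 𝕜] [NormedSpace 𝕜 ℂ]
    [NormedSpace 𝕜 V] {f : Ω → V} {F : ℂ → V} {y : Ω} (h : f =ᶠ[𝓝 y] fun y => F y.1) :
    MDifferentiableAt 𝓘(𝕜, ℂ) 𝓘(𝕜, V) f y ↔ DifferentiableAt 𝕜 F y.1 := by
  have hw := writtenInExtChartAt_opens (𝕜 := 𝕜) h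
  have hd : DifferentiableWithinAt 𝕜 (writtenInExtChartAt 𝓘(𝕜, ℂ) 𝓘(𝕜, V) y f)
      (Set.range 𝓘(𝕜, ℂ)) (extChartAt 𝓘(𝕜, ℂ) y y) ↔ DifferentiableAt 𝕜 F y.1 := by
    rw [ModelWithCorners.range_eq_univ, differentiableWithinAt_univ]
    exact hw.differentiableAt_iff
  rw [mdifferentiableAt_iff, hd]
  refine ⟨fun h => h.2, fun hF => ⟨?_, hF⟩⟩
  exact (ContinuousAt.comp (g := F) hF.continuousAt continuous_subtype_val.continuousAt).congr h.symm

lemma mfderiv_opens {f : Ω → ℂ} {F : ℂ → ℂ} {y : Ω} (h : f =ᶠ[𝓝 y] fun y => F y.1)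
    (hF : DifferentiableAt ℝ F y.1) (v : ℂ) :
    (show ℂ →L[ℝ] ℂ from mfderiv 𝓘(ℝ, ℂ) 𝓘(ℝ, ℂ) f y) v = fderiv ℝ F y.1 v := by
  have hw := writtenInExtChartAt_opens (𝕜 := ℝ) h
  have hm := (mdifferentiableAt_opens_iff (𝕜 := ℝ) h).2 hF
  rw [hm.mfderiv]
  have : fderivWithin ℝ (writtenInExtChartAt 𝓘(ℝ, ℂ) 𝓘(ℝ, ℂ) y f) (Set.range 𝓘(ℝ, ℂ))
      (extChartAt 𝓘(ℝ, ℂ) y y) = fderiv ℝ F y.1 := by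
    rw [ModelWithCorners.range_eq_univ, fderivWithin_univ]
    exact hw.fderiv_eq
  exact congrArg (fun L : ℂ →L[ℝ] ℂ => L v) this

variable {f : Ω → ℂ} {F : ℂ → ℂ} {x y : Ω}

lemma dz_eq_wirt (h : ∀ᶠ w : Ω in 𝓝 y, f w = F (w - x))
    (hF : DifferentiableAt ℝ F ((y : ℂ) - x)) : dz f y = wirt F ((y : ℂ) - x) := by
  have hF' : DifferentiableAt ℝ (fun w : ℂ => F (w - x)) (y : ℂ) :=
    hF.comp (y : ℂ) (differentiableAt_id.sub_const _)
  have h1 := mfderiv_opens (F := fun w => F (w - x)) h hF'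
  rw [fderiv_comp_sub] at h1
  rw [wirt, ← h1, ← h1]
  rfl

lemma dzbar_eq_wirtBar (h : ∀ᶠ w : Ω in 𝓝 y, f w = F (w - x))
    (hF : DifferentiableAt ℝ F ((y : ℂ) - x)) : dzbar f y = wirtBar F ((y : ℂ) - x) := by
  have hF' : DifferentiableAt ℝ (fun w : ℂ => F (w - x)) (y : ℂ) :=
    hF.comp (y : ℂ) (differentiableAt_id.sub_const _)
  have h1 := mfderiv_opens (F := fun w => F (w - x)) h hF'
  rw [fderiv_comp_sub] at h1
  rw [wirtBar, ← h1, ← h1]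
  rfl

/-- Translation by `-x` maps the Lebesgue measure of a disc in `Ω` to Lebesgue measure. -/
lemma map_lebesgue_restrict_ball {r : ℝ} (hr : ball (x : ℂ) r ⊆ Ω) :
    Measure.map (fun y : Ω => (y : ℂ) - x) ((lebesgue Ω).restrict (ball x r)) =
      volume.restrict (ball 0 r) := by
  have hm : MeasurableSet (Ω : Set ℂ) := Ω.isOpen.measurableSet
  have e1 : (fun y : Ω => (y : ℂ) - x) = (fun z : ℂ => z - x) ∘ Subtype.val := rfl
  have e2 : ball x r = Subtype.val ⁻¹' ball (x : ℂ) r := rfl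
  rw [e1, ← Measure.map_map (by fun_prop) measurable_subtype_coe, e2,
    ← Measure.restrict_map measurable_subtype_coe measurableSet_ball, lebesgue]
  have e3 : Measure.map (Subtype.val : Ω → ℂ) (Measure.comap Subtype.val volume) =
    volume.restrict (Ω : Set ℂ) := map_comap_subtype_coe hm volume
  rw [e3, Measure.restrict_restrict measurableSet_ball, Set.inter_eq_left.2 hr]
  have e4 : ball (x : ℂ) r = (fun z : ℂ => z - x) ⁻¹' ball 0 r := by
    ext z; simp [dist_eq_norm]
  rw [e4, ← Measure.restrict_map (by fun_prop) measurableSet_ball,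
    (measurePreserving_sub_right volume (x : ℂ)).map_eq]

lemma measurableEmbedding_sub (x : Ω) : MeasurableEmbedding fun y : Ω => (y : ℂ) - x :=
  (measurableEmbedding_subRight (x : ℂ)).comp
    (MeasurableEmbedding.subtype_coe Ω.isOpen.measurableSet)

variable {g : Ω → ℝ} {G : ℂ → ℝ} {r : ℝ}

lemma integral_ball_lebesgue (hr : ball (x : ℂ) r ⊆ Ω) (h : ∀ y ∈ ball x r, g y = G (y - x)) :
    ∫ y in ball x r, g y ∂(lebesgue Ω) = ∫ z in ball 0 r, G z := by
  rw [← map_lebesgue_restrict_ball hr, (measurableEmbedding_sub x).integral_map]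
  exact setIntegral_congr_fun measurableSet_ball h

lemma integrableOn_ball_lebesgue (hr : ball (x : ℂ) r ⊆ Ω) (h : ∀ y ∈ ball x r, g y = G (y - x)) :
    IntegrableOn g (ball x r) (lebesgue Ω) ↔ IntegrableOn G (ball 0 r) := by
  rw [IntegrableOn, IntegrableOn, ← map_lebesgue_restrict_ball hr,
    (measurableEmbedding_sub x).integrable_map_iff]
  exact integrableOn_congr_fun h measurableSet_ball

lemma ball_subset_opens {r : ℝ} (hr : ball (x : ℂ) r ⊆ Ω) {z : ℂ} (hz : z ∈ ball (0 : ℂ) r) :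
    (x : ℂ) + z ∈ Ω := hr (by simpa [dist_eq_norm] using hz)

end Opens

/-! ### Extension of local metrics to the plane -/

section Cutoff

lemma contDiff_mul_of_tsupport {χ f : ℂ → ℂ} (hχ : ContDiff ℝ ∞ χ)
    (hf : ∀ z ∈ tsupport χ, ContDiffAt ℝ ∞ f z) : ContDiff ℝ ∞ fun z => χ z * f z := by
  rw [contDiff_iff_contDiffAt]
  intro z
  by_cases hz : z ∈ tsupport χ
  · exact hχ.contDiffAt.mul (hf z hz)
  · have : (fun z => χ z * f z) =ᶠ[𝓝 z] fun _ => 0 := by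
      filter_upwards [notMem_tsupport_iff_eventuallyEq.1 hz] with w hw
      simp [hw]
    exact contDiffAt_const.congr_of_eventuallyEq this

variable {ι : Type*} [DecidableEq ι]

/-- A positive matrix function that is smooth near a disc agrees on a smaller disc with a globally
defined one. -/
lemma exists_global_metric {G : ℂ → Matrix ι ι ℂ} {R : ℝ} (hR : 0 < R)
    (hG : ∀ z ∈ ball (0 : ℂ) R, ∀ i j, ContDiffAt ℝ ∞ (fun z => G z i j) z)
    (hGp : ∀ z ∈ ball (0 : ℂ) R, (G z).PosDef) :
    ∃ H : ℂ → Matrix ι ι ℂ, SmoothM H ∧ (∀ z, (H z).PosDef) ∧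
      ∀ z ∈ ball (0 : ℂ) (R / 4), H z = G z := by
  let χ : ContDiffBump (0 : ℂ) := ⟨R / 4, R / 2, by positivity, by linarith⟩
  have hχ : ContDiff ℝ ∞ fun z : ℂ => ((χ z : ℝ) : ℂ) := ofRealCLM.contDiff.comp χ.contDiff
  have hsub : tsupport (fun z : ℂ => ((χ z : ℝ) : ℂ)) ⊆ ball 0 R := by
    refine (closure_mono (fun z hz => ?_)).trans (χ.tsupport_eq.subset.trans
      (closedBall_subset_ball (by show R / 2 < R; linarith)))
    simpa using hz
  -- A convex combination with the identity matrix stays positive definite.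
  refine ⟨fun z => ((χ z : ℝ) : ℂ) • G z + (1 - ((χ z : ℝ) : ℂ)) • (1 : Matrix ι ι ℂ),
    SmoothM.add (fun i j => ?_) (SmoothM.smul (contDiff_const.sub hχ) (SmoothM.const _)),
    fun z => ?_, fun z hz => ?_⟩
  · simp only [Matrix.smul_apply, smul_eq_mul]
    exact contDiff_mul_of_tsupport hχ fun z hz => hG z (hsub hz) i j
  · by_cases hz : χ z = 0
    · simp [hz, Matrix.PosDef.one]
    · have hz' : z ∈ ball (0 : ℂ) R := hsub (subset_tsupport _ (by simpa using hz))
      have h0 : 0 < χ z := lt_of_le_of_ne χ.nonneg (Ne.symm hz)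
      refine ((hGp z hz').smul (by exact_mod_cast h0)).add_posSemidef
        (Matrix.PosSemidef.one.smul ?_)
      have := χ.le_one (x := z)
      rw [← ofReal_one, ← ofReal_sub]
      exact_mod_cast sub_nonneg.2 this
  · have : χ z = 1 := χ.one_of_mem_closedBall (ball_subset_closedBall hz)
    simp [this]

end Cutoff

end L2Extension

/-! ### Local frames of the bundle -/

namespace L2Extension

open Complex ComplexConjugate Metric Matrix
open scoped ComplexOrder

namespace HermitianMetric

variable {Ω : Opens ℂ} {n : ℕ} {E : Ω → Type*}
  [∀ x, AddCommGroup (E x)] [∀ x, Module ℂ (E x)] [∀ x, TopologicalSpace (E x)]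
  [TopologicalSpace (TotalSpace (Fin n → ℂ) E)]
  [FiberBundle (Fin n → ℂ) E]
  (h : HermitianMetric n E)
  (e : Trivialization (Fin n → ℂ) (π (Fin n → ℂ) E)) {x y : Ω}

lemma gram_isHermitian (y : Ω) :
    (h.gram e y).IsHermitian := by
  ext i j
  rw [conjTranspose_apply]
  exact (h.conj_symm y _ _).symm

/-- The connection matrix of a smooth matrix function. -/
noncomputable def chernConnection (H : ℂ → Matrix (Fin n) (Fin n) ℂ) (z : ℂ) : Matrix (Fin n) (Fin n) ℂ :=
  wirtM H z * (H z)⁻¹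

variable {e}

section Local

variable {R : ℝ} {H : ℂ → Matrix (Fin n) (Fin n) ℂ}

lemma smoothM_chernConnection (hH : SmoothM H) (hHp : ∀ z, (H z).PosDef) :
    SmoothM (chernConnection H) := hH.wirtM.mul (hH.inv_of_posDef hHp)

lemma wirtM_eq_chernConnection_mul (hHp : ∀ z, (H z).PosDef) (z : ℂ) :
    wirtM H z = chernConnection H z * H z := by
  rw [chernConnection, Matrix.mul_assoc,
    Matrix.nonsing_inv_mul _ ((isUnit_iff_isUnit_det _).1 (hHp z).isUnit), Matrix.mul_one]

lemma connectionMatrix_eq (hH : SmoothM H) (hHg : ∀ y ∈ ball x R, h.gram e y = H (y - x)) :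
    ∀ y ∈ ball x R, h.connectionMatrix e y = chernConnection H (y - x) := fun y hy => by
  rw [connectionMatrix, chernConnection, hHg y hy]
  congr 1
  ext i j
  refine dz_eq_wirt (F := fun z => H z i j) ?_ (hH.differentiableAt i j)
  filter_upwards [isOpen_ball.mem_nhds hy] with w hw
  rw [hHg w hw]

lemma curvatureMatrix_eq (hH : SmoothM H) (hHp : ∀ z, (H z).PosDef)
    (hHg : ∀ y ∈ ball x R, h.gram e y = H (y - x)) :
    ∀ y ∈ ball x R, h.curvatureMatrix e y = -wirtBarM (chernConnection H) (y - x) := fun y hy => by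
  ext i j
  rw [curvatureMatrix, Matrix.of_apply, Matrix.neg_apply]
  congr 1
  refine dzbar_eq_wirtBar (F := fun z => chernConnection H z i j) ?_
    ((smoothM_chernConnection hH hHp).differentiableAt i j)
  filter_upwards [isOpen_ball.mem_nhds hy] with w hw
  rw [h.connectionMatrix_eq hH hHg w hw]

end Local

variable (e) [VectorBundle ℂ (Fin n → ℂ) E] [MemTrivializationAtlas e]

/-- The row of coordinates of a vector with respect to the frame defined by a trivialization. -/
noncomputable def coords (y : Ω) (v : E y) : Matrix Unit (Fin n) ℂ := Matrix.of fun _ => e.linearMapAt ℂ y v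

variable {e}

lemma symmₗ_coords (hy : y ∈ e.baseSet) (v : E y) : e.symmₗ ℂ y (coords e y v ()) = v :=
  e.symmₗ_linearMapAt hy v

lemma coords_symmₗ (hy : y ∈ e.baseSet) (c : Fin n → ℂ) :
    coords e y (e.symmₗ ℂ y c) = Matrix.of fun _ => c := by
  ext i j
  simp [coords, e.linearMapAt_symmₗ hy]

lemma coords_injective (hy : y ∈ e.baseSet) : Function.Injective (coords e y) := fun v w hvw => by
  rw [← symmₗ_coords hy v, hvw, symmₗ_coords hy w]

lemma coords_ne_zero (hy : y ∈ e.baseSet) {v : E y} (hv : v ≠ 0) : coords e y v ≠ 0 := fun h0 => by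
  refine hv (coords_injective hy (h0.trans ?_))
  ext i j
  simp [coords]

lemma form_eq_herm (hy : y ∈ e.baseSet) (v w : E y) :
    h.form y v w = herm (h.gram e y) (coords e y v) (coords e y w) := by
  have hs : ∀ v : E y, v = ∑ i, coords e y v () i • e.symm y (Pi.single i 1) := fun v => by
    conv_lhs => rw [← symmₗ_coords hy v, pi_eq_sum_univ' (coords e y v ()), map_sum]
    refine Finset.sum_congr rfl fun i _ => ?_
    rw [map_smul, e.symmₗ_apply hy]
  conv_lhs => rw [hs v, hs w]
  rw [herm_eq_sum]
  simp only [map_sum, LinearMap.sum_apply, map_smul, LinearMap.smul_apply, LinearMap.map_smulₛₗ,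
    smul_eq_mul, gram, Matrix.of_apply, Finset.sum_mul, Finset.mul_sum]
  refine Finset.sum_congr rfl fun j _ => Finset.sum_congr rfl fun i _ => ?_
  ring

lemma gram_posDef (hy : y ∈ e.baseSet) : (h.gram e y).PosDef := by
  refine PosDef.of_dotProduct_mulVec_pos (h.gram_isHermitian e y) fun c hc => ?_
  -- The form is linear in its first slot and coordinates are rows, so the quadratic form `c*Hc` is
  -- the squared norm of the vector with conjugate coordinates.
  set v := e.symmₗ ℂ y (star c) with hv
  have hcv : coords e y v = Matrix.of fun _ => star c := coords_symmₗ hy _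
  have hv0 : v ≠ 0 := fun h0 => hc (by
    ext j
    have h1 : coords e y v () j = 0 := by simp [h0, coords]
    rw [hcv] at h1
    simpa using h1)
  have h2 : star c ⬝ᵥ h.gram e y *ᵥ c = h.form y v v := by
    rw [h.form_eq_herm hy, hcv, herm, Matrix.mul_assoc, Matrix.mul_apply]
    simp [dotProduct, mulVec, Matrix.mul_apply]
  rw [h2, Complex.lt_def]
  refine ⟨h.pos y v hv0, ?_⟩
  have := congrArg Complex.im (h.conj_symm y v v)
  simp at this
  simp; linarith

variable (e) in
/-- Around a point of the base set, the Gram matrix is the restriction of a smooth positive matrix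
function on the plane. -/
lemma exists_local_metric (hx : x ∈ e.baseSet) :
    ∃ (R : ℝ) (H : ℂ → Matrix (Fin n) (Fin n) ℂ), 0 < R ∧ ball (x : ℂ) R ⊆ Ω ∧
      (∀ y ∈ ball x R, y ∈ e.baseSet) ∧ SmoothM H ∧ (∀ z, (H z).PosDef) ∧
      ∀ y ∈ ball x R, h.gram e y = H (y - x) := by
  obtain ⟨R₁, hR₁, h1⟩ := Metric.isOpen_iff.1 Ω.isOpen x x.2
  obtain ⟨R₂, hR₂, h2⟩ := Metric.isOpen_iff.1 e.open_baseSet x hx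
  set R := min R₁ R₂ with hR
  have hR0 : 0 < R := lt_min hR₁ hR₂
  have hRΩ : ball (x : ℂ) R ⊆ Ω := (ball_subset_ball (min_le_left _ _)).trans h1
  have hRe : ∀ y ∈ ball x R, y ∈ e.baseSet := fun y hy => h2 (ball_subset_ball (min_le_right _ _) hy)
  classical
  set G : ℂ → Matrix (Fin n) (Fin n) ℂ := fun z =>
    if hz : (x : ℂ) + z ∈ Ω then h.gram e ⟨x + z, hz⟩ else 1 with hG
  have hGy : ∀ y : Ω, G (y - x) = h.gram e y := fun y => by simp [hG]
  have hmem : ∀ z (hz : z ∈ ball (0 : ℂ) R), (⟨x + z, ball_subset_opens hRΩ hz⟩ : Ω) ∈ ball x R :=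
    fun z hz => by
      rw [mem_ball, Subtype.dist_eq]
      simpa [dist_eq_norm] using hz
  have hGz : ∀ z (hz : z ∈ ball (0 : ℂ) R), G z = h.gram e ⟨x + z, ball_subset_opens hRΩ hz⟩ :=
    fun z hz => by rw [← hGy]; simp
  have hG1 : ∀ z ∈ ball (0 : ℂ) R, ∀ i j, ContDiffAt ℝ ∞ (fun z => G z i j) z := fun z hz i j => by
    have hyb := hRe _ (hmem z hz)
    have hs := (h.smooth e (Pi.single i 1) (Pi.single j 1)).contMDiffAt
      (e.open_baseSet.mem_nhds hyb)
    let g : ℂ → ℂ := fun w => G (w - x) i j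
    have hg : ∀ w, g w = G (w - x) i j := fun w => rfl
    have h3 : (fun y : Ω => h.form y (e.symm y (Pi.single i 1)) (e.symm y (Pi.single j 1))) =
        fun y : Ω => g y := by
      ext y
      simp only [hg, hGy]; rfl
    rw [h3] at hs
    have hs' := (contMDiffAt_subtype_iff (f := g) (n := ∞) (I := 𝓘(ℝ, ℂ)) (I' := 𝓘(ℝ, ℂ))).1 hs
    rw [contMDiffAt_iff_contDiffAt] at hs'
    have h4 : (fun z => G z i j) = g ∘ fun z => x + z := by
      ext z; simp [hg]
    rw [h4]
    exact ContDiffAt.comp z hs' (contDiffAt_const.add contDiffAt_id)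
  have hG2 : ∀ z ∈ ball (0 : ℂ) R, (G z).PosDef := fun z hz => by
    rw [hGz z hz]
    exact h.gram_posDef (hRe _ (hmem z hz))
  obtain ⟨H, hH, hHp, hHG⟩ := exists_global_metric (G := G) hR0 hG1 hG2
  refine ⟨R / 4, H, by positivity, (ball_subset_ball (by linarith)).trans hRΩ,
    fun y hy => hRe y (ball_subset_ball (by linarith) hy), hH, hHp, fun y hy => ?_⟩
  rw [hHG _ (by simpa [dist_eq_norm, Subtype.dist_eq] using hy), hGy]

section Local

variable {R : ℝ} {H : ℂ → Matrix (Fin n) (Fin n) ℂ}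

variable [ContMDiffVectorBundle 1 (Fin n → ℂ) E 𝓘(ℂ, ℂ)] {r : ℝ}

lemma isL2Holomorphic_iff (hRΩ : ball (x : ℂ) R ⊆ Ω) (hRe : ∀ y ∈ ball x R, y ∈ e.baseSet)
    (hHg : ∀ y ∈ ball x R, h.gram e y = H (y - x)) (hr : r ≤ R)
    {s : ∀ y, E y} {s' : ℂ → Matrix Unit (Fin n) ℂ}
    (hs : ∀ y ∈ ball x r, coords e y (s y) = s' (y - x)) :
    (h.IsL2Holomorphic x r s ↔ (∀ j, DifferentiableOn ℂ (fun z => s' z () j) (ball 0 r)) ∧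
      IntegrableOn (fun z => (herm (H z) (s' z) (s' z)).re) (ball 0 r)) ∧
    ∫ y in ball x r, h.normSq y (s y) ∂(lebesgue Ω) =
      ∫ z in ball 0 r, (herm (H z) (s' z) (s' z)).re := by
  have hre : ball x r ⊆ e.baseSet := fun y hy => hRe y (ball_subset_ball hr hy)
  have hrΩ : ball (x : ℂ) r ⊆ Ω := (ball_subset_ball hr).trans hRΩ
  have hn : ∀ y ∈ ball x r, h.normSq y (s y) =
      (fun z => (herm (H z) (s' z) (s' z)).re) (y - x) := fun y hy => by
    simp only [normSq]
    rw [h.form_eq_herm (hre hy), hs y hy, hHg y (ball_subset_ball hr hy)]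
  refine ⟨and_congr ?_ (integrableOn_ball_lebesgue hrΩ hn), integral_ball_lebesgue hrΩ hn⟩
  rw [e.mdifferentiableOn_section_iff isOpen_ball hre]
  have hpt : ∀ y ∈ ball x r, (MDifferentiableAt 𝓘(ℂ, ℂ) 𝓘(ℂ, Fin n → ℂ) (fun y => (e ⟨y, s y⟩).2) y ↔
      ∀ j, DifferentiableAt ℂ (fun z => s' z () j) (y - x)) := fun y hy => by
    have h1 : (fun y : Ω => (e ⟨y, s y⟩).2) =ᶠ[𝓝 y] fun y => (fun (w : ℂ) j => s' (w - x) () j) y.1 := by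
      filter_upwards [isOpen_ball.mem_nhds hy] with w hw
      ext j
      rw [← hs w hw, coords, e.linearMapAt_def_of_mem (hre hw)]
      rfl
    rw [mdifferentiableAt_opens_iff (𝕜 := ℂ) (F := fun (w : ℂ) j => s' (w - x) () j) h1,
      differentiableAt_pi]
    refine forall_congr' fun j => ?_
    exact (differentiableAt_comp_sub (f := fun z => s' z () j) (x : ℂ))
  constructor
  · intro hd j z hz
    have hy : (⟨x + z, ball_subset_opens hrΩ hz⟩ : Ω) ∈ ball x r := by
      rw [mem_ball, Subtype.dist_eq]
      simpa [dist_eq_norm] using hz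
    have := (hpt _ hy).1 ((hd _ hy).mdifferentiableAt (isOpen_ball.mem_nhds hy)) j
    simp only [add_sub_cancel_left] at this
    exact this.differentiableWithinAt
  · intro hd y hy
    refine ((hpt y hy).2 fun j => ?_).mdifferentiableWithinAt
    have hz : (y : ℂ) - x ∈ ball (0 : ℂ) r := by simpa [dist_eq_norm, Subtype.dist_eq] using hy
    exact (hd j _ hz).differentiableAt (isOpen_ball.mem_nhds hz)

/-- The extension index in a local frame. -/
lemma extensionIndex_eq_coordIndex (hRΩ : ball (x : ℂ) R ⊆ Ω) (hRe : ∀ y ∈ ball x R, y ∈ e.baseSet)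
    (hHg : ∀ y ∈ ball x R, h.gram e y = H (y - x)) (hr0 : 0 < r) (hr : r ≤ R) (ξ : E x) :
    h.extensionIndex x r ξ = coordIndex H r (coords e x ξ) := by
  have hx : x ∈ ball x r := mem_ball_self hr0
  have hxe := hRe x (ball_subset_ball hr hx)
  have hN : h.normSq x ξ = (herm (H 0) (coords e x ξ) (coords e x ξ)).re := by
    rw [normSq, h.form_eq_herm hxe, hHg x (ball_subset_ball hr hx), sub_self]
  rw [extensionIndex, coordIndex, hN]
  congr 1
  ext t
  constructor
  · rintro ⟨s, hs, rfl, rfl⟩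
    classical
    set s' : ℂ → Matrix Unit (Fin n) ℂ := fun z =>
      if hz : (x : ℂ) + z ∈ Ω then coords e ⟨x + z, hz⟩ (s ⟨x + z, hz⟩) else 0 with hs'
    have hc : ∀ y : Ω, coords e y (s y) = s' (y - x) := fun y => by
      have hz : (x : ℂ) + (y - x) ∈ Ω := by simp
      have h1 : s' (y - x) = coords e ⟨x + (y - x), hz⟩ (s ⟨x + (y - x), hz⟩) := dif_pos hz
      have h2 : ∀ w : Ω, w = y → coords e y (s y) = coords e w (s w) := by rintro w rfl; rfl
      rw [h1]
      exact h2 _ (Subtype.ext (by simp))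
    obtain ⟨h1, h2⟩ := h.isL2Holomorphic_iff hRΩ hRe hHg hr (s := s) (s' := s') fun y _ => hc y
    have h3 := h1.1 hs
    exact ⟨s', ⟨h3.1, h3.2, by rw [hc x, sub_self]⟩, by rw [h2]⟩
  · rintro ⟨s', ⟨h1, h2, h3⟩, rfl⟩
    set s : ∀ y, E y := fun y => e.symmₗ ℂ y (s' (y - x) ()) with hs
    have hc : ∀ y ∈ ball x r, coords e y (s y) = s' (y - x) := fun y hy => by
      rw [hs, coords_symmₗ (hRe y (ball_subset_ball hr hy))]
      rfl
    obtain ⟨h4, h5⟩ := h.isL2Holomorphic_iff hRΩ hRe hHg hr hc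
    refine ⟨s, h4.2 ⟨h1, h2⟩, coords_injective hxe ?_, by rw [h5]⟩
    rw [hc x hx, sub_self, h3]

end Local

end HermitianMetric

end L2Extension

/-! ### Extension index, curvature and the equivalence -/

namespace L2Extension

open Complex ComplexConjugate Metric Matrix
open scoped ComplexOrder

section Radius

variable {Ω : Opens ℂ}

/-- Boundedness of `Ω` matters here: the real supremum of a set that is not bounded above is `0` by
convention. -/
lemma discRadius_pos (hΩ : Bornology.IsBounded (Ω : Set ℂ)) (a : Ω) : 0 < discRadius a := by
  obtain ⟨ρ, hρ, hρΩ⟩ := Metric.isOpen_iff.1 Ω.isOpen a a.2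
  obtain ⟨D, hD⟩ := hΩ.subset_closedBall (a : ℂ)
  refine hρ.trans_le (le_csSup ⟨D, ?_⟩ ⟨hρ, hρΩ⟩)
  rintro r ⟨hr, hrΩ⟩
  -- The disc is open, so `r ≤ D` is tested on points at distance `(t+r)/2 < r` from the centre.
  refine le_of_forall_lt fun t ht => lt_of_lt_of_le (?_ : t < (t + r) / 2) ?_
  · linarith
  rcases lt_or_ge ((t + r) / 2) 0 with h0 | h0
  · exact h0.le.trans (nonneg_of_mem_closedBall (hD a.2))
  · have hmem : (a : ℂ) + (((t + r) / 2 : ℝ) : ℂ) ∈ ball (a : ℂ) r := by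
      rw [mem_ball, dist_eq_norm, add_sub_cancel_left, norm_real, Real.norm_of_nonneg h0]
      linarith
    have := hD (hrΩ hmem)
    rwa [mem_closedBall, dist_eq_norm, add_sub_cancel_left, norm_real, Real.norm_of_nonneg h0]
      at this

lemma exists_lt_discRadius (hΩ : Bornology.IsBounded (Ω : Set ℂ)) (a : Ω) {P : ℝ → Prop}
    (hP : ∀ᶠ r in 𝓝[>] (0 : ℝ), P r) :
    ∃ r₀ : ℝ, 0 < r₀ ∧ r₀ < discRadius a ∧ ∀ r : ℝ, 0 < r → r < r₀ → P r := by
  obtain ⟨u, hu, hP⟩ := mem_nhdsGT_iff_exists_Ioo_subset.1 hP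
  have hδ := discRadius_pos hΩ a
  have hu0 : 0 < u := hu
  refine ⟨min u (discRadius a / 2), lt_min hu0 (by linarith),
    (min_le_right _ _).trans_lt (by linarith), fun r h0 hr =>
      hP ⟨h0, hr.trans_le (min_le_left _ _)⟩⟩

end Radius

namespace HermitianMetric

variable {Ω : Opens ℂ} {n : ℕ} {E : Ω → Type*}
  [∀ x, AddCommGroup (E x)] [∀ x, Module ℂ (E x)] [∀ x, TopologicalSpace (E x)]
  [TopologicalSpace (TotalSpace (Fin n → ℂ) E)]
  [FiberBundle (Fin n → ℂ) E] [VectorBundle ℂ (Fin n → ℂ) E]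
  (h : HermitianMetric n E)

lemma form_curvature (x : Ω) (ξ : E x) :
    h.form x (h.curvature x ξ) ξ = herm (h.gram (trivializationAt (Fin n → ℂ) E x) x)
      (coords (trivializationAt (Fin n → ℂ) E x) x ξ *
        h.curvatureMatrix (trivializationAt (Fin n → ℂ) E x) x)
      (coords (trivializationAt (Fin n → ℂ) E x) x ξ) := by
  have hx := mem_baseSet_trivializationAt (Fin n → ℂ) E x
  rw [h.form_eq_herm hx]
  congr 1
  exact coords_symmₗ hx _

variable [ContMDiffVectorBundle 1 (Fin n → ℂ) E 𝓘(ℂ, ℂ)]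
  {e : Trivialization (Fin n → ℂ) (π (Fin n → ℂ) E)} [MemTrivializationAtlas e] {x : Ω}

/-- The second order expansion of the extension index, in terms of the curvature matrix of a
local frame. -/
lemma tendsto_extensionIndex_frame (hx : x ∈ e.baseSet) {ξ : E x} (hξ : ξ ≠ 0) :
    Filter.Tendsto (fun r => (h.extensionIndex x r ξ - 1) / r ^ 2) (𝓝[>] 0)
      (𝓝 (-(herm (h.gram e x) (coords e x ξ * h.curvatureMatrix e x) (coords e x ξ)).re /
        (2 * h.normSq x ξ))) := by
  obtain ⟨R, H, hR, hRΩ, hRe, hH, hHp, hHg⟩ := h.exists_local_metric e hx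
  have h1 := tendsto_coordIndex hH hHp (smoothM_chernConnection hH hHp)
    (wirtM_eq_chernConnection_mul hHp) (coords_ne_zero hx hξ)
  have hxR := mem_ball_self (x := x) hR
  have h2 := h.curvatureMatrix_eq hH hHp hHg x hxR
  have h3 := hHg x hxR
  rw [sub_self] at h2 h3
  rw [normSq, h.form_eq_herm hx, h2, h3]
  have h4 : ∀ M : Matrix (Fin n) (Fin n) ℂ, -(herm (H 0) (coords e x ξ * -M) (coords e x ξ)).re =
      (herm (H 0) (coords e x ξ * M) (coords e x ξ)).re := fun M => by
    simp [herm, Matrix.neg_mul]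
  rw [h4]
  refine h1.congr' ?_
  filter_upwards [Ioo_mem_nhdsGT hR] with r hr
  rw [h.extensionIndex_eq_coordIndex hRΩ hRe hHg hr.1 hr.2.le]

/-- The second order expansion of the extension index. -/
theorem tendsto_extensionIndex {ξ : E x} (hξ : ξ ≠ 0) :
    Filter.Tendsto (fun r => (h.extensionIndex x r ξ - 1) / r ^ 2) (𝓝[>] 0)
      (𝓝 (-(h.form x (h.curvature x ξ) ξ).re / (2 * h.normSq x ξ))) := by
  rw [form_curvature]
  exact h.tendsto_extensionIndex_frame (mem_baseSet_trivializationAt (Fin n → ℂ) E x) hξ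

/-- The curvature form can be computed in any local frame. -/
lemma form_curvature_frame (hx : x ∈ e.baseSet) (ξ : E x) :
    (herm (h.gram e x) (coords e x ξ * h.curvatureMatrix e x) (coords e x ξ)).re =
      (h.form x (h.curvature x ξ) ξ).re := by
  by_cases hξ : ξ = 0
  · have : coords e x ξ = 0 := by ext i j; simp [hξ, coords]
    rw [this]; simp [hξ]
  -- The extension index involves no frame, so neither does its second order limit, which determines
  -- the curvature form; no transformation rule is needed.
  · have := tendsto_nhds_unique (h.tendsto_extensionIndex_frame hx hξ) (h.tendsto_extensionIndex hξ)
    have hN : 0 < h.normSq x ξ := h.pos x ξ hξ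
    field_simp at this
    linarith

/-- The extension index is at most one where the curvature is semipositive. -/
theorem eventually_extensionIndex_le_one (hc : ∀ᶠ y in 𝓝 x, h.CurvatureGE y 0) {ξ : E x}
    (hξ : ξ ≠ 0) : ∀ᶠ r in 𝓝[>] (0 : ℝ), h.extensionIndex x r ξ ≤ 1 := by
  have hx := mem_baseSet_trivializationAt (Fin n → ℂ) E x
  obtain ⟨R, H, hR, hRΩ, hRe, hH, hHp, hHg⟩ :=
    h.exists_local_metric (trivializationAt (Fin n → ℂ) E x) hx
  obtain ⟨R', hR', hc⟩ := Metric.eventually_nhds_iff_ball.1 hc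
  set ρ := min R R'
  have hρ : 0 < ρ := lt_min hR hR'
  have hρR : ρ ≤ R := min_le_left _ _
  filter_upwards [Ioo_mem_nhdsGT hρ] with r hr
  rw [h.extensionIndex_eq_coordIndex hRΩ hRe hHg hr.1 (hr.2.le.trans hρR)]
  refine coordIndex_le_one hH hHp (smoothM_chernConnection hH hHp)
    (wirtM_eq_chernConnection_mul hHp) hr.1 hr.2 (fun z hz c => ?_) (coords_ne_zero hx hξ)
  set y : Ω := ⟨x + z, ball_subset_opens hRΩ (ball_subset_ball hρR hz)⟩ with hy
  have hyz : (y : ℂ) - x = z := by simp [hy]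
  have hyρ : y ∈ ball x ρ := by
    rw [mem_ball, Subtype.dist_eq, dist_eq_norm, hyz]
    simpa using hz
  have hyR := ball_subset_ball hρR hyρ
  -- The hypothesis at `y` uses the preferred frame at `y`; it is transported to the frame at `x`,
  -- in which the extension theorem is applied.
  have h1 := h.form_curvature_frame (hRe y hyR)
    ((trivializationAt (Fin n → ℂ) E x).symmₗ ℂ y (c ()))
  have h2 := hc y (ball_subset_ball (min_le_right _ _) hyρ)
    ((trivializationAt (Fin n → ℂ) E x).symmₗ ℂ y (c ()))
  rw [zero_mul, ← h1, coords_symmₗ (hRe y hyR), h.curvatureMatrix_eq hH hHp hHg y hyR,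
    hHg y hyR, hyz] at h2
  have h3 : (Matrix.of fun _ => c () : Matrix Unit (Fin n) ℂ) = c := rfl
  rw [h3] at h2
  simp only [herm, Matrix.mul_neg, Matrix.neg_mul, Matrix.neg_apply, neg_re] at h2 ⊢
  linarith

/-- From `e^{-mr²} ≤ 1/(1 + mr²)` the quotient `(L - 1)/r²` is at most `-m/(1 + mr²)`, and letting
`r → 0` compares `-m` with the limit given by the curvature. -/
theorem SharpExtensionBound.curvatureGE {c : ℝ} (hL : h.SharpExtensionBound x c) :
    h.CurvatureGE x c := by
  intro ξ
  by_cases hξ : ξ = 0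
  · simp [hξ, normSq]
  have hN : 0 < h.normSq x ξ := h.pos x ξ hξ
  set k := (h.form x (h.curvature x ξ) ξ).re with hk
  refine le_of_forall_pos_le_add fun δ hδ => ?_
  -- With `ε = δ/|ξ|²` the loss in the final inequality is exactly `δ`.
  obtain ⟨r₀, hr₀, -, hr⟩ := hL (δ / h.normSq x ξ) (by positivity) ξ hξ
  set m := max ((c - δ / h.normSq x ξ) / 2) 0 with hm
  have hm0 : 0 ≤ m := le_max_right _ _
  have hlim : Filter.Tendsto (fun r : ℝ => -m / (1 + m * r ^ 2)) (𝓝[>] 0) (𝓝 (-m)) := by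
    have hc : Continuous fun r : ℝ => -m / (1 + m * r ^ 2) :=
      continuous_const.div (by fun_prop) fun r => by positivity
    have := (hc.tendsto 0).mono_left (nhdsWithin_le_nhds (s := Set.Ioi 0))
    simpa using this
  have hle := le_of_tendsto_of_tendsto (h.tendsto_extensionIndex hξ) hlim (by
    filter_upwards [Ioo_mem_nhdsGT hr₀] with r hr'
    have h1 := hr r hr'.1 hr'.2
    have hr0 := hr'.1
    have hp : 0 < 1 + m * r ^ 2 := by positivity
    have h2 : Real.exp (-(m * r ^ 2)) ≤ (1 + m * r ^ 2)⁻¹ := by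
      rw [Real.exp_neg]
      gcongr
      linarith [Real.add_one_le_exp (m * r ^ 2)]
    have h3 : (1 + m * r ^ 2)⁻¹ - 1 = -m / (1 + m * r ^ 2) * r ^ 2 := by field_simp; ring
    rw [div_le_iff₀ (by positivity)]
    linarith)
  have h4 : (c - δ / h.normSq x ξ) / 2 ≤ m := le_max_left _ _
  rw [div_le_iff₀ (by positivity)] at hle
  have h5 : (c - δ / h.normSq x ξ) / 2 * (2 * h.normSq x ξ) ≤ m * (2 * h.normSq x ξ) := by gcongr
  have h6 : (c - δ / h.normSq x ξ) / 2 * (2 * h.normSq x ξ) = c * h.normSq x ξ - δ := by field_simp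
  linarith

/-- If `c > 0`, then `m < c/2`, so the limit of `(L - 1)/r²` is strictly below `-m` and `L < 1 - mr²
≤ e^{-mr²}` for small `r`. If `c = 0`, then `m = 0` and the bound `L ≤ 1` is the sharp extension
theorem, which needs semipositivity on a neighbourhood. -/
theorem CurvatureGE.sharpExtensionBound (hΩ : Bornology.IsBounded (Ω : Set ℂ)) {c : ℝ}
    (hc0 : 0 ≤ c) (hc : 0 < c ∨ ∀ᶠ y in 𝓝 x, h.CurvatureGE y 0) (hk : h.CurvatureGE x c) :
    h.SharpExtensionBound x c := by
  intro ε hε ξ hξ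
  refine exists_lt_discRadius hΩ x ?_
  rcases hc0.eq_or_lt with rfl | hc0
  · have hm : max ((0 - ε) / 2) 0 = 0 := max_eq_right (by linarith)
    simp only [hm, zero_mul, neg_zero, Real.exp_zero]
    exact h.eventually_extensionIndex_le_one (hc.resolve_left (lt_irrefl 0)) hξ
  · have hN : 0 < h.normSq x ξ := h.pos x ξ hξ
    set m := max ((c - ε) / 2) 0 with hm
    have hmc : m < c / 2 := max_lt (by linarith) (by linarith)
    have hlt : -(h.form x (h.curvature x ξ) ξ).re / (2 * h.normSq x ξ) < -m := by
      rw [div_lt_iff₀ (by positivity)]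
      nlinarith [hk ξ]
    filter_upwards [(h.tendsto_extensionIndex hξ).eventually_lt_const hlt, self_mem_nhdsWithin]
      with r hr (hr0 : 0 < r)
    rw [div_lt_iff₀ (by positivity)] at hr
    have := Real.add_one_le_exp (-(m * r ^ 2))
    linarith

end HermitianMetric

end L2Extension

theorem mainTheorem8 {n : ℕ} {Ω : TopologicalSpace.Opens ℂ}
    (hΩ : IsConnected (Ω : Set ℂ)) (hΩb : Bornology.IsBounded (Ω : Set ℂ))
    (E : Ω → Type*)
    [∀ x, AddCommGroup (E x)] [∀ x, Module ℂ (E x)] [∀ x, TopologicalSpace (E x)]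
    [TopologicalSpace (TotalSpace (Fin n → ℂ) E)]
    [FiberBundle (Fin n → ℂ) E] [VectorBundle ℂ (Fin n → ℂ) E]
    [ContMDiffVectorBundle ω (Fin n → ℂ) E 𝓘(ℂ, ℂ)]
    (h : L2Extension.HermitianMetric n E)
    (g : Ω → ℝ) (hg : ∀ x, 0 ≤ g x) (a : Ω) :
    (h.SharpExtensionBound a (g a) → h.CurvatureGE a (g a)) ∧
    ((0 < g a ∨ ∀ᶠ x in 𝓝 a, h.CurvatureGE x 0) →
      (h.SharpExtensionBound a (g a) ↔ h.CurvatureGE a (g a))) := by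
  have : ContMDiffVectorBundle 1 (Fin n → ℂ) E 𝓘(ℂ, ℂ) :=
    ContMDiffVectorBundle.of_le (n := ω) le_top
  exact ⟨fun hL => hL.curvatureGE, fun hc => ⟨fun hL => hL.curvatureGE,
    fun hk => hk.sharpExtensionBound h hΩb (hg a) hc⟩⟩
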